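/- **Setting.** All quantities depend on the dimension $d\to\infty$; $O,\Theta,o,\ll,\gg$ refer to this limit, and $\ll,\gg$ are uniform over hidden nodes. Let $k\ge 2$ be the sparsity parameter, $m^*\ge 2$ an integer, $H\gg d$ the number of hidden nodes, and $k\,m^*\log^2 d=o(d)$ (in particular $m^*=o(d/k)$). *Data.* $X\in\mathbb R^d$ has i.i.d. symmetric coordinates with $|X_i|\in\{0\}\cup[1/\sqrt k,1]$, $P(X_i\ne0)=\Theta(k/d)$, $\mathbb EX_i^2=\Theta(1/d)$, $\mathbb E|X_i|=\Theta(\sqrt k/d)$ and $\mathbb E|X_i|^3=\Theta(1/(d\sqrt k))$. One observes $Z=MX+\xi$ with $M$ orthogonal and $\xi\sim N(0,\zeta^2I_d/d)$ independent of $X$, $\zeta>0$ fixed. The coordinates of $\theta_0\in\mathbb R^d$ satisfy $|(\theta_0)_i|=\Theta(1)$ uniformly in $i$. In regression (square loss $(f-y)^2$, absolute loss $|f-y|$) $Y=\theta_0^\top X+N(0,s^2)$ with independent noise and fixed $s>0$; in classification $P(Y=1\mid X,\xi)=1/(1+e^{\theta_0^\top X})=1-P(Y=0\mid X,\xi)$,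 with the logistic loss $\log(1+e^{(2y-1)f})$, the negative log-likelihood of this model. *Networks.* $f_{W,b}(z)=\sum_{h=1}^H\sigma(z^\top W_h,b_h)$, $\sigma(v,e)=v\,1\{|v|\ge e\}$ (all output weights $a_h=1$), and $U=M^\top W$. The class $\mathcal M$ consists of the sequences (in $d$) of networks with (1) $b_h\ll\|U_h\|/\sqrt{k\|U_h\|_0}$; (2) $b_h\gg\|U_h\|/(\sqrt{k\|U_h\|_0}\log d)\gg\|U_h\|/\sqrt d$; (3) $1\le\|U_h\|_0\le m^*$ for all $h$; (4) for each $i$ the nonzero $U_{i,h}$ have the same sign, and $|U_{i,h}|=\Theta(\gamma)$ uniformly over nonzero entries, for some scale $\gamma=\gamma_d>0$ that may depend on the sequence of networks. *Losses.* $l_\epsilon(z,y;W,b)=l(f_{W,b}(z+\delta),y)$ with $\delta=\epsilon\,\partial_z l/\|\partial_z l\|$ (no attack if the gradient is zero), where $l$ in the gradient is $z\mapsto l(f_{W,b}(z),y)$; $l_0$ is the clean loss, and $l_0(X,Y;\theta_0)=l(\theta_0^\top X,Y)$. Put $$\psi=\frac{H(m^*)^3k^3\log^2k}{d^2}+\sqrt{\frac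 kd}.$$ Since $\mathcal M$ is a class of sequences, a statement about "$L-\min_{\mathcal M}L$" means: the upper bound holds against every sequence $(W',b')\in\mathcal M$, for all large $d$, with a constant independent of $(W',b')$; the lower bound holds against at least one $(W',b')\in\mathcal M$. **Theorem.** If $Hk^3(m^*)^3=O(d^{2-\tau})$ for some $\tau>0$, then $\psi\to0$. The losses below are integrable. There are sets $S_d$ of networks, the same for all three losses, such that * (many networks) for all large $d$ the networks in $S_d$ realize at least $2^d$ different collections $\{\operatorname{supp}U_h: h\le H\}$ of feature sets; every sequence selected from the $S_d$ belongs to $\mathcal M$; and $Ua=\theta_0$, where $a=(1,\dots,1)^\top$, for all members of $S_d$, $d$ large; and for each of the square, absolute and logistic losses, with constants uniform over $(W,b)\in S_d$ and for $d$ large: * (good clean performance) $$\mathbb El_0(Z,Y;W,b)=\min_{(W',b')\in\mathcal M}\mathbb El_0(Z,Y;W',b')+O(\psi)=\mathbb El_0(X,Y;\theta_0)+O(\psi);$$ * (poor robustness) for every $\epsilon=\epsilon_d\ge0$ with $\epsilon=\Theta(1/(\log d\sqrt{m^*k}))$, $$\mathbb El_\epsilon(Z,Y;W,b)-\min_{(W',b')\in\mathcal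 M}\mathbb El_\epsilon(Z,Y;W',b')=O(\psi)+\Theta(\epsilon\sqrt{m^*k}),$$ and $\psi=o(\epsilon\sqrt{m^*k})$ if $Hk^3(m^*)^3=O(d^{2-\tau})$ for some $\tau>0$. -/

import Mathlib

open Filter Topology Asymptotics MeasureTheory ProbabilityTheory

noncomputable section

namespace FeaturePurification

/-- Vectors of `ℝᵈ` with the Euclidean norm. -/
abbrev Vec (d : ℕ) : Type := EuclideanSpace ℝ (Fin d)

/-- A two-layer network with `H` hidden nodes on `ℝᵈ`: the columns of `weight` are the first-layer
weights `W_h`, and `intercept h` is `b_h`.  The output weights are all equal to `1`. -/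
structure Network (d H : ℕ) where
  weight : Matrix (Fin d) (Fin H) ℝ
  intercept : Fin H → ℝ

/-- The gated activation `σ(v, e) = v · 1{|v| ≥ e}`. -/
def gate (v e : ℝ) : ℝ := if e ≤ |v| then v else 0

/-- `f_{W,b}(z) = ∑ₕ σ(zᵀ W_h, b_h)`. -/
def Network.predict {d H : ℕ} (N : Network d H) (z : Vec d) : ℝ :=
  ∑ h, gate (∑ i, z i * N.weight i h) (N.intercept h)

inductive LossKind where
  | square
  | absolute
  | logistic

/-- The loss of the prediction `p` at the response `y`.  For `y ∈ {0, 1}` the logistic loss is the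
negative log-likelihood of the model `P(Y = 1) = 1 / (1 + exp p)`. -/
def LossKind.loss : LossKind → ℝ → ℝ → ℝ
  | .square, p, y => (p - y) ^ 2
  | .absolute, p, y => |p - y|
  | .logistic, p, y => Real.log (1 + Real.exp ((2 * y - 1) * p))

/-- The fast gradient attack `δ = e (∂l/∂z) / ‖∂l/∂z‖` (no attack where the gradient vanishes). -/
def attack (ℓ : LossKind) {d H : ℕ} (e : ℝ) (N : Network d H) (z : Vec d) (y : ℝ) : Vec d :=
  let g : Vec d := gradient (fun z' : Vec d => ℓ.loss (N.predict z') y) z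
  (e * ‖g‖⁻¹) • g

/-- The adversarial loss `l_e(z, y; W, b) = l(z + δ, y; W, b)`; the clean loss is `e = 0`. -/
def advLoss (ℓ : LossKind) {d H : ℕ} (e : ℝ) (N : Network d H) (z : Vec d) (y : ℝ) : ℝ :=
  ℓ.loss (N.predict (z + attack ℓ e N z y)) y

/-- `a ≪ b`, uniformly over the hidden nodes, as `d → ∞`. -/
def MuchLess {H : ℕ → ℕ} (a b : ∀ d : ℕ, Fin (H d) → ℝ) : Prop :=
  ∀ c : ℝ, 0 < c → ∀ᶠ d in atTop, ∀ h, a d h ≤ c * b d h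

/-- The data of the problem, for every dimension `d`: number of hidden nodes `H`, sparsity `k`,
bound `mstar` on the number of features per node, law of one coordinate of the features `X`,
mixing matrix `M`, coefficient vector `θ₀`; and the two noise levels (`ζ` for the input noise,
`s` for the standard deviation of the response noise in regression). -/
structure Model where
  H : ℕ → ℕ
  k : ℕ → ℝ
  mstar : ℕ → ℕ
  coordLaw : ℕ → Measure ℝ
  M : ∀ d : ℕ, Matrix (Fin d) (Fin d) ℝ
  θ₀ : ∀ d : ℕ, Vec d
  ζ : ℝ
  s : ℝ

namespace Model

/-- The sparse coding assumption.  Here `E|X_i| = Θ(√k / d)`, i.e. `|X_i|` has conditional mean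
`Θ(1 / √k)` given that the coordinate is active. -/
structure SparseCoding (P : Model) : Prop where
  prob : ∀ d, IsProbabilityMeasure (P.coordLaw d)
  symm : ∀ d, (P.coordLaw d).map (fun x => -x) = P.coordLaw d
  range : ∀ d, ∀ᵐ x ∂(P.coordLaw d), x = 0 ∨ (1 / √(P.k d) ≤ |x| ∧ |x| ≤ 1)
  active : (fun d => (P.coordLaw d).real {x | x ≠ 0}) =Θ[atTop] fun d => P.k d / (d : ℝ)
  moment_one : (fun d => ∫ x, |x| ∂(P.coordLaw d)) =Θ[atTop] fun d => √(P.k d) / (d : ℝ)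
  moment_two : (fun d => ∫ x, x ^ 2 ∂(P.coordLaw d)) =Θ[atTop] fun d => 1 / (d : ℝ)
  moment_three :
    (fun d => ∫ x, |x| ^ 3 ∂(P.coordLaw d)) =Θ[atTop] fun d => 1 / ((d : ℝ) * √(P.k d))
  unitary : ∀ d, P.M d ∈ Matrix.orthogonalGroup (Fin d) ℝ
  coeff : ∃ c C : ℝ, 0 < c ∧ ∀ᶠ d in atTop, ∀ i, c ≤ |P.θ₀ d i| ∧ |P.θ₀ d i| ≤ C
  input_noise : 0 < P.ζ
  response_noise : 0 < P.s

/-- The law of `X`: independent coordinates with law `coordLaw d`. -/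
def featureLaw (P : Model) (d : ℕ) : Measure (Vec d) :=
  (Measure.pi fun _ : Fin d => P.coordLaw d).map (WithLp.toLp 2)

/-- The law `N(0, ζ² I_d / d)` of the input noise `ξ`. -/
def noiseLaw (P : Model) (d : ℕ) : Measure (Vec d) :=
  (Measure.pi fun _ : Fin d => gaussianReal 0 (P.ζ ^ 2 / (d : ℝ)).toNNReal).map (WithLp.toLp 2)

/-- `Z = M X + ξ`. -/
def observe (P : Model) (d : ℕ) (x ξ : Vec d) : Vec d :=
  WithLp.toLp 2 ((P.M d).mulVec x.ofLp) + ξ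

/-- `θ₀ᵀ x`. -/
def score (P : Model) (d : ℕ) (x : Vec d) : ℝ := ∑ i, P.θ₀ d i * x i

/-- Joint law of `(X, Z, Y)` for `Y = θ₀ᵀ X + N(0, s²)`, with `X`, `ξ` and the response noise
independent. -/
def regressionLaw (P : Model) (d : ℕ) : Measure (Vec d × Vec d × ℝ) :=
  (((P.featureLaw d).prod (P.noiseLaw d)).prod (gaussianReal 0 (P.s ^ 2).toNNReal)).map
    fun q => (q.1.1, P.observe d q.1.1 q.1.2, P.score d q.1.1 + q.2)

/-- Joint law of `(X, Z, Y)` where `X` and `ξ` are independent and, given them, `Y` is Bernoulli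
with `P(Y = 1) = 1 / (1 + exp(θ₀ᵀ X))`. -/
def classificationLaw (P : Model) (d : ℕ) : Measure (Vec d × Vec d × ℝ) :=
  (((P.featureLaw d).prod (P.noiseLaw d)).withDensity
      fun q => ENNReal.ofReal (1 / (1 + Real.exp (P.score d q.1)))).map
    (fun q => (q.1, P.observe d q.1 q.2, 1)) +
  (((P.featureLaw d).prod (P.noiseLaw d)).withDensity
      fun q => ENNReal.ofReal (1 - 1 / (1 + Real.exp (P.score d q.1)))).map
    (fun q => (q.1, P.observe d q.1 q.2, 0))

/-- Square and absolute loss go with regression, logistic loss with classification. -/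
def dataLaw (P : Model) (ℓ : LossKind) (d : ℕ) : Measure (Vec d × Vec d × ℝ) :=
  match ℓ with
  | .square => P.regressionLaw d
  | .absolute => P.regressionLaw d
  | .logistic => P.classificationLaw d

/-- `E l_e(Z, Y; W, b)`; the clean risk is `e = 0`. -/
def risk (P : Model) (ℓ : LossKind) (e : ℝ) {d : ℕ} (N : Network d (P.H d)) : ℝ :=
  ∫ w, advLoss ℓ e N w.2.1 w.2.2 ∂(P.dataLaw ℓ d)

/-- `E l_0(X, Y; θ₀)`. -/
def oracleRisk (P : Model) (ℓ : LossKind) (d : ℕ) : ℝ :=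
  ∫ w, ℓ.loss (P.score d w.1) w.2.2 ∂(P.dataLaw ℓ d)

/-- `U = Mᵀ W`: entry `(i, h)` is the strength of feature `i` in the hidden node `h`. -/
def coef (P : Model) {d : ℕ} (N : Network d (P.H d)) : Matrix (Fin d) (Fin (P.H d)) ℝ :=
  (P.M d).transpose * N.weight

/-- The features learned by the node `h`. -/
def nodeSupport (P : Model) {d : ℕ} (N : Network d (P.H d)) (h : Fin (P.H d)) : Finset (Fin d) :=
  Finset.univ.filter fun i => P.coef N i h ≠ 0

/-- `‖U_h‖₀`. -/
def nodeCount (P : Model) {d : ℕ} (N : Network d (P.H d)) (h : Fin (P.H d)) : ℕ :=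
  (P.nodeSupport N h).card

/-- `‖U_h‖`, the Euclidean norm. -/
def nodeNorm (P : Model) {d : ℕ} (N : Network d (P.H d)) (h : Fin (P.H d)) : ℝ :=
  √(∑ i, P.coef N i h ^ 2)

/-- The collection of feature sets learned by the hidden nodes.  It does not change when hidden
nodes are permuted or the nonzero weights are changed. -/
def supportPattern (P : Model) {d : ℕ} (N : Network d (P.H d)) : Finset (Finset (Fin d)) :=
  Finset.univ.image (P.nodeSupport N)

/-- `‖U_h‖ / √(k ‖U_h‖₀)`. -/
def nodeScale (P : Model) {d : ℕ} (N : Network d (P.H d)) (h : Fin (P.H d)) : ℝ :=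
  P.nodeNorm N h / √(P.k d * (P.nodeCount N h : ℝ))

/-- The class `𝓜` of (sequences, indexed by the dimension, of) two-layer networks.  The scale `γ`
may depend on the sequence. -/
structure InClass (P : Model) (N : ∀ d : ℕ, Network d (P.H d)) : Prop where
  intercept_upper :
    MuchLess (fun d h => (N d).intercept h) (fun d h => P.nodeScale (N d) h)
  intercept_lower :
    MuchLess (fun d h => P.nodeScale (N d) h / Real.log (d : ℝ)) (fun d h => (N d).intercept h)
  noise_small :
    MuchLess (fun d h => P.nodeNorm (N d) h / √(d : ℝ))
      (fun d h => P.nodeScale (N d) h / Real.log (d : ℝ))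
  features : ∀ᶠ d in atTop, ∀ h, 1 ≤ P.nodeCount (N d) h ∧ P.nodeCount (N d) h ≤ P.mstar d
  same_sign : ∀ᶠ d in atTop, ∀ i h h', 0 ≤ P.coef (N d) i h * P.coef (N d) i h'
  same_scale : ∃ (γ : ℕ → ℝ) (c C : ℝ), 0 < c ∧ ∀ᶠ d in atTop, 0 < γ d ∧
    ∀ i h, P.coef (N d) i h ≠ 0 →
      c * γ d ≤ |P.coef (N d) i h| ∧ |P.coef (N d) i h| ≤ C * γ d

/-- `U a = θ₀` (all `a_h` are `1`). -/
def Matches (P : Model) {d : ℕ} (N : Network d (P.H d)) : Prop :=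
  ∀ i, ∑ h, P.coef N i h = P.θ₀ d i

/-- `ψ = H (m*)³ k³ log² k / d² + √(k / d)`. -/
def psi (P : Model) (d : ℕ) : ℝ :=
  (P.H d : ℝ) * (P.mstar d : ℝ) ^ 3 * P.k d ^ 3 * Real.log (P.k d) ^ 2 / (d : ℝ) ^ 2
    + √(P.k d / (d : ℝ))

/-- `H k³ (m*)³ = O(d^{2 - τ})` for some `τ > 0`. -/
def Moderate (P : Model) : Prop :=
  ∃ τ : ℝ, 0 < τ ∧ (fun d : ℕ => (P.H d : ℝ) * P.k d ^ 3 * (P.mstar d : ℝ) ^ 3)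
    =O[atTop] fun d : ℕ => (d : ℝ) ^ (2 - τ)

/-- `√(m* k)`. -/
def rootMK (P : Model) (d : ℕ) : ℝ := √((P.mstar d : ℝ) * P.k d)

end Model

end FeaturePurification

end

/-!
The non-robust networks are built from a grouping of the features into groups of at most `m*`
features. The `H` nodes are distributed evenly over the groups, the nodes of a group `A` share the
coefficients `θ₀` of `A` equally, and their intercepts are the geometric mean of the two bounds
which define the class (`groupNetwork`). By the rotation invariance of the Gaussian, features and
input noise become independent coordinates of one product space (`baseLaw`), on which different
groups are independent.

*Clean performance.* A group is bad if two of its features are active at once, or if its noise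
exceeds its threshold. Both have a probability of the order of `(k |A| / d)²`, the latter by the
eighth moment of the noise. A good group with an active feature is open and adds only its noise to
the contribution of its features; a good group without active features is closed. Hence the
prediction error is a sum of independent odd functions, with a second moment of order `(m*)² k³ /
d`, which is `O(ψ)` (`integral_sum_groupErr_sq_le`, `errOrder_le_psi`).

*Attack.* Almost surely no pre-activation lies at a threshold, and the attack is a step along the
normalized gradient of the prediction, with the sign of the loss derivative
(`advLoss_eq_stepLoss`). On good groups the step is too small to open or close nodes, so it moves
the prediction by `ε` times the norm of the coefficients of the groups with an active feature; bad
groups disturb this by their thresholds (`abs_predict_step_sub_le`). Averaging over the response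
at a fixed score expands all three losses to first order (`exists_respAvg_attack`); the bounded
density of the Gaussian response noise smooths the kink of the absolute loss. The result is `risk
= oracleRisk + ε * attackCost + O(ψ + ε² m* k)` (`exists_abs_risk_sub_le`), with `attackCost =
O(√(m* k))`.

*All networks of the class.* As the coefficients of each feature have a constant sign, the weight
vectors of a network have nonnegative inner products, so a step along the gradient moves every
pre-activation in the direction of the step, and the attack never decreases the loss. The clean
prediction in turn is no better than the true score, which is Bayes optimal. So `oracleRisk` is a
lower bound for all risks of the class (`oracleRisk_le_risk`), which gives the upper bounds of the
theorem.

*Lower bound for the robustness gap.* The competitor is the network of the grouping into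
singletons. If half of the features belong to groups of exactly `m*` features, the squared
gradient norm exceeds that of the competitor by at least `c²` times the number of inactive
features in active groups, which has a mean of order `m* k`. Truncating the score and the number
of features in active groups, at levels controlled by second moments, turns this into a gap of
order `√(m* k)` between the attack costs (`weighted_gap_ge`, `exists_attackCost_gap`); the
second-order terms are of smaller order since `ε √(m* k) → 0`.

*Number of networks.* Arrange most of the features in `m*` rows of `d / m*` features, and choose a
permutation of every row but the first; the groups are the columns. Different choices have
different groups, and `((d / m*)!) ^ (m* - 1) ≥ 2 ^ d` for large `d` (`two_pow_le_ncard`).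
-/

namespace FeaturePurification

open scoped NNReal

/-! ### The sample space: features and noise as independent coordinates -/

section SampleSpace

variable {ι : Type*} [Fintype ι]

/-- The law of the features (left coordinates, i.i.d. with law `μ`) and of the input noise in
feature coordinates (right coordinates, i.i.d. centred Gaussian of variance `v`). -/
noncomputable def sampleLaw (ι : Type*) [Fintype ι] (μ : Measure ℝ) (v : ℝ≥0) :
    Measure (ι ⊕ ι → ℝ) :=
  Measure.pi (Sum.elim (fun _ => μ) (fun _ => gaussianReal 0 v))

instance isProbabilityMeasure_sumElim (μ : Measure ℝ) [IsProbabilityMeasure μ] (v : ℝ≥0)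
    (j : ι ⊕ ι) : IsProbabilityMeasure
      (Sum.elim (fun _ => μ) (fun _ => gaussianReal 0 v) j : Measure ℝ) := by
  cases j <;> simp only [Sum.elim_inl, Sum.elim_inr] <;> infer_instance

variable {μ : Measure ℝ} [IsProbabilityMeasure μ] {v : ℝ≥0}

instance isProbabilityMeasure_sampleLaw : IsProbabilityMeasure (sampleLaw ι μ v) := by
  unfold sampleLaw; infer_instance

theorem measurePreserving_inl (i : ι) :
    MeasurePreserving (fun ω : ι ⊕ ι → ℝ => ω (Sum.inl i)) (sampleLaw ι μ v) μ :=
  measurePreserving_eval (Sum.elim (fun _ : ι => μ) (fun _ : ι => gaussianReal 0 v)) (Sum.inl i)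

theorem measurePreserving_inr (i : ι) :
    MeasurePreserving (fun ω : ι ⊕ ι → ℝ => ω (Sum.inr i)) (sampleLaw ι μ v)
      (gaussianReal 0 v) :=
  measurePreserving_eval (Sum.elim (fun _ : ι => μ) (fun _ : ι => gaussianReal 0 v)) (Sum.inr i)

theorem iIndepFun_coord :
    iIndepFun (fun (j : ι ⊕ ι) (ω : ι ⊕ ι → ℝ) => ω j) (sampleLaw ι μ v) :=
  iIndepFun_pi (X := fun _ => id) fun _ => aemeasurable_id

/-- Functions of disjoint sets of coordinates are independent. -/
theorem indepFun_of_dependsOn {F G : (ι ⊕ ι → ℝ) → ℝ} (hF : Measurable F) (hG : Measurable G)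
    {s t : Set (ι ⊕ ι)} (hs : DependsOn F s) (ht : DependsOn G t) (hst : Disjoint s t) :
    IndepFun F G (sampleLaw ι μ v) := by
  classical
  have h := (iIndepFun_coord (ι := ι) (μ := μ) (v := v)).indepFun_finset s.toFinset t.toFinset
    (by rwa [Set.disjoint_toFinset]) (fun j => measurable_pi_apply j)
  let ext (s : Set (ι ⊕ ι)) (u : s.toFinset → ℝ) : ι ⊕ ι → ℝ :=
    fun j => if hj : j ∈ s.toFinset then u ⟨j, hj⟩ else 0
  have hext (s : Set (ι ⊕ ι)) : Measurable (ext s) := by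
    refine measurable_pi_lambda _ fun j => ?_
    by_cases hj : j ∈ s.toFinset
    · simpa only [ext, hj, dite_true] using measurable_pi_apply _
    · simp only [ext, hj, dite_false]; exact measurable_const
  have key := h.comp (hF.comp (hext s)) (hG.comp (hext t))
  have e1 : (F ∘ ext s) ∘ (fun (a : ι ⊕ ι → ℝ) (i : s.toFinset) => a i) = F := by
    funext a
    refine hs fun j hj => ?_
    simp [ext, hj]
  have e2 : (G ∘ ext t) ∘ (fun (a : ι ⊕ ι → ℝ) (i : t.toFinset) => a i) = G := by
    funext a
    refine ht fun j hj => ?_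
    simp [ext, hj]
  rwa [e1, e2] at key

theorem integral_mul_of_dependsOn {F G : (ι ⊕ ι → ℝ) → ℝ} (hF : Measurable F)
    (hG : Measurable G) {s t : Set (ι ⊕ ι)} (hs : DependsOn F s) (ht : DependsOn G t)
    (hst : Disjoint s t) :
    ∫ ω, F ω * G ω ∂sampleLaw ι μ v =
      (∫ ω, F ω ∂sampleLaw ι μ v) * ∫ ω, G ω ∂sampleLaw ι μ v :=
  (indepFun_of_dependsOn hF hG hs ht hst).integral_fun_mul_eq_mul_integral
    hF.aestronglyMeasurable hG.aestronglyMeasurable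

/-- The joint law of features and noise is symmetric, so odd functions have mean zero. -/
theorem integral_eq_zero_of_odd (hμ : μ.map (fun x => -x) = μ) {F : (ι ⊕ ι → ℝ) → ℝ}
    (hodd : ∀ ω, F (-ω) = -F ω) : ∫ ω, F ω ∂sampleLaw ι μ v = 0 := by
  have hneg : MeasurePreserving (fun ω : ι ⊕ ι → ℝ => fun j => -ω j)
      (sampleLaw ι μ v) (sampleLaw ι μ v) := by
    refine measurePreserving_pi _ _ fun j => ⟨measurable_neg, ?_⟩
    cases j
    · simpa using hμ
    · simpa using gaussianReal_map_neg (μ := 0) (v := v)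
  have h := hneg.integral_comp (MeasurableEquiv.neg (ι ⊕ ι → ℝ)).measurableEmbedding F
  have h2 : ∀ ω : ι ⊕ ι → ℝ, F (fun j => -ω j) = -F ω := hodd
  simp only [h2, integral_neg] at h
  linarith

/-- For pairwise independent summands the second moment of the sum exceeds the sum of the second
moments at most by the square of the mean. -/
theorem integral_sum_sq_le {Ω κ : Type*} [MeasurableSpace Ω] {Q : Measure Ω}
    [IsProbabilityMeasure Q] (s : Finset κ) {F : κ → Ω → ℝ} (hF : ∀ g ∈ s, MemLp (F g) 2 Q)
    (hind : Set.Pairwise (s : Set κ) fun g g' => IndepFun (F g) (F g') Q) :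
    ∫ ω, (∑ g ∈ s, F g ω) ^ 2 ∂Q ≤
      ∑ g ∈ s, ∫ ω, F g ω ^ 2 ∂Q + (∑ g ∈ s, ∫ ω, F g ω ∂Q) ^ 2 := by
  have h1 := IndepFun.variance_sum hF hind
  have hS : MemLp (∑ g ∈ s, F g) 2 Q := memLp_finsetSum' s hF
  have h2 := variance_eq_sub hS
  have h3 : ∑ g ∈ s, variance (F g) Q ≤ ∑ g ∈ s, ∫ ω, F g ω ^ 2 ∂Q := by
    refine Finset.sum_le_sum fun g hg => ?_
    rw [variance_eq_sub (hF g hg)]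
    have : 0 ≤ (∫ x, F g x ∂Q) ^ 2 := sq_nonneg _
    simp only [Pi.pow_apply]
    linarith
  have h4 : ∫ x, (∑ g ∈ s, F g) x ∂Q = ∑ g ∈ s, ∫ ω, F g ω ∂Q := by
    simp only [Finset.sum_apply]
    exact integral_finsetSum _ fun g hg => (hF g hg).integrable (by norm_num)
  rw [h1, h4] at h2
  have h5 : ∫ x, ((∑ g ∈ s, F g) ^ 2) x ∂Q = ∫ ω, (∑ g ∈ s, F g ω) ^ 2 ∂Q := by
    simp [Finset.sum_apply]
  rw [h5] at h2
  linarith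

theorem memLp_inr (i : ι) (p : ℝ≥0) :
    MemLp (fun ω : ι ⊕ ι → ℝ => ω (Sum.inr i)) p (sampleLaw ι μ v) :=
  (memLp_id_gaussianReal p).comp_measurePreserving (measurePreserving_inr i)

theorem measurable_noise_linear (a : ι → ℝ) :
    Measurable fun ω : ι ⊕ ι → ℝ => ∑ i, a i * ω (Sum.inr i) := by
  fun_prop

/-- A linear combination of the noise coordinates is Gaussian. -/
theorem map_noise_linear (a : ι → ℝ) :
    (sampleLaw ι μ v).map (fun ω => ∑ i, a i * ω (Sum.inr i)) =
      gaussianReal 0 (v * (∑ i, a i ^ 2).toNNReal) := by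
  have hg (i : ι) : HasGaussianLaw (fun ω : ι ⊕ ι → ℝ => a i * ω (Sum.inr i))
      (sampleLaw ι μ v) := by
    have h1 : HasLaw (fun ω : ι ⊕ ι → ℝ => ω (Sum.inr i)) (gaussianReal 0 v)
        (sampleLaw ι μ v) := ⟨(measurePreserving_inr (μ := μ) (v := v) i).measurable.aemeasurable,
          (measurePreserving_inr (μ := μ) i).map_eq⟩
    exact (h1.hasGaussianLaw).fun_smul (a i)
  have hind : iIndepFun (fun (i : ι) (ω : ι ⊕ ι → ℝ) => a i * ω (Sum.inr i))
      (sampleLaw ι μ v) :=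
    ((iIndepFun_coord (ι := ι) (μ := μ) (v := v)).precomp Sum.inr_injective).comp
      (fun i x => a i * x) fun i => measurable_const_mul (a i)
  have hsum := iIndepFun.hasGaussianLaw_fun_sum hg hind
  rw [hsum.map_eq_gaussianReal]
  have hL (i : ι) : MemLp (fun ω : ι ⊕ ι → ℝ => a i * ω (Sum.inr i)) 2 (sampleLaw ι μ v) :=
    (memLp_inr i 2).const_mul (a i)
  have hmean : ∫ ω, ∑ i, a i * ω (Sum.inr i) ∂sampleLaw ι μ v = 0 := by
    rw [integral_finsetSum _ fun i _ => (hL i).integrable (by norm_num)]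
    refine Finset.sum_eq_zero fun i _ => ?_
    rw [integral_const_mul]
    have h := integral_map (μ := sampleLaw ι μ v) (measurePreserving_inr (μ := μ) (v := v) i).measurable.aemeasurable
      (f := fun x : ℝ => x) (by fun_prop)
    rw [(measurePreserving_inr i).map_eq, integral_id_gaussianReal] at h
    rw [← h, mul_zero]
  have hvar : variance (fun ω : ι ⊕ ι → ℝ => ∑ i, a i * ω (Sum.inr i)) (sampleLaw ι μ v) =
      v * ∑ i, a i ^ 2 := by
    have h1 := IndepFun.variance_sum (s := Finset.univ) (fun i _ => hL i)
      (fun i _ j _ hij => hind.indepFun hij)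
    have h2 : (∑ i, fun ω : ι ⊕ ι → ℝ => a i * ω (Sum.inr i)) =
        fun ω => ∑ i, a i * ω (Sum.inr i) := by
      funext ω; simp
    rw [h2] at h1
    rw [h1, Finset.mul_sum]
    refine Finset.sum_congr rfl fun i _ => ?_
    rw [variance_const_mul]
    have h3 := variance_map (μ := sampleLaw ι μ v) (X := fun x : ℝ => x)
      (Y := fun ω : ι ⊕ ι → ℝ => ω (Sum.inr i)) (by fun_prop)
      (measurable_pi_apply (Sum.inr i)).aemeasurable
    rw [(measurePreserving_inr i).map_eq, variance_fun_id_gaussianReal] at h3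
    have h4 : variance (fun ω : ι ⊕ ι → ℝ => ω (Sum.inr i)) (sampleLaw ι μ v) = v := h3.symm
    rw [h4]; ring
  rw [hmean, hvar]
  congr 1
  rw [Real.toNNReal_mul v.coe_nonneg, Real.toNNReal_coe]

/-- The absolute moments of the standard Gaussian. -/
noncomputable def gaussMoment (q : ℕ) : ℝ := ∫ x, |x| ^ q ∂gaussianReal 0 1

theorem gaussMoment_nonneg (q : ℕ) : 0 ≤ gaussMoment q :=
  integral_nonneg fun _ => by positivity

theorem integrable_abs_pow_gaussianReal (w : ℝ≥0) (q : ℕ) :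
    Integrable (fun x : ℝ => |x| ^ q) (gaussianReal 0 w) := by
  have h := (memLp_id_gaussianReal (μ := 0) (v := w) (q : ℝ≥0)).integrable_norm_pow'
  simpa using h

theorem integral_abs_pow_gaussianReal (w : ℝ≥0) (q : ℕ) :
    ∫ x, |x| ^ q ∂gaussianReal 0 w = √(w : ℝ) ^ q * gaussMoment q := by
  have h : gaussianReal 0 w = (gaussianReal 0 1).map (fun x => √(w : ℝ) * x) := by
    rw [gaussianReal_map_const_mul]
    congr 1
    · simp
    · ext; simp
  rw [h, integral_map (by fun_prop) (by fun_prop), gaussMoment, ← integral_const_mul]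
  refine integral_congr_ae (Eventually.of_forall fun x => ?_)
  simp only [abs_mul, mul_pow, abs_of_nonneg (Real.sqrt_nonneg _)]

theorem integrable_noise_pow (a : ι → ℝ) (q : ℕ) :
    Integrable (fun ω => |∑ i, a i * ω (Sum.inr i)| ^ q) (sampleLaw ι μ v) := by
  have h := integrable_abs_pow_gaussianReal (v * (∑ i, a i ^ 2).toNNReal) q
  rw [← map_noise_linear (μ := μ)] at h
  exact h.comp_measurable (measurable_noise_linear a)

theorem integral_noise_pow (a : ι → ℝ) (q : ℕ) :
    ∫ ω, |∑ i, a i * ω (Sum.inr i)| ^ q ∂sampleLaw ι μ v =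
      √(v * ∑ i, a i ^ 2) ^ q * gaussMoment q := by
  have h := integral_abs_pow_gaussianReal (v * (∑ i, a i ^ 2).toNNReal) q
  rw [← map_noise_linear (μ := μ), integral_map (measurable_noise_linear a).aemeasurable
    (by fun_prop)] at h
  rw [h]
  congr 3
  have : 0 ≤ ∑ i, a i ^ 2 := Finset.sum_nonneg fun _ _ => sq_nonneg _
  rw [NNReal.coe_mul, Real.coe_toNNReal _ this]

end SampleSpace

section Coordinates

variable (P : Model) (d : ℕ)

/-- The joint law of features and input noise at dimension `d`, with the noise taken in feature
coordinates. -/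
noncomputable def baseLaw : Measure (Fin d ⊕ Fin d → ℝ) :=
  sampleLaw (Fin d) (P.coordLaw d) (P.ζ ^ 2 / (d : ℝ)).toNNReal

variable {d} in
/-- The feature vector of a sample point. -/
noncomputable def featureVec (ω : Fin d ⊕ Fin d → ℝ) : Vec d := WithLp.toLp 2 fun i => ω (Sum.inl i)

/-- The input noise of a sample point, rotated from feature coordinates to input coordinates. -/
noncomputable def noiseVec (ω : Fin d ⊕ Fin d → ℝ) : Vec d :=
  WithLp.toLp 2 ((P.M d).mulVec fun i => ω (Sum.inr i))

/-- The observed vector of a sample point. -/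
noncomputable def inputVec (ω : Fin d ⊕ Fin d → ℝ) : Vec d :=
  P.observe d (featureVec ω) (noiseVec P d ω)

variable {P}

theorem norm_mulVec_of_orthogonal {A : Matrix (Fin d) (Fin d) ℝ}
    (hA : A ∈ Matrix.orthogonalGroup (Fin d) ℝ) (x : Vec d) :
    ‖(WithLp.toLp 2 (A.mulVec x.ofLp) : Vec d)‖ = ‖x‖ := by
  have h1 : A.transpose * A = 1 := by
    have := (Matrix.mem_orthogonalGroup_iff' (Fin d) ℝ).1 hA
    simpa [Matrix.star_eq_conjTranspose] using this
  have h2 : A.mulVec x.ofLp ⬝ᵥ A.mulVec x.ofLp = x.ofLp ⬝ᵥ x.ofLp := by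
    rw [Matrix.dotProduct_mulVec, ← Matrix.mulVec_transpose, Matrix.mulVec_mulVec, h1,
      Matrix.one_mulVec]
  have h3 : ‖(WithLp.toLp 2 (A.mulVec x.ofLp) : Vec d)‖ ^ 2 = ‖x‖ ^ 2 := by
    rw [EuclideanSpace.real_norm_sq_eq, EuclideanSpace.real_norm_sq_eq]
    simpa [dotProduct, sq] using h2
  exact (sq_eq_sq₀ (norm_nonneg _) (norm_nonneg _)).1 h3

/-- Rotating by an orthogonal matrix, as a linear isometry. -/
noncomputable def rotation {A : Matrix (Fin d) (Fin d) ℝ}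
    (hA : A ∈ Matrix.orthogonalGroup (Fin d) ℝ) : Vec d ≃ₗᵢ[ℝ] Vec d :=
  LinearIsometry.toLinearIsometryEquiv
    { toFun := fun x => WithLp.toLp 2 (A.mulVec x.ofLp)
      map_add' := fun x y => by ext i; simp [Matrix.mulVec_add]
      map_smul' := fun c x => by ext i; simp [Matrix.mulVec_smul]
      norm_map' := norm_mulVec_of_orthogonal d hA } rfl

/-- The input noise is a multiple of the standard Gaussian, whose rotation invariance is in Mathlib.
-/
theorem noiseLaw_eq_map_stdGaussian :
    P.noiseLaw d = (stdGaussian (Vec d)).map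
      (fun x => √(((P.ζ ^ 2 / (d : ℝ)).toNNReal : ℝ≥0) : ℝ) • x) := by
  set v := (P.ζ ^ 2 / (d : ℝ)).toNNReal
  have h : gaussianReal 0 v = (gaussianReal 0 1).map (fun x => √(v : ℝ) * x) := by
    rw [gaussianReal_map_const_mul]
    congr 1
    · simp
    · ext; simp
  have hpi : (Measure.pi fun _ : Fin d => gaussianReal 0 v) =
      (Measure.pi fun _ : Fin d => gaussianReal 0 1).map (fun x i => √(v : ℝ) * x i) := by
    have := Measure.pi_map_pi (μ := fun _ : Fin d => gaussianReal 0 1)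
      (f := fun _ x => √(v : ℝ) * x) (hμ := fun i => by rw [← h]; infer_instance)
      (fun i => by fun_prop)
    rw [this, ← h]
  rw [Model.noiseLaw, hpi, ← map_pi_eq_stdGaussian, Measure.map_map (by fun_prop) (by fun_prop),
    Measure.map_map (by fun_prop) (by fun_prop)]
  rfl

/-- Isotropic Gaussian noise is invariant under the mixing matrix. -/
theorem noiseLaw_map_rotation (hM : P.M d ∈ Matrix.orthogonalGroup (Fin d) ℝ) :
    (P.noiseLaw d).map (fun x => WithLp.toLp 2 ((P.M d).mulVec x.ofLp)) = P.noiseLaw d := by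
  have h := stdGaussian_map (rotation d hM)
  rw [noiseLaw_eq_map_stdGaussian]
  set c := √(((P.ζ ^ 2 / (d : ℝ)).toNNReal : ℝ≥0) : ℝ)
  conv_rhs => rw [← h]
  have hcont : Continuous (rotation d hM) := (rotation d hM).continuous
  change Measure.map (rotation d hM) _ = _
  rw [Measure.map_map hcont.measurable (by fun_prop),
    Measure.map_map (by fun_prop) hcont.measurable]
  congr 1
  funext x
  exact (rotation d hM).map_smul c x

/-- Independent feature and noise coordinates generate the law of features and input noise: the
mixing matrix leaves the noise law invariant. -/
theorem measurePreserving_feature_noise (hP : P.SparseCoding) :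
    MeasurePreserving (fun ω => (featureVec ω, noiseVec P d ω)) (baseLaw P d)
      ((P.featureLaw d).prod (P.noiseLaw d)) := by
  have := hP.prob d
  have h1 := measurePreserving_sumPiEquivProdPi
    (Sum.elim (fun _ : Fin d => P.coordLaw d)
      (fun _ : Fin d => gaussianReal 0 (P.ζ ^ 2 / (d : ℝ)).toNNReal))
  have hrot : Measurable fun x : Fin d → ℝ =>
      (WithLp.toLp 2 ((P.M d).mulVec x) : Vec d) := by
    have : Continuous fun x : Fin d → ℝ => (P.M d).mulVec x :=
      Continuous.matrix_mulVec continuous_const continuous_id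
    fun_prop
  have h2 : MeasurePreserving (WithLp.toLp 2 : (Fin d → ℝ) → Vec d)
      (Measure.pi fun _ : Fin d => P.coordLaw d) (P.featureLaw d) := ⟨by fun_prop, rfl⟩
  have h3 : MeasurePreserving (fun x : Fin d → ℝ =>
      (WithLp.toLp 2 ((P.M d).mulVec x) : Vec d))
      (Measure.pi fun _ : Fin d => gaussianReal 0 (P.ζ ^ 2 / (d : ℝ)).toNNReal)
      (P.noiseLaw d) := by
    refine ⟨hrot, ?_⟩
    conv_rhs => rw [← noiseLaw_map_rotation d (hP.unitary d), Model.noiseLaw]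
    rw [Measure.map_map _ (by fun_prop)]
    · rfl
    · exact hrot.comp (by fun_prop : Measurable fun x : Vec d => x.ofLp)
  have : IsProbabilityMeasure (P.featureLaw d) := by
    rw [← h2.map_eq]; exact Measure.isProbabilityMeasure_map h2.measurable.aemeasurable
  have : IsProbabilityMeasure (P.noiseLaw d) := by
    rw [← h3.map_eq]; exact Measure.isProbabilityMeasure_map h3.measurable.aemeasurable
  exact (h2.prod h3).comp h1

end Coordinates

/-! ### One-dimensional analysis of the losses -/

section Response

/-- The mean of `F(Y)` given that the score `θ₀ᵀX` equals `t`. -/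
noncomputable def respAvg (ℓ : LossKind) (s t : ℝ) (F : ℝ → ℝ) : ℝ :=
  match ℓ with
  | .square => ∫ η, F (t + η) ∂gaussianReal 0 (s ^ 2).toNNReal
  | .absolute => ∫ η, F (t + η) ∂gaussianReal 0 (s ^ 2).toNNReal
  | .logistic => 1 / (1 + Real.exp t) * F 1 + (1 - 1 / (1 + Real.exp t)) * F 0

/-- A quantity with the sign of the derivative of the loss in the prediction `p`. -/
def LossKind.slope : LossKind → ℝ → ℝ → ℝ
  | .square, p, y => p - y
  | .absolute, p, y => p - y
  | .logistic, _, y => 2 * y - 1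

/-- The mean of the modulus of the loss derivative, at the true score `t`: the first-order cost of
an attack which shifts the prediction in the worst direction. -/
noncomputable def attackWeight (ℓ : LossKind) (s t : ℝ) : ℝ :=
  match ℓ with
  | .square => 2 * ∫ η, |η| ∂gaussianReal 0 (s ^ 2).toNNReal
  | .absolute => 1
  | .logistic => 2 * (Real.sigmoid t * Real.sigmoid (-t))

theorem abs_integral_sub_integral_le {Ω : Type*} [MeasurableSpace Ω] {Q : Measure Ω}
    {F G H : Ω → ℝ} (hF : AEStronglyMeasurable F Q) (hG : Integrable G Q) (hH : Integrable H Q)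
    (h : ∀ᵐ ω ∂Q, |F ω - G ω| ≤ H ω) : |∫ ω, F ω ∂Q - ∫ ω, G ω ∂Q| ≤ ∫ ω, H ω ∂Q := by
  have hd : Integrable (fun ω => F ω - G ω) Q := hH.mono' (hF.sub hG.1) h
  have hFi : Integrable F Q := (hd.add hG).congr (Eventually.of_forall fun ω => by simp)
  rw [← integral_sub hFi hG]
  exact (abs_integral_le_integral_abs).trans (integral_mono_ae hd.abs hH h)

theorem sigmoid_neg_eq (t : ℝ) : 1 / (1 + Real.exp t) = Real.sigmoid (-t) := by
  simp [Real.sigmoid_def]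

theorem one_sub_sigmoid_neg (t : ℝ) : 1 - Real.sigmoid (-t) = Real.sigmoid t := by
  rw [Real.sigmoid_neg]; ring

/-- The tangent inequality for the convex function `u ↦ log (1 + exp u)`. -/
theorem softplus_tangent_le (u h : ℝ) :
    Real.log (1 + Real.exp u) + Real.sigmoid u * h ≤ Real.log (1 + Real.exp (u + h)) := by
  set p := Real.sigmoid u with hp
  have hp0 : 0 < p := Real.sigmoid_pos u
  have hp1 : p < 1 := Real.sigmoid_lt_one u
  have he : 0 < Real.exp u := Real.exp_pos u
  have hpe : p * (1 + Real.exp u) = Real.exp u := by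
    rw [hp, Real.sigmoid_def, Real.exp_neg]; field_simp; ring
  have hconv := convexOn_exp.2 (Set.mem_univ (0 : ℝ)) (Set.mem_univ h) (sub_nonneg.2 hp1.le)
    hp0.le (by ring)
  simp only [smul_eq_mul, mul_zero, zero_add, Real.exp_zero, mul_one] at hconv
  have h1 : Real.exp (p * h) * (1 + Real.exp u) ≤ 1 + Real.exp (u + h) := by
    rw [Real.exp_add]
    have h2 := mul_le_mul_of_nonneg_right hconv (by positivity : 0 ≤ 1 + Real.exp u)
    have h3 : (1 - p + p * Real.exp h) * (1 + Real.exp u) = 1 + Real.exp u * Real.exp h := by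
      linear_combination (Real.exp h - 1) * hpe
    linarith
  have h2 := Real.log_le_log (by positivity) h1
  rw [Real.log_mul (Real.exp_ne_zero _) (by positivity), Real.log_exp] at h2
  linarith

theorem abs_sigmoid_sub_le (u h : ℝ) : |Real.sigmoid (u + h) - Real.sigmoid u| ≤ |h| := by
  have hl : LipschitzWith 1 Real.sigmoid := by
    refine lipschitzWith_of_nnnorm_deriv_le differentiable_sigmoid fun x => ?_
    rw [← NNReal.coe_le_coe, coe_nnnorm, Real.norm_eq_abs, Real.deriv_sigmoid]
    have h0 := Real.sigmoid_pos x
    have h1 := Real.sigmoid_lt_one x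
    simp only [NNReal.coe_one]
    rw [abs_of_nonneg (mul_nonneg h0.le (by linarith))]
    nlinarith
  have := hl.dist_le_mul (u + h) u
  simpa [Real.dist_eq] using this

/-- First-order Taylor expansion of `u ↦ log (1 + exp u)`. -/
theorem abs_softplus_taylor_le (u h : ℝ) :
    |Real.log (1 + Real.exp (u + h)) - Real.log (1 + Real.exp u) - Real.sigmoid u * h| ≤
      h ^ 2 := by
  have h1 := softplus_tangent_le u h
  have h2 := softplus_tangent_le (u + h) (-h)
  rw [add_neg_cancel_right] at h2
  have h3 := abs_sigmoid_sub_le u h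
  have h4 : (Real.sigmoid (u + h) - Real.sigmoid u) * h ≤ h ^ 2 := by
    refine (le_abs_self _).trans ?_
    rw [abs_mul, ← sq_abs h, sq]
    exact mul_le_mul_of_nonneg_right h3 (abs_nonneg h)
  rw [abs_le]
  constructor <;> nlinarith

theorem loss_nonneg (ℓ : LossKind) (p y : ℝ) : 0 ≤ ℓ.loss p y := by
  cases ℓ
  · exact sq_nonneg _
  · exact abs_nonneg _
  · exact Real.log_nonneg (by linarith [Real.exp_pos ((2 * y - 1) * p)])

theorem loss_le (ℓ : LossKind) (p y : ℝ) : ℓ.loss p y ≤ 4 * (1 + p ^ 2 + y ^ 2) := by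
  cases ℓ
  · simp only [LossKind.loss]; nlinarith [sq_nonneg (p + y)]
  · simp only [LossKind.loss]
    rw [abs_le]
    constructor <;> nlinarith [sq_nonneg (p - 1), sq_nonneg (y - 1), sq_nonneg (p + 1),
      sq_nonneg (y + 1)]
  · simp only [LossKind.loss]
    have h := softplus_tangent_le ((2 * y - 1) * p) (-((2 * y - 1) * p))
    rw [add_neg_cancel, Real.exp_zero] at h
    have h0 := Real.sigmoid_pos ((2 * y - 1) * p)
    have h1 := Real.sigmoid_lt_one ((2 * y - 1) * p)
    have h2 : Real.log (1 + 1) ≤ 1 := by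
      have := Real.log_le_sub_one_of_pos (by norm_num : (0 : ℝ) < 1 + 1); linarith
    have h3 : Real.sigmoid ((2 * y - 1) * p) * ((2 * y - 1) * p) ≤ |(2 * y - 1) * p| := by
      refine (le_abs_self _).trans ?_
      rw [abs_mul, abs_of_pos h0]
      exact mul_le_of_le_one_left (abs_nonneg _) h1.le
    have h4 : |(2 * y - 1) * p| ≤ ((2 * y - 1) ^ 2 + p ^ 2) / 2 := by
      rw [abs_le]
      constructor <;> nlinarith [sq_nonneg (2 * y - 1 + p), sq_nonneg (2 * y - 1 - p)]
    nlinarith [sq_nonneg (2 * y + 1), sq_nonneg p]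

/-- Either the loss is differentiable in the prediction with a derivative of the sign of the slope,
or the prediction minimizes the loss. -/
theorem exists_hasDerivAt_loss (ℓ : LossKind) (p y : ℝ) :
    (ℓ.slope p y ≠ 0 ∧ ∃ r, HasDerivAt (fun q => ℓ.loss q y) r p ∧ r ≠ 0 ∧
      Real.sign r = Real.sign (ℓ.slope p y)) ∨
    (ℓ.slope p y = 0 ∧ ∀ q, ℓ.loss p y ≤ ℓ.loss q y) := by
  by_cases h0 : ℓ.slope p y = 0
  · refine Or.inr ⟨h0, fun q => ?_⟩
    cases ℓ
    · simp only [LossKind.slope] at h0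
      simp only [LossKind.loss, h0]; nlinarith [sq_nonneg (q - y)]
    · simp only [LossKind.slope] at h0
      simp only [LossKind.loss, h0]; simp
    · simp only [LossKind.slope] at h0
      simp only [LossKind.loss, h0]; simp
  refine Or.inl ⟨h0, ?_⟩
  cases ℓ
  · simp only [LossKind.slope] at h0 ⊢
    refine ⟨2 * (p - y), ?_, by simpa using h0, ?_⟩
    · have := ((hasDerivAt_id p).sub_const y).fun_pow 2
      simpa [LossKind.loss] using this
    · rcases lt_or_gt_of_ne h0 with h | h
      · rw [Real.sign_of_neg h, Real.sign_of_neg (by linarith)]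
      · rw [Real.sign_of_pos h, Real.sign_of_pos (by linarith)]
  · simp only [LossKind.slope] at h0 ⊢
    rcases lt_or_gt_of_ne h0 with h | h
    · refine ⟨-1, ?_, by norm_num, by rw [Real.sign_of_neg h, Real.sign_of_neg (by norm_num)]⟩
      have := (hasDerivAt_abs_neg h).comp p ((hasDerivAt_id p).sub_const y)
      simpa [LossKind.loss, Function.comp_def] using this
    · refine ⟨1, ?_, by norm_num, by rw [Real.sign_of_pos h, Real.sign_of_pos (by norm_num)]⟩
      have := (hasDerivAt_abs_pos h).comp p ((hasDerivAt_id p).sub_const y)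
      simpa [LossKind.loss, Function.comp_def] using this
  · simp only [LossKind.slope] at h0 ⊢
    set a := 2 * y - 1 with ha
    refine ⟨Real.exp (a * p) * a / (1 + Real.exp (a * p)), ?_, ?_, ?_⟩
    · have h1 : HasDerivAt (fun q : ℝ => a * q) a p := by
        simpa using (hasDerivAt_id p).const_mul a
      have h2 := (h1.exp.const_add 1).log (by positivity)
      simpa [LossKind.loss, ← ha] using h2
    · have : 0 < 1 + Real.exp (a * p) := by positivity
      positivity
    · rcases lt_or_gt_of_ne h0 with h | h
      · rw [Real.sign_of_neg h, Real.sign_of_neg]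
        exact div_neg_of_neg_of_pos (mul_neg_of_pos_of_neg (Real.exp_pos _) h) (by positivity)
      · rw [Real.sign_of_pos h, Real.sign_of_pos]
        positivity

/-- Moving the prediction in the direction of the slope does not decrease the loss. -/
theorem loss_le_of_sign (ℓ : LossKind) {p y : ℝ} {R : ℝ → ℝ} (h1 : p ≤ R 1) (h2 : R (-1) ≤ p)
    (h3 : R 0 = p) : ℓ.loss p y ≤ ℓ.loss (R (Real.sign (ℓ.slope p y))) y := by
  rcases lt_trichotomy (ℓ.slope p y) 0 with h | h | h
  · rw [Real.sign_of_neg h]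
    cases ℓ <;> simp only [LossKind.slope] at h <;> simp only [LossKind.loss]
    · nlinarith
    · rw [abs_of_neg h, abs_of_neg (by linarith)]; linarith
    · refine Real.log_le_log (by positivity) ?_
      have : (2 * y - 1) * p ≤ (2 * y - 1) * R (-1) := by nlinarith
      linarith [Real.exp_le_exp.2 this]
  · rw [h, Real.sign_zero, h3]
  · rw [Real.sign_of_pos h]
    cases ℓ <;> simp only [LossKind.slope] at h <;> simp only [LossKind.loss]
    · nlinarith
    · rw [abs_of_pos h, abs_of_pos (by linarith)]; linarith
    · refine Real.log_le_log (by positivity) ?_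
      have : (2 * y - 1) * p ≤ (2 * y - 1) * R 1 := by nlinarith
      linarith [Real.exp_le_exp.2 this]

theorem integrable_id_gaussianReal (w : ℝ≥0) : Integrable (fun η : ℝ => η) (gaussianReal 0 w) :=
  (memLp_id_gaussianReal (μ := 0) (v := w) 1).integrable (by simp)

theorem integrable_sq_gaussianReal (w : ℝ≥0) :
    Integrable (fun η : ℝ => η ^ 2) (gaussianReal 0 w) := by
  simpa using integrable_abs_pow_gaussianReal w 2

theorem integrable_quadratic_gaussianReal (w : ℝ≥0) (a b c : ℝ) :
    Integrable (fun η : ℝ => a + η ^ 2 - b * η + c * |η|) (gaussianReal 0 w) :=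
  (((integrable_const a).add (integrable_sq_gaussianReal w)).sub
    ((integrable_id_gaussianReal w).const_mul b)).add
    ((integrable_id_gaussianReal w).abs.const_mul c)

theorem integral_quadratic_gaussianReal (w : ℝ≥0) (a b c : ℝ) :
    ∫ η, (a + η ^ 2 - b * η + c * |η|) ∂gaussianReal 0 w =
      a + ∫ η, η ^ 2 ∂gaussianReal 0 w + c * ∫ η, |η| ∂gaussianReal 0 w := by
  have i1 : Integrable (fun η : ℝ => a + η ^ 2) (gaussianReal 0 w) :=
    (integrable_const a).add (integrable_sq_gaussianReal w)
  have i2 : Integrable (fun η : ℝ => b * η) (gaussianReal 0 w) :=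
    (integrable_id_gaussianReal w).const_mul b
  have i3 : Integrable (fun η : ℝ => c * |η|) (gaussianReal 0 w) :=
    (integrable_id_gaussianReal w).abs.const_mul c
  have i4 : Integrable (fun η : ℝ => a + η ^ 2 - b * η) (gaussianReal 0 w) := i1.sub i2
  rw [integral_add i4 i3, integral_sub i1 i2,
    integral_add (integrable_const a) (integrable_sq_gaussianReal w), integral_const_mul,
    integral_const_mul, integral_id_gaussianReal]
  simp

/-- Shifting the centre of the absolute error of a Gaussian by `a` does not decrease its mean, and
increases it only on the event `|η| ≤ |a|`. -/
theorem integral_abs_sub_gaussian (s a : ℝ) :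
    ∫ η, |η| ∂gaussianReal 0 (s ^ 2).toNNReal ≤
        ∫ η, |a - η| ∂gaussianReal 0 (s ^ 2).toNNReal ∧
      ∫ η, |a - η| ∂gaussianReal 0 (s ^ 2).toNNReal ≤
        ∫ η, |η| ∂gaussianReal 0 (s ^ 2).toNNReal +
          |a| * (gaussianReal 0 (s ^ 2).toNNReal).real (Set.Icc (-|a|) |a|) := by
  set γ := gaussianReal 0 (s ^ 2).toNNReal with hγ
  have hid : Integrable (fun η : ℝ => η) γ := integrable_id_gaussianReal _
  have i1 : Integrable (fun η => |a - η|) γ := ((integrable_const a).sub hid).abs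
  have i2 : Integrable (fun η => |a + η|) γ := ((integrable_const a).add hid).abs
  have hsymm : ∫ η, |a + η| ∂γ = ∫ η, |a - η| ∂γ := by
    have h := integral_map (μ := γ) (φ := fun x : ℝ => -x) (f := fun η => |a - η|)
      (by fun_prop) (by fun_prop)
    rw [hγ, gaussianReal_map_neg, neg_zero] at h
    rw [hγ, h]
    simp
  have hsum : ∫ η, (|a + η| + |a - η|) ∂γ = 2 * ∫ η, |a - η| ∂γ := by
    rw [integral_add i2 i1, hsymm]; ring
  constructor
  · have h1 : ∫ η, 2 * |η| ∂γ ≤ ∫ η, (|a + η| + |a - η|) ∂γ := by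
      refine integral_mono (hid.abs.const_mul 2) (i2.add i1) fun η => ?_
      have := abs_sub (a + η) (a - η)
      have h2 : |a + η - (a - η)| = 2 * |η| := by
        rw [show a + η - (a - η) = 2 * η by ring, abs_mul, abs_two]
      simp only
      linarith
    rw [integral_const_mul, hsum] at h1
    linarith
  · have i3 : Integrable ((Set.Icc (-|a|) |a|).indicator fun _ : ℝ => 2 * |a|) γ :=
      (integrable_const _).indicator measurableSet_Icc
    have h1 : ∫ η, (|a + η| + |a - η|) ∂γ ≤
        ∫ η, (2 * |η| + (Set.Icc (-|a|) |a|).indicator (fun _ => 2 * |a|) η) ∂γ := by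
      refine integral_mono (i2.add i1) ((hid.abs.const_mul 2).add i3) fun η => ?_
      simp only
      -- the sum on the left is twice the maximum of `|a|` and `|η|`
      by_cases hη : |η| ≤ |a|
      · rw [Set.indicator_of_mem (by rwa [Set.mem_Icc, ← abs_le])]
        rcases abs_cases (a + η) with h | h <;> rcases abs_cases (a - η) with h' | h' <;>
          rcases abs_cases a with h'' | h'' <;> rcases abs_cases η with h''' | h''' <;> linarith
      · rw [Set.indicator_of_notMem (by rwa [Set.mem_Icc, ← abs_le])]
        push Not at hη
        rcases abs_cases (a + η) with h | h <;> rcases abs_cases (a - η) with h' | h' <;>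
          rcases abs_cases a with h'' | h'' <;> rcases abs_cases η with h''' | h''' <;> linarith
    rw [hsum, integral_add (hid.abs.const_mul 2) i3, integral_const_mul,
      integral_indicator_const _ measurableSet_Icc, smul_eq_mul] at h1
    linarith

/-- The Gaussian density is bounded by `1 / s`. -/
theorem gaussianReal_real_Icc_le {s : ℝ} (hs : 0 < s) {r : ℝ} (hr : 0 ≤ r) :
    (gaussianReal 0 (s ^ 2).toNNReal).real (Set.Icc (-r) r) ≤ s⁻¹ * (2 * r) := by
  have hv : (s ^ 2).toNNReal ≠ 0 := by
    simp only [ne_eq, Real.toNNReal_eq_zero, not_le]; positivity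
  rw [measureReal_def, gaussianReal_apply_eq_integral 0 hv, ENNReal.toReal_ofReal
    (integral_nonneg fun x => gaussianPDFReal_nonneg _ _ _)]
  have hd (x : ℝ) : gaussianPDFReal 0 (s ^ 2).toNNReal x ≤ s⁻¹ := by
    rw [gaussianPDFReal, Real.coe_toNNReal _ (sq_nonneg s)]
    have h1 : Real.exp (-(x - 0) ^ 2 / (2 * s ^ 2)) ≤ 1 := by
      rw [Real.exp_le_one_iff, neg_div]
      have : 0 ≤ (x - 0) ^ 2 / (2 * s ^ 2) := by positivity
      linarith
    have h2 : s ≤ √(2 * Real.pi * s ^ 2) := by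
      refine Real.le_sqrt_of_sq_le ?_
      nlinarith [Real.pi_gt_three, sq_nonneg s]
    calc (√(2 * Real.pi * s ^ 2))⁻¹ * Real.exp (-(x - 0) ^ 2 / (2 * s ^ 2))
        ≤ s⁻¹ * 1 := by gcongr
      _ = s⁻¹ := mul_one _
  have h2 := setIntegral_mono_on (μ := volume) (s := Set.Icc (-r) r)
    (integrable_gaussianPDFReal 0 (s ^ 2).toNNReal).integrableOn
    (integrableOn_const (by simp)) measurableSet_Icc (fun x _ => hd x)
  refine h2.trans (le_of_eq ?_)
  rw [setIntegral_const, smul_eq_mul, measureReal_def, Real.volume_Icc, ENNReal.toReal_ofReal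
    (by linarith)]
  ring

theorem attackWeight_nonneg (ℓ : LossKind) (s t : ℝ) : 0 ≤ attackWeight ℓ s t := by
  cases ℓ <;> simp only [attackWeight]
  · exact mul_nonneg two_pos.le (integral_nonneg fun _ => abs_nonneg _)
  · exact zero_le_one
  · have := Real.sigmoid_pos t; have := Real.sigmoid_pos (-t); positivity

theorem exists_attackWeight_le (ℓ : LossKind) (s : ℝ) :
    ∃ W, 0 < W ∧ ∀ t, attackWeight ℓ s t ≤ W := by
  cases ℓ <;> simp only [attackWeight]
  · refine ⟨2 * (∫ η, |η| ∂gaussianReal 0 (s ^ 2).toNNReal) + 1, ?_, fun _ => by linarith⟩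
    have : 0 ≤ ∫ η, |η| ∂gaussianReal 0 (s ^ 2).toNNReal := integral_nonneg fun _ => abs_nonneg _
    positivity
  · exact ⟨1, one_pos, fun _ => le_rfl⟩
  · refine ⟨2, two_pos, fun t => ?_⟩
    have h0 := Real.sigmoid_pos t
    have h1 := Real.sigmoid_le_one t
    have h2 := Real.sigmoid_pos (-t)
    have h3 := Real.sigmoid_le_one (-t)
    nlinarith

/-- The attack weight is bounded below on bounded scores.  Only the logistic weight depends on the
score; it decays where the response is almost certain. -/
theorem exists_le_attackWeight (ℓ : LossKind) {s : ℝ} (hs : 0 < s) (K : ℝ) :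
    ∃ w, 0 < w ∧ ∀ t, |t| ≤ K → w ≤ attackWeight ℓ s t := by
  cases ℓ <;> simp only [attackWeight]
  · refine ⟨_, ?_, fun _ _ => le_rfl⟩
    have hv : (s ^ 2).toNNReal ≠ 0 := by
      simp only [ne_eq, Real.toNNReal_eq_zero, not_le]; positivity
    have h := integral_abs_pow_gaussianReal (s ^ 2).toNNReal 1
    simp only [pow_one] at h
    have hpos : 0 < ∫ η, |η| ∂gaussianReal 0 (s ^ 2).toNNReal := by
      rw [integral_pos_iff_support_of_nonneg (fun _ => abs_nonneg _)
        (by simpa using integrable_abs_pow_gaussianReal (s ^ 2).toNNReal 1)]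
      have : Function.support (fun η : ℝ => |η|) = {0}ᶜ := by ext; simp
      have := nullSingletonClass_gaussianReal (μ := 0) hv
      rw [‹Function.support (fun η : ℝ => |η|) = {0}ᶜ›, prob_compl_eq_one_iff
        (measurableSet_singleton 0) |>.2 (measure_singleton 0)]
      exact one_pos
    positivity
  · exact ⟨1, one_pos, fun _ _ => le_rfl⟩
  · refine ⟨2 * (Real.sigmoid (-K) * Real.sigmoid (-K)), ?_, fun t ht => ?_⟩
    · have := Real.sigmoid_pos (-K); positivity
    · rw [abs_le] at ht
      have h1 := Real.sigmoid_le (show -K ≤ t from ht.1)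
      have h2 := Real.sigmoid_le (show -K ≤ -t by linarith)
      have h3 := Real.sigmoid_pos (-K)
      have h4 := Real.sigmoid_pos t
      gcongr

theorem measurable_attackWeight (ℓ : LossKind) (s : ℝ) : Measurable (attackWeight ℓ s) := by
  cases ℓ
  · exact measurable_const
  · exact measurable_const
  · have : Continuous fun t => 2 * (Real.sigmoid t * Real.sigmoid (-t)) := by fun_prop
    exact this.measurable

/-- Bayes optimality of the true score. -/
theorem respAvg_loss_score_le (ℓ : LossKind) (s t p : ℝ) :
    respAvg ℓ s t (ℓ.loss t) ≤ respAvg ℓ s t (ℓ.loss p) := by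
  cases ℓ <;> simp only [respAvg, LossKind.loss]
  · set γ := gaussianReal 0 (s ^ 2).toNNReal with hγ
    have h1 (η : ℝ) : (p - (t + η)) ^ 2 = (p - t) ^ 2 + η ^ 2 - 2 * (p - t) * η + 0 * |η| := by
      ring
    have h2 (η : ℝ) : (t - (t + η)) ^ 2 = η ^ 2 := by ring
    simp only [h1, h2]
    rw [hγ, integral_quadratic_gaussianReal]
    nlinarith [sq_nonneg (p - t)]
  · have h := (integral_abs_sub_gaussian s (p - t)).1
    have h1 (η : ℝ) : |t - (t + η)| = |η| := by rw [sub_add_cancel_left, abs_neg]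
    have h2 (η : ℝ) : |p - (t + η)| = |p - t - η| := by rw [sub_add_eq_sub_sub]
    simpa only [h1, h2] using h
  · rw [sigmoid_neg_eq, one_sub_sigmoid_neg]
    have h1 := softplus_tangent_le t (p - t)
    have h2 := softplus_tangent_le (-t) (t - p)
    have h3 := Real.sigmoid_pos t
    have h4 := Real.sigmoid_pos (-t)
    simp only [mul_one, mul_zero, zero_sub, neg_mul, one_mul, show (2 : ℝ) - 1 = 1 by norm_num]
    rw [show t + (p - t) = p by ring] at h1
    rw [show -t + (t - p) = -p by ring] at h2
    nlinarith [mul_le_mul_of_nonneg_left h1 h4.le, mul_le_mul_of_nonneg_left h2 h3.le]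

theorem measurable_comp_sign (R : ℝ → ℝ) {f : ℝ → ℝ} (hf : Measurable f) :
    Measurable fun x => R (Real.sign (f x)) := by
  have h (x : ℝ) : R (Real.sign (f x)) =
      if f x < 0 then R (-1) else if 0 < f x then R 1 else R 0 := by
    unfold Real.sign; split_ifs <;> rfl
  simp only [h]
  exact Measurable.ite (measurableSet_lt hf measurable_const) measurable_const
    (Measurable.ite (measurableSet_lt measurable_const hf) measurable_const measurable_const)

/-- The conditional mean of the attacked loss exceeds the Bayes risk by the attack weight times the
shift `D` of the prediction, up to terms which are quadratic in the error `p - t` of the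
prediction and in `D`, or of the order of the error `E` in the shift.  The path `R` gives the
prediction at the attack directions `1`, `-1`, and at `0` without attack. -/
theorem exists_respAvg_attack (ℓ : LossKind) {s : ℝ} (hs : 0 < s) :
    ∃ C, 0 < C ∧ ∀ (t p D E : ℝ) (R : ℝ → ℝ), 0 ≤ D → 0 ≤ E → R 0 = p →
      |R 1 - p - D| ≤ E → |R (-1) - p + D| ≤ E →
      |respAvg ℓ s t (fun y => ℓ.loss (R (Real.sign (ℓ.slope p y))) y)
          - respAvg ℓ s t (ℓ.loss t) - attackWeight ℓ s t * D| ≤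
        C * ((p - t) ^ 2 + D ^ 2 + E + E ^ 2) := by
  set γ := gaussianReal 0 (s ^ 2).toNNReal with hγ
  have hv : (s ^ 2).toNNReal ≠ 0 := by
    simp only [ne_eq, Real.toNNReal_eq_zero, not_le]; positivity
  have hna := nullSingletonClass_gaussianReal (μ := 0) hv
  rw [← hγ] at hna
  have hid : Integrable (fun η : ℝ => η) γ := integrable_id_gaussianReal _
  have hne (a : ℝ) : ∀ᵐ η ∂γ, η ≠ a := by
    rw [ae_iff]; simp
  -- Off a null set the sign of `p - (t + η)` is `±1`, and the attack increases the distance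
  -- `|p - t - η|` of the prediction from the response by some `Δ` close to `D`.
  have hshift (t p D E : ℝ) (R : ℝ → ℝ) (h1 : |R 1 - p - D| ≤ E) (h2 : |R (-1) - p + D| ≤ E) :
      ∀ᵐ η ∂γ, ∃ Δ, |Δ - D| ≤ E ∧
        |R (Real.sign (p - (t + η))) - (t + η)| = |(|p - t - η|) + Δ| := by
    filter_upwards [hne (p - t)] with η hη
    rcases lt_or_gt_of_ne hη with h | h
    · refine ⟨R 1 - p, h1, ?_⟩
      rw [Real.sign_of_pos (by linarith), abs_of_pos (show 0 < p - t - η by linarith)]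
      congr 1; ring
    · refine ⟨p - R (-1), by rwa [← abs_neg, show -(p - R (-1) - D) = R (-1) - p + D by ring], ?_⟩
      rw [Real.sign_of_neg (by linarith), abs_of_neg (show p - t - η < 0 by linarith), ← abs_neg]
      congr 1; ring
  cases ℓ
  · simp only [respAvg, LossKind.loss, LossKind.slope, attackWeight, ← hγ]
    set A := ∫ η, |η| ∂γ with hA
    have hA0 : 0 ≤ A := integral_nonneg fun _ => abs_nonneg _
    refine ⟨2 * A + 6, by positivity, fun t p D E R hD hE h0 h1 h2 => ?_⟩
    set a := p - t with ha
    have key := abs_integral_sub_integral_le (Q := γ)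
      (F := fun η => (R (Real.sign (p - (t + η))) - (t + η)) ^ 2)
      (G := fun η => a ^ 2 + η ^ 2 - 2 * a * η + 2 * D * |η|)
      (H := fun η => 2 * E * |η| + (2 * a ^ 2 + 3 * D ^ 2 + 3 * E ^ 2))
      (((measurable_comp_sign R (by fun_prop)).sub (by fun_prop)).pow_const 2).aestronglyMeasurable
      (integrable_quadratic_gaussianReal _ _ _ _)
      ((hid.abs.const_mul _).add (integrable_const _)) ?_
    · rw [hγ, integral_quadratic_gaussianReal, ← hγ, integral_add (hid.abs.const_mul _)
        (integrable_const _)] at key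
      simp only [integral_const_mul, integral_const, probReal_univ, smul_eq_mul, one_mul, ← hA]
        at key
      have h3 (η : ℝ) : (t - (t + η)) ^ 2 = η ^ 2 := by ring
      simp only [h3]
      rw [abs_le] at key ⊢
      constructor <;> nlinarith [key.1, key.2, sq_nonneg a, sq_nonneg D, sq_nonneg E,
        mul_nonneg hA0 hE, mul_nonneg hA0 (sq_nonneg a), mul_nonneg hA0 (sq_nonneg D),
        mul_nonneg hA0 (sq_nonneg E)]
    · filter_upwards [hshift t p D E R h1 h2] with η ⟨Δ, hΔ, h⟩
      rw [← sq_abs (R _ - _), h, sq_abs, ← ha]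
      have e1 : ((|a - η|) + Δ) ^ 2 - (a ^ 2 + η ^ 2 - 2 * a * η + 2 * D * |η|) =
          2 * |a - η| * (Δ - D) + 2 * D * (|a - η| - |η|) + Δ ^ 2 := by
        linear_combination sq_abs (a - η)
      have e2 : |(|a - η| - |η|)| ≤ |a| := by
        have h5 := abs_abs_sub_abs_le (a - η) (-η)
        rw [abs_neg] at h5
        simpa using h5
      have e3 : |a - η| ≤ |a| + |η| := abs_sub a η
      have e4 : |2 * |a - η| * (Δ - D)| ≤ 2 * (|a| + |η|) * E := by
        rw [abs_mul, abs_of_nonneg (show 0 ≤ 2 * |a - η| by positivity)]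
        gcongr
      have e5 : |2 * D * (|a - η| - |η|)| ≤ 2 * D * |a| := by
        rw [abs_mul, abs_of_nonneg (show 0 ≤ 2 * D by positivity)]
        gcongr
      have e6 : Δ ^ 2 ≤ 2 * D ^ 2 + 2 * E ^ 2 := by
        rw [abs_le] at hΔ
        nlinarith [sq_nonneg (Δ - D - D), mul_nonneg (sub_nonneg.2 hΔ.2)
          (show 0 ≤ E + (Δ - D) by linarith)]
      rw [e1]
      have e7 := abs_add_three (2 * |a - η| * (Δ - D)) (2 * D * (|a - η| - |η|)) (Δ ^ 2)
      rw [abs_of_nonneg (sq_nonneg Δ)] at e7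
      nlinarith [sq_nonneg (|a| - E), sq_nonneg (|a| - D), sq_abs a]
  · simp only [respAvg, LossKind.loss, LossKind.slope, attackWeight, ← hγ]
    refine ⟨2 * s⁻¹ + 1, by positivity, fun t p D E R hD hE h0 h1 h2 => ?_⟩
    set a := p - t with ha
    have i1 : Integrable (fun η => |a - η|) γ := ((integrable_const a).sub hid).abs
    have key := abs_integral_sub_integral_le (Q := γ)
      (F := fun η => |R (Real.sign (p - (t + η))) - (t + η)|)
      (G := fun η => |a - η| + D) (H := fun _ => E)
      ((measurable_comp_sign R (by fun_prop)).sub (by fun_prop)).abs.aestronglyMeasurable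
      (i1.add (integrable_const _)) (integrable_const _) ?_
    · rw [integral_add i1 (integrable_const _)] at key
      simp only [integral_const, probReal_univ, smul_eq_mul, one_mul] at key
      have h3 (η : ℝ) : |t - (t + η)| = |η| := by rw [sub_add_cancel_left, abs_neg]
      simp only [h3]
      obtain ⟨k1, k2⟩ := integral_abs_sub_gaussian s a
      rw [← hγ] at k1 k2
      have k3 := gaussianReal_real_Icc_le hs (abs_nonneg a)
      rw [← hγ] at k3
      have k4 : |a| * γ.real (Set.Icc (-|a|) |a|) ≤ 2 * s⁻¹ * a ^ 2 := by
        rw [← sq_abs a]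
        nlinarith [mul_le_mul_of_nonneg_left k3 (abs_nonneg a)]
      have hs' : 0 < s⁻¹ := inv_pos.2 hs
      rw [abs_le] at key ⊢
      constructor <;> nlinarith [key.1, key.2, sq_nonneg a, sq_nonneg D, sq_nonneg E,
        mul_nonneg hs'.le hE, mul_nonneg hs'.le (sq_nonneg D), mul_nonneg hs'.le (sq_nonneg E)]
    · filter_upwards [hshift t p D E R h1 h2] with η ⟨Δ, hΔ, h⟩
      rw [h, ← ha]
      have e1 := abs_abs_sub_abs_le (|a - η| + Δ) (|a - η| + D)
      rw [abs_of_nonneg (show 0 ≤ |a - η| + D by positivity),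
        show |a - η| + Δ - (|a - η| + D) = Δ - D by ring] at e1
      exact e1.trans hΔ
  · simp only [respAvg, LossKind.loss, LossKind.slope, attackWeight]
    refine ⟨6, by norm_num, fun t p D E R hD hE h0 h1 h2 => ?_⟩
    rw [sigmoid_neg_eq, one_sub_sigmoid_neg]
    simp only [mul_one, mul_zero, zero_sub, neg_mul, one_mul, show (2 : ℝ) - 1 = 1 by norm_num]
    rw [Real.sign_of_pos one_pos, Real.sign_of_neg (show (-1 : ℝ) < 0 by norm_num)]
    set a := p - t with ha
    have q1 := abs_softplus_taylor_le t (R 1 - t)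
    have q2 := abs_softplus_taylor_le (-t) (t - R (-1))
    rw [show t + (R 1 - t) = R 1 by ring] at q1
    rw [show -t + (t - R (-1)) = -R (-1) by ring] at q2
    have s1 := Real.sigmoid_pos t
    have s2 := Real.sigmoid_le_one t
    have s3 := Real.sigmoid_pos (-t)
    have s4 := Real.sigmoid_le_one (-t)
    set σ := Real.sigmoid t
    set σ' := Real.sigmoid (-t)
    have r1 : (R 1 - t) ^ 2 ≤ 3 * a ^ 2 + 3 * D ^ 2 + 3 * E ^ 2 := by
      rw [abs_le] at h1
      have : (R 1 - p - D) ^ 2 ≤ E ^ 2 := sq_le_sq' (by linarith) h1.2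
      have e : R 1 - t = a + D + (R 1 - p - D) := by rw [ha]; ring
      rw [e]
      nlinarith [sq_nonneg (a - D), sq_nonneg (a - (R 1 - p - D)), sq_nonneg (D - (R 1 - p - D))]
    have r2 : (t - R (-1)) ^ 2 ≤ 3 * a ^ 2 + 3 * D ^ 2 + 3 * E ^ 2 := by
      rw [abs_le] at h2
      have : (R (-1) - p + D) ^ 2 ≤ E ^ 2 := sq_le_sq' (by linarith) h2.2
      have e : t - R (-1) = -a + D - (R (-1) - p + D) := by rw [ha]; ring
      rw [e]
      nlinarith [sq_nonneg (a + D), sq_nonneg (a - (R (-1) - p + D)),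
        sq_nonneg (D + (R (-1) - p + D))]
    have ident : σ' * Real.log (1 + Real.exp (R 1)) + σ * Real.log (1 + Real.exp (-R (-1))) -
        (σ' * Real.log (1 + Real.exp t) + σ * Real.log (1 + Real.exp (-t))) - 2 * (σ * σ') * D =
        σ' * (Real.log (1 + Real.exp (R 1)) - Real.log (1 + Real.exp t) - σ * (R 1 - t)) +
        σ * (Real.log (1 + Real.exp (-R (-1))) - Real.log (1 + Real.exp (-t)) -
          σ' * (t - R (-1))) + σ * σ' * ((R 1 - p - D) - (R (-1) - p + D)) := by ring
    rw [ident]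
    refine (abs_add_three _ _ _).trans ?_
    have t1 : ∀ {c x B : ℝ}, 0 < c → c ≤ 1 → |x| ≤ B → |c * x| ≤ B := by
      intro c x B hc hc1 hx
      rw [abs_mul, abs_of_pos hc]
      exact (mul_le_of_le_one_left (abs_nonneg x) hc1).trans hx
    have t2 : |(R 1 - p - D) - (R (-1) - p + D)| ≤ 2 * E :=
      (abs_sub _ _).trans (by linarith)
    have t3 := t1 s3 s4 q1
    have t4 := t1 s1 s2 q2
    have t5 := t1 (mul_pos s1 s3) (mul_le_one₀ s2 s3.le s4) t2
    linarith [sq_nonneg a, sq_nonneg D, sq_nonneg E]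

end Response

/-! ### The attack on a network with the gated activation -/

section Attack

variable {d H : ℕ}

/-- The weight vector `W_h` of the node `h`. -/
noncomputable def Network.col (N : Network d H) (h : Fin H) : Vec d :=
  WithLp.toLp 2 fun i => N.weight i h

/-- The pre-activation `zᵀ W_h`. -/
noncomputable def Network.pre (N : Network d H) (z : Vec d) (h : Fin H) : ℝ :=
  ∑ i, z i * N.weight i h

theorem Network.pre_eq_inner (N : Network d H) (z : Vec d) (h : Fin H) :
    N.pre z h = inner ℝ (N.col h) z := by
  simp [Network.pre, Network.col, PiLp.inner_apply]

theorem Network.predict_eq (N : Network d H) (z : Vec d) :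
    N.predict z = ∑ h, gate (N.pre z h) (N.intercept h) := rfl

/-- The sum of the weight vectors of the active nodes, which is the gradient of the prediction away
from the activation thresholds. -/
noncomputable def Network.activeGrad (N : Network d H) (z : Vec d) : Vec d :=
  ∑ h, if N.intercept h ≤ |N.pre z h| then N.col h else 0

/-- The normalized gradient of the prediction (zero where the gradient vanishes). -/
noncomputable def Network.dir (N : Network d H) (z : Vec d) : Vec d :=
  ‖N.activeGrad z‖⁻¹ • N.activeGrad z

/-- No node is exactly at its activation threshold. -/
def Network.Regular (N : Network d H) (z : Vec d) : Prop :=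
  ∀ h, |N.pre z h| ≠ N.intercept h

/-- The loss after the step `e · sign(slope) · dir`. -/
noncomputable def stepLoss (ℓ : LossKind) (e : ℝ) (N : Network d H) (z : Vec d) (y : ℝ) : ℝ :=
  ℓ.loss (N.predict (z + (e * Real.sign (ℓ.slope (N.predict z) y)) • N.dir z)) y

theorem Network.continuous_pre (N : Network d H) (h : Fin H) :
    Continuous fun z => N.pre z h := by
  unfold Network.pre; fun_prop

theorem Network.predict_eventuallyEq (N : Network d H) {z : Vec d} (hz : N.Regular z) :
    N.predict =ᶠ[𝓝 z] fun z' => inner ℝ (N.activeGrad z) z' := by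
  have h1 : ∀ᶠ z' in 𝓝 z, ∀ h, (N.intercept h ≤ |N.pre z' h| ↔ N.intercept h ≤ |N.pre z h|) := by
    refine eventually_all.2 fun h => ?_
    have hc : Tendsto (fun z' => |N.pre z' h|) (𝓝 z) (𝓝 |N.pre z h|) :=
      ((N.continuous_pre h).abs).tendsto z
    rcases lt_or_gt_of_ne (hz h) with hlt | hgt
    · filter_upwards [hc.eventually (gt_mem_nhds hlt)] with z' hz'
      simp only [not_le.2 hlt, not_le.2 hz']
    · filter_upwards [hc.eventually (lt_mem_nhds hgt)] with z' hz'
      simp only [hgt.le, le_of_lt hz']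
  filter_upwards [h1] with z' hz'
  rw [N.predict_eq, Network.activeGrad, sum_inner]
  refine Finset.sum_congr rfl fun h _ => ?_
  rw [gate]
  by_cases hh : N.intercept h ≤ |N.pre z h|
  · rw [if_pos ((hz' h).2 hh), if_pos hh, N.pre_eq_inner]
  · rw [if_neg (fun h' => hh ((hz' h).1 h')), if_neg hh, inner_zero_left]

/-- Away from the activation thresholds the fast gradient attack is a step of length `e` along the
normalized gradient of the prediction, in the direction which increases the loss. -/
theorem advLoss_eq_stepLoss (ℓ : LossKind) (e : ℝ) (N : Network d H) {z : Vec d}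
    (hz : N.Regular z) (y : ℝ) : advLoss ℓ e N z y = stepLoss ℓ e N z y := by
  have hp : HasFDerivAt N.predict (innerSL ℝ (N.activeGrad z)) z :=
    ((innerSL ℝ (N.activeGrad z)).hasFDerivAt (x := z)).congr_of_eventuallyEq
      (N.predict_eventuallyEq hz)
  suffices h : attack ℓ e N z y =
      (e * Real.sign (ℓ.slope (N.predict z) y)) • N.dir z by
    rw [advLoss, stepLoss, h]
  rcases exists_hasDerivAt_loss ℓ (N.predict z) y with ⟨_, r, hr, hr0, hsign⟩ | ⟨h0, hmin⟩
  · have hc := hr.comp_hasFDerivAt z hp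
    have hg : gradient (fun z' : Vec d => ℓ.loss (N.predict z') y) z = r • N.activeGrad z := by
      refine HasGradientAt.gradient ?_
      rw [hasGradientAt_iff_hasFDerivAt]
      have he : InnerProductSpace.toDual ℝ (Vec d) (r • N.activeGrad z) =
          r • innerSL ℝ (N.activeGrad z) := by
        ext x
        simp [InnerProductSpace.toDual_apply_apply]
      rw [he]
      exact hc
    rw [attack, hg, ← hsign]
    simp only [Network.dir, norm_smul, mul_inv, Real.norm_eq_abs, smul_smul]
    congr 1
    have : |r|⁻¹ * r = Real.sign r := by
      rcases lt_or_gt_of_ne hr0 with h | h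
      · rw [Real.sign_of_neg h, abs_of_neg h, inv_neg, neg_mul, inv_mul_cancel₀ hr0]
      · rw [Real.sign_of_pos h, abs_of_pos h, inv_mul_cancel₀ hr0]
    rw [← this]; ring
  · have hg : gradient (fun z' : Vec d => ℓ.loss (N.predict z') y) z = 0 := by
      have hloc : IsLocalMin (fun z' : Vec d => ℓ.loss (N.predict z') y) z :=
        Eventually.of_forall fun z' => hmin _
      rw [gradient, hloc.fderiv_eq_zero, map_zero]
    rw [attack, hg, h0, Real.sign_zero]
    simp

theorem gate_mono (e : ℝ) : Monotone fun v => gate v e := by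
  intro v w hvw
  simp only [gate]
  split_ifs with h1 h2 h2
  · exact hvw
  · push Not at h2
    rw [abs_lt] at h2
    rcases le_abs.1 h1 with h | h <;> linarith
  · push Not at h1
    rw [abs_lt] at h1
    rcases le_abs.1 h2 with h | h <;> linarith
  · exact le_rfl

theorem abs_gate_le (v e : ℝ) : |gate v e| ≤ |v| := by
  unfold gate; split_ifs
  · exact le_rfl
  · simp

theorem Network.pre_add_smul (N : Network d H) (z u : Vec d) (t : ℝ) (h : Fin H) :
    N.pre (z + t • u) h = N.pre z h + t * N.pre u h := by
  simp only [N.pre_eq_inner, inner_add_right, inner_smul_right]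

/-- If the weight vectors have nonnegative inner products, a step along the gradient of the
prediction raises every pre-activation. -/
theorem Network.predict_step_mono (N : Network d H)
    (hN : ∀ h h', 0 ≤ inner ℝ (N.col h) (N.col h')) (z : Vec d) :
    Monotone fun t : ℝ => N.predict (z + t • N.dir z) := by
  intro t t' htt'
  simp only [N.predict_eq]
  refine Finset.sum_le_sum fun h _ => gate_mono _ ?_
  rw [N.pre_add_smul, N.pre_add_smul]
  have : 0 ≤ N.pre (N.dir z) h := by
    rw [N.pre_eq_inner, Network.dir, inner_smul_right, Network.activeGrad, inner_sum]
    refine mul_nonneg (by positivity) (Finset.sum_nonneg fun h' _ => ?_)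
    split_ifs
    · exact hN h h'
    · simp
  nlinarith

/-- The attack does not decrease the loss of a network whose weight vectors have nonnegative inner
products. -/
theorem stepLoss_zero_le (ℓ : LossKind) {e : ℝ} (he : 0 ≤ e) (N : Network d H)
    (hN : ∀ h h', 0 ≤ inner ℝ (N.col h) (N.col h')) (z : Vec d) (y : ℝ) :
    stepLoss ℓ 0 N z y ≤ stepLoss ℓ e N z y := by
  have hm := N.predict_step_mono hN z
  have h0 : N.predict (z + (0 : ℝ) • N.dir z) = N.predict z := by simp
  have h := loss_le_of_sign ℓ (p := N.predict z) (y := y)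
    (R := fun τ => N.predict (z + (e * τ) • N.dir z))
    (by rw [← h0]; exact hm (by simpa using he)) (by rw [← h0]; exact hm (by simpa using he))
    (by simp)
  simpa [stepLoss] using h

theorem stepLoss_zero (ℓ : LossKind) (N : Network d H) (z : Vec d) (y : ℝ) :
    stepLoss ℓ 0 N z y = ℓ.loss (N.predict z) y := by
  simp [stepLoss]

theorem measurable_gate (e : ℝ) : Measurable fun v => gate v e := (gate_mono e).measurable

theorem Network.measurable_predict (N : Network d H) : Measurable N.predict := by
  have : N.predict = fun z => ∑ h, gate (N.pre z h) (N.intercept h) := rfl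
  rw [this]
  exact Finset.measurable_sum _ fun h _ =>
    (measurable_gate _).comp (N.continuous_pre h).measurable

theorem Network.measurable_dir (N : Network d H) : Measurable N.dir := by
  have h : Measurable N.activeGrad := by
    refine Finset.measurable_sum _ fun h _ => Measurable.ite ?_ measurable_const measurable_const
    exact measurableSet_le measurable_const (N.continuous_pre h).abs.measurable
  exact h.norm.inv.smul h

theorem measurable_loss (ℓ : LossKind) : Measurable fun q : ℝ × ℝ => ℓ.loss q.1 q.2 := by
  cases ℓ <;> simp only [LossKind.loss] <;> fun_prop

theorem measurable_slope (ℓ : LossKind) : Measurable fun q : ℝ × ℝ => ℓ.slope q.1 q.2 := by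
  cases ℓ <;> simp only [LossKind.slope] <;> fun_prop

theorem measurable_stepLoss (ℓ : LossKind) (e : ℝ) (N : Network d H) :
    Measurable fun w : Vec d × ℝ => stepLoss ℓ e N w.1 w.2 := by
  have h1 : Measurable fun w : Vec d × ℝ => ℓ.slope (N.predict w.1) w.2 :=
    (measurable_slope ℓ).comp ((N.measurable_predict.comp measurable_fst).prodMk measurable_snd)
  have h2 : Measurable Real.sign := measurable_comp_sign id measurable_id
  have h3 : Measurable fun w : Vec d × ℝ =>
      w.1 + (e * Real.sign (ℓ.slope (N.predict w.1) w.2)) • N.dir w.1 :=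
    measurable_fst.add (((h2.comp h1).const_mul e).smul (N.measurable_dir.comp measurable_fst))
  exact (measurable_loss ℓ).comp ((N.measurable_predict.comp h3).prodMk measurable_snd)

theorem measurableSet_regular (N : Network d H) : MeasurableSet {z | N.Regular z} := by
  have : {z | N.Regular z} = ⋂ h, {z | |N.pre z h| ≠ N.intercept h} := by
    ext; simp [Network.Regular]
  rw [this]
  exact MeasurableSet.iInter fun h =>
    (measurableSet_eq_fun (N.continuous_pre h).abs.measurable measurable_const).compl

theorem Network.abs_predict_le (N : Network d H) (z : Vec d) :
    |N.predict z| ≤ (∑ h, ‖N.col h‖) * ‖z‖ := by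
  rw [N.predict_eq, Finset.sum_mul]
  refine (Finset.abs_sum_le_sum_abs _ _).trans (Finset.sum_le_sum fun h _ => ?_)
  refine (abs_gate_le _ _).trans ?_
  rw [N.pre_eq_inner]
  exact abs_real_inner_le_norm _ _

theorem Network.norm_dir_le (N : Network d H) (z : Vec d) : ‖N.dir z‖ ≤ 1 := by
  rw [Network.dir, norm_smul, norm_inv, norm_norm]
  exact inv_mul_le_one

theorem abs_stepLoss_le (ℓ : LossKind) (e : ℝ) (N : Network d H) :
    ∃ K, ∀ z y, |stepLoss ℓ e N z y| ≤ K * (1 + ‖z‖ ^ 2 + y ^ 2) := by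
  set B := ∑ h, ‖N.col h‖ with hB
  have hB0 : 0 ≤ B := Finset.sum_nonneg fun _ _ => norm_nonneg _
  refine ⟨4 * (1 + 2 * B ^ 2 + 2 * B ^ 2 * e ^ 2), fun z y => ?_⟩
  rw [stepLoss, abs_of_nonneg (loss_nonneg _ _ _)]
  refine (loss_le _ _ _).trans ?_
  set z' := z + (e * Real.sign (ℓ.slope (N.predict z) y)) • N.dir z with hz'
  have h1 : ‖z'‖ ≤ ‖z‖ + |e| := by
    refine (norm_add_le _ _).trans ?_
    gcongr
    rw [norm_smul, Real.norm_eq_abs, abs_mul]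
    have h2 : |Real.sign (ℓ.slope (N.predict z) y)| ≤ 1 := by
      rcases Real.sign_apply_eq (ℓ.slope (N.predict z) y) with h | h | h <;> rw [h] <;> simp
    calc |e| * |Real.sign (ℓ.slope (N.predict z) y)| * ‖N.dir z‖ ≤ |e| * 1 * 1 := by
          gcongr; exact N.norm_dir_le z
      _ = |e| := by ring
  have h3 := N.abs_predict_le z'
  have h4 : N.predict z' ^ 2 ≤ B ^ 2 * (2 * ‖z‖ ^ 2 + 2 * e ^ 2) := by
    rw [← sq_abs]
    calc |N.predict z'| ^ 2 ≤ (B * (‖z‖ + |e|)) ^ 2 := by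
          gcongr; exact h3.trans (by gcongr)
      _ ≤ B ^ 2 * (2 * ‖z‖ ^ 2 + 2 * e ^ 2) := by
          rw [mul_pow]; gcongr
          nlinarith [sq_nonneg (‖z‖ - |e|), sq_abs e]
  have h5 : 0 ≤ B ^ 2 := sq_nonneg _
  have h6 : 0 ≤ ‖z‖ ^ 2 := sq_nonneg _
  nlinarith [sq_nonneg y, sq_nonneg e, mul_nonneg h5 (sq_nonneg e), mul_nonneg h5 (sq_nonneg y),
    mul_nonneg (mul_nonneg h5 (sq_nonneg e)) (sq_nonneg y),
    mul_nonneg (mul_nonneg h5 (sq_nonneg e)) h6]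

end Attack

section DataLaw

variable {P : Model} {d : ℕ}

theorem isProbabilityMeasure_featureLaw (hP : P.SparseCoding) (d : ℕ) :
    IsProbabilityMeasure (P.featureLaw d) := by
  have := hP.prob d
  exact Measure.isProbabilityMeasure_map (by fun_prop)

instance isProbabilityMeasure_noiseLaw : IsProbabilityMeasure (P.noiseLaw d) :=
  Measure.isProbabilityMeasure_map (by fun_prop)

theorem continuous_observe : Continuous fun q : Vec d × Vec d => P.observe d q.1 q.2 := by
  have : Continuous fun q : Vec d × Vec d => (P.M d).mulVec q.1.ofLp :=
    Continuous.matrix_mulVec continuous_const (by fun_prop)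
  unfold Model.observe
  fun_prop

theorem continuous_score : Continuous fun x : Vec d => P.score d x := by
  unfold Model.score; fun_prop

theorem measurable_featureVec : Measurable (featureVec (d := d)) := by
  unfold featureVec; fun_prop

/-- Mean values under the data law, computed by averaging over the response first. -/
theorem integral_dataLaw (hP : P.SparseCoding) (ℓ : LossKind) {Φ : Vec d × Vec d × ℝ → ℝ}
    (hΦ : Integrable Φ (P.dataLaw ℓ d)) :
    Integrable (fun ω => respAvg ℓ P.s (P.score d (featureVec ω))
      fun y => Φ (featureVec ω, inputVec P d ω, y)) (baseLaw P d) ∧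
    ∫ w, Φ w ∂P.dataLaw ℓ d = ∫ ω, respAvg ℓ P.s (P.score d (featureVec ω))
      (fun y => Φ (featureVec ω, inputVec P d ω, y)) ∂baseLaw P d := by
  have := isProbabilityMeasure_featureLaw hP d
  have hT := measurePreserving_feature_noise d hP
  set Λ := (P.featureLaw d).prod (P.noiseLaw d) with hΛ
  -- It is enough to average over the response at fixed features and input noise.
  suffices h : Integrable (fun q : Vec d × Vec d => respAvg ℓ P.s (P.score d q.1)
      fun y => Φ (q.1, P.observe d q.1 q.2, y)) Λ ∧
      ∫ w, Φ w ∂P.dataLaw ℓ d = ∫ q, respAvg ℓ P.s (P.score d q.1)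
        (fun y => Φ (q.1, P.observe d q.1 q.2, y)) ∂Λ by
    refine ⟨hT.integrable_comp_of_integrable h.1, h.2.trans ?_⟩
    have h1 := h.1.aestronglyMeasurable
    rw [← hT.map_eq] at h1 ⊢
    exact integral_map hT.measurable.aemeasurable h1
  have hg : Measurable fun q : (Vec d × Vec d) × ℝ =>
      (q.1.1, P.observe d q.1.1 q.1.2, P.score d q.1.1 + q.2) := by
    have := (continuous_observe (P := P) (d := d)).measurable
    have := (continuous_score (P := P) (d := d)).measurable
    exact (by fun_prop : Measurable fun q : (Vec d × Vec d) × ℝ => q.1.1).prodMk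
      (((continuous_observe (P := P) (d := d)).measurable.comp measurable_fst).prodMk
        (((continuous_score (P := P) (d := d)).measurable.comp
          (measurable_fst.comp measurable_fst)).add measurable_snd))
  have hreg : Integrable Φ (P.regressionLaw d) →
      Integrable (fun q : Vec d × Vec d => ∫ η, Φ (q.1, P.observe d q.1 q.2, P.score d q.1 + η)
        ∂gaussianReal 0 (P.s ^ 2).toNNReal) Λ ∧
      ∫ w, Φ w ∂P.regressionLaw d = ∫ q : Vec d × Vec d, ∫ η,
        Φ (q.1, P.observe d q.1 q.2, P.score d q.1 + η) ∂gaussianReal 0 (P.s ^ 2).toNNReal ∂Λ := by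
    intro h
    rw [Model.regressionLaw] at h ⊢
    have h1 := h.comp_measurable hg
    refine ⟨h1.integral_prod_left, ?_⟩
    rw [integral_map hg.aemeasurable h.aestronglyMeasurable]
    exact integral_prod _ h1
  cases ℓ
  · exact hreg hΦ
  · exact hreg hΦ
  · change Integrable Φ (P.classificationLaw d) at hΦ
    change _ ∧ ∫ w, Φ w ∂P.classificationLaw d = _
    rw [Model.classificationLaw] at hΦ ⊢
    rw [← hΛ] at hΦ ⊢
    have hs : Measurable fun q : Vec d × Vec d => 1 / (1 + Real.exp (P.score d q.1)) := by
      have : Measurable fun q : Vec d × Vec d => P.score d q.1 :=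
        (continuous_score (P := P) (d := d)).measurable.comp measurable_fst
      exact measurable_const.div (measurable_const.add this.exp)
    have hgy (y : ℝ) : Measurable fun q : Vec d × Vec d => (q.1, P.observe d q.1 q.2, y) :=
      measurable_fst.prodMk ((continuous_observe (P := P) (d := d)).measurable.prodMk
        measurable_const)
    obtain ⟨h1, h0⟩ := integrable_add_measure.1 hΦ
    have hpart (π : Vec d × Vec d → ℝ) (hπ : Measurable π) (hπ0 : ∀ q, 0 ≤ π q) (y : ℝ)
        (hi : Integrable Φ ((Λ.withDensity fun q => ENNReal.ofReal (π q)).map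
          fun q => (q.1, P.observe d q.1 q.2, y))) :
        Integrable (fun q => π q * Φ (q.1, P.observe d q.1 q.2, y)) Λ ∧
        ∫ w, Φ w ∂((Λ.withDensity fun q => ENNReal.ofReal (π q)).map
          fun q => (q.1, P.observe d q.1 q.2, y)) =
          ∫ q, π q * Φ (q.1, P.observe d q.1 q.2, y) ∂Λ := by
      have hi' := hi.comp_measurable (hgy y)
      rw [integrable_withDensity_iff_integrable_smul' hπ.ennreal_ofReal (by simp)] at hi'
      refine ⟨by simpa [ENNReal.toReal_ofReal (hπ0 _)] using hi', ?_⟩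
      rw [integral_map (hgy y).aemeasurable hi.aestronglyMeasurable,
        integral_withDensity_eq_integral_toReal_smul hπ.ennreal_ofReal (by simp)]
      simp [ENNReal.toReal_ofReal (hπ0 _)]
    have hp0 (q : Vec d × Vec d) : 0 ≤ 1 / (1 + Real.exp (P.score d q.1)) := by positivity
    have hp1 (q : Vec d × Vec d) : 0 ≤ 1 - 1 / (1 + Real.exp (P.score d q.1)) := by
      rw [sub_nonneg, div_le_one (by positivity)]
      linarith [Real.exp_pos (P.score d q.1)]
    obtain ⟨i1, e1⟩ := hpart _ hs hp0 1 h1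
    obtain ⟨i0, e0⟩ := hpart (fun q => 1 - 1 / (1 + Real.exp (P.score d q.1)))
      (measurable_const.sub hs) hp1 0 h0
    simp only [respAvg]
    refine ⟨i1.add i0, ?_⟩
    rw [integral_add_measure h1 h0, integral_add i1 i0, e1, e0]

/-- Almost sure properties of the input do not depend on the response. -/
theorem ae_dataLaw (hP : P.SparseCoding) (ℓ : LossKind) {A : Set (Vec d)} (hA : MeasurableSet A)
    (h : ∀ᵐ ω ∂baseLaw P d, inputVec P d ω ∈ A) : ∀ᵐ w ∂P.dataLaw ℓ d, w.2.1 ∈ A := by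
  have := isProbabilityMeasure_featureLaw hP d
  have hT := measurePreserving_feature_noise d hP
  have hobs := (continuous_observe (P := P) (d := d)).measurable
  have hAe : MeasurableSet {w : Vec d × Vec d × ℝ | w.2.1 ∈ A} :=
    (measurable_fst.comp measurable_snd) hA
  have h1 : ∀ᵐ q ∂(P.featureLaw d).prod (P.noiseLaw d), P.observe d q.1 q.2 ∈ A := by
    rw [← hT.map_eq, ae_map_iff hT.measurable.aemeasurable (hobs hA)]
    exact h
  have hgy (y : ℝ) : Measurable fun q : Vec d × Vec d => (q.1, P.observe d q.1 q.2, y) :=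
    measurable_fst.prodMk (hobs.prodMk measurable_const)
  have hreg : ∀ᵐ w ∂P.regressionLaw d, w.2.1 ∈ A := by
    rw [Model.regressionLaw, ae_map_iff _ hAe]
    · exact Measure.quasiMeasurePreserving_fst.ae h1
    · exact (by fun_prop : Measurable fun q : (Vec d × Vec d) × ℝ => q.1.1).prodMk
        ((hobs.comp measurable_fst).prodMk
          (((continuous_score (P := P) (d := d)).measurable.comp
            (measurable_fst.comp measurable_fst)).add measurable_snd)) |>.aemeasurable
  cases ℓ
  · exact hreg
  · exact hreg
  · change ∀ᵐ w ∂P.classificationLaw d, w.2.1 ∈ A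
    rw [Model.classificationLaw, ae_add_measure_iff, ae_map_iff (hgy 1).aemeasurable hAe,
      ae_map_iff (hgy 0).aemeasurable hAe]
    exact ⟨(withDensity_absolutelyContinuous _ _).ae_le h1,
      (withDensity_absolutelyContinuous _ _).ae_le h1⟩

theorem coordLaw_abs_le_one (hP : P.SparseCoding) (d : ℕ) : ∀ᵐ x ∂P.coordLaw d, |x| ≤ 1 := by
  filter_upwards [hP.range d] with x hx
  rcases hx with rfl | h
  · simp
  · exact h.2

theorem integrable_norm_sq_pi_map {κ : Measure ℝ} [IsProbabilityMeasure κ]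
    (h : Integrable (fun x => x ^ 2) κ) :
    Integrable (fun x : Vec d => ‖x‖ ^ 2)
      ((Measure.pi fun _ : Fin d => κ).map (WithLp.toLp 2)) := by
  rw [integrable_map_measure (by fun_prop) (by fun_prop)]
  simp only [Function.comp_def, EuclideanSpace.real_norm_sq_eq]
  exact integrable_finsetSum _ fun i _ => 
    (measurePreserving_eval (fun _ : Fin d => κ) i).integrable_comp_of_integrable h

theorem norm_observe_le (hP : P.SparseCoding) (x ξ : Vec d) :
    ‖P.observe d x ξ‖ ≤ ‖x‖ + ‖ξ‖ := by
  refine (norm_add_le _ _).trans ?_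
  rw [norm_mulVec_of_orthogonal d (hP.unitary d)]

theorem score_sq_le (x : Vec d) : P.score d x ^ 2 ≤ ‖P.θ₀ d‖ ^ 2 * ‖x‖ ^ 2 := by
  rw [← mul_pow, ← sq_abs]
  have h : P.score d x = inner ℝ (P.θ₀ d) x := by
    simp [Model.score, PiLp.inner_apply, mul_comm]
  rw [h]
  gcongr
  exact abs_real_inner_le_norm _ _

theorem integrable_quadratic_dataLaw (hP : P.SparseCoding) (ℓ : LossKind) (d : ℕ) :
    Integrable (fun w : Vec d × Vec d × ℝ => 1 + ‖w.1‖ ^ 2 + ‖w.2.1‖ ^ 2 + w.2.2 ^ 2)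
      (P.dataLaw ℓ d) := by
  have := hP.prob d
  have := isProbabilityMeasure_featureLaw hP d
  have hobs := (continuous_observe (P := P) (d := d))
  have hsc := (continuous_score (P := P) (d := d))
  have hx : Integrable (fun x : Vec d => ‖x‖ ^ 2) (P.featureLaw d) := by
    refine integrable_norm_sq_pi_map ((integrable_const (1 : ℝ)).mono' (by fun_prop) ?_)
    filter_upwards [coordLaw_abs_le_one hP d] with x hx
    rw [Real.norm_eq_abs, abs_pow]
    exact pow_le_one₀ (abs_nonneg _) hx
  have hξ : Integrable (fun x : Vec d => ‖x‖ ^ 2) (P.noiseLaw d) :=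
    integrable_norm_sq_pi_map (integrable_sq_gaussianReal _)
  have hΛ : Integrable (fun q : Vec d × Vec d => (3 + 2 * ‖P.θ₀ d‖ ^ 2) * ‖q.1‖ ^ 2 +
      2 * ‖q.2‖ ^ 2) ((P.featureLaw d).prod (P.noiseLaw d)) :=
    ((hx.comp_fst _).const_mul _).add ((hξ.comp_snd _).const_mul 2)
  have hbound (x ξ : Vec d) (y r : ℝ) (hy : y ^ 2 ≤ 2 * (‖P.θ₀ d‖ ^ 2 * ‖x‖ ^ 2) + r) :
      ‖1 + ‖x‖ ^ 2 + ‖P.observe d x ξ‖ ^ 2 + y ^ 2‖ ≤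
        ((3 + 2 * ‖P.θ₀ d‖ ^ 2) * ‖x‖ ^ 2 + 2 * ‖ξ‖ ^ 2) + (1 + r) := by
    rw [Real.norm_eq_abs, abs_of_nonneg (by positivity)]
    have h1 : ‖P.observe d x ξ‖ ^ 2 ≤ 2 * ‖x‖ ^ 2 + 2 * ‖ξ‖ ^ 2 := by
      calc ‖P.observe d x ξ‖ ^ 2 ≤ (‖x‖ + ‖ξ‖) ^ 2 := by gcongr; exact norm_observe_le hP x ξ
        _ ≤ _ := by nlinarith [sq_nonneg (‖x‖ - ‖ξ‖)]
    nlinarith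
  have hmeas : Measurable fun w : Vec d × Vec d × ℝ => 1 + ‖w.1‖ ^ 2 + ‖w.2.1‖ ^ 2 + w.2.2 ^ 2 := by
    fun_prop
  have hg : Measurable fun q : (Vec d × Vec d) × ℝ =>
      (q.1.1, P.observe d q.1.1 q.1.2, P.score d q.1.1 + q.2) :=
    (by fun_prop : Measurable fun q : (Vec d × Vec d) × ℝ => q.1.1).prodMk
      ((hobs.measurable.comp measurable_fst).prodMk
        ((hsc.measurable.comp (measurable_fst.comp measurable_fst)).add measurable_snd))
  have hreg : Integrable (fun w : Vec d × Vec d × ℝ => 1 + ‖w.1‖ ^ 2 + ‖w.2.1‖ ^ 2 + w.2.2 ^ 2)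
      (P.regressionLaw d) := by
    rw [Model.regressionLaw, integrable_map_measure hmeas.aestronglyMeasurable hg.aemeasurable]
    have hη : Integrable (fun η : ℝ => 1 + 2 * η ^ 2) (gaussianReal 0 (P.s ^ 2).toNNReal) :=
      (integrable_const 1).add ((integrable_sq_gaussianReal _).const_mul 2)
    refine ((hΛ.comp_fst _).add (hη.comp_snd _)).mono' (hmeas.comp hg).aestronglyMeasurable
      (Eventually.of_forall fun q => ?_)
    refine hbound _ _ _ _ ?_
    have := score_sq_le (P := P) q.1.1
    nlinarith [sq_nonneg (P.score d q.1.1 - q.2)]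
  cases ℓ
  · exact hreg
  · exact hreg
  · change Integrable _ (P.classificationLaw d)
    rw [Model.classificationLaw]
    have hgy (y : ℝ) : Measurable fun q : Vec d × Vec d => (q.1, P.observe d q.1 q.2, y) :=
      measurable_fst.prodMk (hobs.measurable.prodMk measurable_const)
    have hpart (π : Vec d × Vec d → ℝ) (hπ : ∀ q, π q ≤ 1) (y : ℝ) :
        Integrable (fun w : Vec d × Vec d × ℝ => 1 + ‖w.1‖ ^ 2 + ‖w.2.1‖ ^ 2 + w.2.2 ^ 2)
          ((((P.featureLaw d).prod (P.noiseLaw d)).withDensity fun q => ENNReal.ofReal (π q)).map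
            fun q => (q.1, P.observe d q.1 q.2, y)) := by
      rw [integrable_map_measure hmeas.aestronglyMeasurable (hgy y).aemeasurable]
      have hle : ((P.featureLaw d).prod (P.noiseLaw d)).withDensity
          (fun q => ENNReal.ofReal (π q)) ≤ (P.featureLaw d).prod (P.noiseLaw d) := by
        conv_rhs => rw [← withDensity_one (μ := (P.featureLaw d).prod (P.noiseLaw d))]
        refine withDensity_mono (Eventually.of_forall fun q => ?_)
        simpa using hπ q
      refine Integrable.mono_measure ?_ hle
      refine (hΛ.add (integrable_const (1 + y ^ 2))).mono'
        (hmeas.comp (hgy y)).aestronglyMeasurable (Eventually.of_forall fun q => ?_)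
      refine hbound _ _ _ _ ?_
      have : 0 ≤ ‖P.θ₀ d‖ ^ 2 * ‖q.1‖ ^ 2 := by positivity
      linarith
    refine integrable_add_measure.2 ⟨hpart _ (fun q => ?_) 1, hpart _ (fun q => ?_) 0⟩
    · rw [div_le_one (by positivity)]
      linarith [Real.exp_pos (P.score d q.1)]
    · have : 0 ≤ 1 / (1 + Real.exp (P.score d q.1)) := by positivity
      linarith

end DataLaw

/-! ### Risks as integrals over the sample space -/

section Risk

variable {P : Model} {d : ℕ}

theorem transpose_mul_self_of_orthogonal (hP : P.SparseCoding) (d : ℕ) :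
    (P.M d).transpose * P.M d = 1 := by
  have := (Matrix.mem_orthogonalGroup_iff' (Fin d) ℝ).1 (hP.unitary d)
  simpa [Matrix.star_eq_conjTranspose] using this

theorem mul_transpose_self_of_orthogonal (hP : P.SparseCoding) (d : ℕ) :
    P.M d * (P.M d).transpose = 1 := by
  have := (Matrix.mem_orthogonalGroup_iff (Fin d) ℝ).1 (hP.unitary d)
  simpa [Matrix.star_eq_conjTranspose] using this

theorem inner_col (hP : P.SparseCoding) (N : Network d (P.H d)) (h h' : Fin (P.H d)) :
    inner ℝ (N.col h) (N.col h') = ∑ i, P.coef N i h * P.coef N i h' := by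
  have h1 : (P.coef N).transpose * P.coef N = N.weight.transpose * N.weight := by
    rw [Model.coef, Matrix.transpose_mul, Matrix.transpose_transpose, Matrix.mul_assoc,
      ← Matrix.mul_assoc (P.M d), mul_transpose_self_of_orthogonal hP, Matrix.one_mul]
  have h2 := congrFun (congrFun h1 h) h'
  simp only [Matrix.mul_apply, Matrix.transpose_apply] at h2
  rw [h2]
  simp [Network.col, PiLp.inner_apply, mul_comm]

/-- In feature coordinates the observed vector is the sum of features and noise. -/
theorem pre_inputVec (N : Network d (P.H d)) (h : Fin (P.H d))
    (ω : Fin d ⊕ Fin d → ℝ) :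
    N.pre (inputVec P d ω) h =
      ∑ i, P.coef N i h * ω (Sum.inl i) + ∑ i, P.coef N i h * ω (Sum.inr i) := by
  have h1 (x : Fin d → ℝ) : ∑ i, (P.M d).mulVec x i * N.weight i h = ∑ i, P.coef N i h * x i := by
    have : ∑ i, (P.M d).mulVec x i * N.weight i h =
        (P.M d).mulVec x ⬝ᵥ fun i => N.weight i h := rfl
    rw [this, dotProduct_comm, Matrix.dotProduct_mulVec, ← Matrix.mulVec_transpose]
    rfl
  rw [← h1, ← h1, ← Finset.sum_add_distrib, Network.pre]
  refine Finset.sum_congr rfl fun i _ => ?_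
  simp [inputVec, Model.observe, featureVec, noiseVec, add_mul]

theorem noiseVar_pos (hP : P.SparseCoding) (hd : 0 < d) :
    0 < (P.ζ ^ 2 / (d : ℝ)).toNNReal := by
  have := hP.input_noise
  rw [Real.toNNReal_pos]
  positivity

theorem nodeCount_pos_iff (N : Network d (P.H d)) (h : Fin (P.H d)) :
    1 ≤ P.nodeCount N h ↔ 0 < ∑ i, P.coef N i h ^ 2 := by
  rw [Nat.one_le_iff_ne_zero, ← Nat.pos_iff_ne_zero, Model.nodeCount, Finset.card_pos,
    Model.nodeSupport]
  constructor
  · rintro ⟨i, hi⟩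
    have hi' : P.coef N i h ≠ 0 := by simpa using hi
    exact Finset.sum_pos' (fun _ _ => sq_nonneg _) ⟨i, Finset.mem_univ i, by positivity⟩
  · intro hpos
    obtain ⟨i, _, hi⟩ := Finset.exists_ne_zero_of_sum_ne_zero hpos.ne'
    exact ⟨i, by simpa using hi⟩

/-- Almost surely no pre-activation equals a threshold in modulus: each pre-activation contains an
independent nondegenerate Gaussian term, so its law has no atoms. -/
theorem ae_regular (hP : P.SparseCoding) (hd : 0 < d) {N : Network d (P.H d)}
    (hN : ∀ h, 1 ≤ P.nodeCount N h) : ∀ᵐ ω ∂baseLaw P d, N.Regular (inputVec P d ω) := by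
  have := hP.prob d
  rw [show (∀ᵐ ω ∂baseLaw P d, N.Regular (inputVec P d ω)) ↔
    ∀ᵐ ω ∂baseLaw P d, ∀ h, |N.pre (inputVec P d ω) h| ≠ N.intercept h from Iff.rfl, ae_all_iff]
  intro h
  have hmS : Measurable fun ω : Fin d ⊕ Fin d → ℝ => ∑ i, P.coef N i h * ω (Sum.inl i) := by
    fun_prop
  have hmN : Measurable fun ω : Fin d ⊕ Fin d → ℝ => ∑ i, P.coef N i h * ω (Sum.inr i) := by
    fun_prop
  have hind : IndepFun (fun ω : Fin d ⊕ Fin d → ℝ => ∑ i, P.coef N i h * ω (Sum.inl i))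
      (fun ω => ∑ i, P.coef N i h * ω (Sum.inr i)) (baseLaw P d) := by
    refine indepFun_of_dependsOn hmS hmN (s := Set.range Sum.inl) (t := Set.range Sum.inr) ?_ ?_
      Set.isCompl_range_inl_range_inr.disjoint
    · intro x y hxy
      exact Finset.sum_congr rfl fun i _ => by rw [hxy _ ⟨i, rfl⟩]
    · intro x y hxy
      exact Finset.sum_congr rfl fun i _ => by rw [hxy _ ⟨i, rfl⟩]
  have : IsProbabilityMeasure (baseLaw P d) := by unfold baseLaw; infer_instance
  have hmap := (indepFun_iff_map_prod_eq_prod_map_map hmS.aemeasurable hmN.aemeasurable).1 hind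
  have hset : MeasurableSet {q : ℝ × ℝ | |q.1 + q.2| = N.intercept h} :=
    measurableSet_eq_fun (by fun_prop) measurable_const
  have hv : (P.ζ ^ 2 / (d : ℝ)).toNNReal * (∑ i, P.coef N i h ^ 2).toNNReal ≠ 0 :=
    mul_ne_zero (noiseVar_pos hP hd).ne'
      (by simpa using (nodeCount_pos_iff N h).1 (hN h))
  have hlaw : (baseLaw P d).map (fun ω => ∑ i, P.coef N i h * ω (Sum.inr i)) =
    gaussianReal 0 ((P.ζ ^ 2 / (d : ℝ)).toNNReal * (∑ i, P.coef N i h ^ 2).toNNReal) :=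
    map_noise_linear _
  have hna := nullSingletonClass_gaussianReal (μ := 0) hv
  have hnull : (baseLaw P d).map (fun ω => (∑ i, P.coef N i h * ω (Sum.inl i),
      ∑ i, P.coef N i h * ω (Sum.inr i))) {q : ℝ × ℝ | |q.1 + q.2| = N.intercept h} = 0 := by
    rw [hmap, hlaw, Measure.measure_prod_null hset]
    refine Eventually.of_forall fun x => ?_
    refine measure_mono_null (t := {N.intercept h - x, -N.intercept h - x}) ?_
      (Set.Finite.measure_zero (by simp) _)
    intro y hy
    rcases eq_or_eq_neg_of_abs_eq (show |x + y| = N.intercept h from hy) with h' | h'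
    · left; linarith
    · right; simp only [Set.mem_singleton_iff]; linarith
  rw [Measure.map_apply (hmS.prodMk hmN) hset] at hnull
  rw [ae_iff]
  convert hnull using 2
  ext ω
  simp [pre_inputVec]

/-- The attacked loss is almost surely the loss after a step along the gradient, and it is bounded
by a quadratic function of input and response. -/
theorem integrable_advLoss (hP : P.SparseCoding) (hd : 0 < d) {N : Network d (P.H d)}
    (hN : ∀ h, 1 ≤ P.nodeCount N h) (ℓ : LossKind) (e : ℝ) :
    Integrable (fun w => stepLoss ℓ e N w.2.1 w.2.2) (P.dataLaw ℓ d) ∧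
    (fun w => advLoss ℓ e N w.2.1 w.2.2) =ᵐ[P.dataLaw ℓ d]
      fun w => stepLoss ℓ e N w.2.1 w.2.2 := by
  constructor
  · obtain ⟨K, hK⟩ := abs_stepLoss_le ℓ e N
    refine ((integrable_quadratic_dataLaw hP ℓ d).const_mul |K|).mono'
      ((measurable_stepLoss ℓ e N).comp measurable_snd).aestronglyMeasurable
      (Eventually.of_forall fun w => ?_)
    refine (hK _ _).trans ?_
    have h1 : K * (1 + ‖w.2.1‖ ^ 2 + w.2.2 ^ 2) ≤ |K| * (1 + ‖w.2.1‖ ^ 2 + w.2.2 ^ 2) := by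
      gcongr; exact le_abs_self K
    refine h1.trans ?_
    gcongr
    linarith [sq_nonneg ‖w.1‖]
  · filter_upwards [ae_dataLaw hP ℓ (measurableSet_regular N) (ae_regular hP hd hN)] with w hw
    exact advLoss_eq_stepLoss ℓ e N hw _

/-- The risk as an integral over features and noise of the mean over the response. -/
theorem risk_eq (hP : P.SparseCoding) (hd : 0 < d) {N : Network d (P.H d)}
    (hN : ∀ h, 1 ≤ P.nodeCount N h) (ℓ : LossKind) (e : ℝ) :
    Integrable (fun ω => respAvg ℓ P.s (P.score d (featureVec ω))
      (stepLoss ℓ e N (inputVec P d ω))) (baseLaw P d) ∧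
    P.risk ℓ e N = ∫ ω, respAvg ℓ P.s (P.score d (featureVec ω))
      (stepLoss ℓ e N (inputVec P d ω)) ∂baseLaw P d := by
  obtain ⟨h1, h2⟩ := integrable_advLoss hP hd hN ℓ e
  obtain ⟨h3, h4⟩ := integral_dataLaw hP ℓ h1
  exact ⟨h3, (integral_congr_ae h2).trans h4⟩

theorem integrable_oracle (hP : P.SparseCoding) (ℓ : LossKind) (d : ℕ) :
    Integrable (fun w => ℓ.loss (P.score d w.1) w.2.2) (P.dataLaw ℓ d) := by
  have hm : Measurable fun w : Vec d × Vec d × ℝ => ℓ.loss (P.score d w.1) w.2.2 :=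
    (measurable_loss ℓ).comp ((continuous_score.measurable.comp measurable_fst).prodMk
      (measurable_snd.comp measurable_snd))
  refine ((integrable_quadratic_dataLaw hP ℓ d).const_mul (4 * (1 + ‖P.θ₀ d‖ ^ 2))).mono'
    hm.aestronglyMeasurable (Eventually.of_forall fun w => ?_)
  rw [Real.norm_eq_abs, abs_of_nonneg (loss_nonneg _ _ _)]
  refine (loss_le _ _ _).trans ?_
  have h1 := score_sq_le (P := P) w.1
  have h2 : 0 ≤ ‖P.θ₀ d‖ ^ 2 := sq_nonneg _
  nlinarith [sq_nonneg w.2.2, sq_nonneg ‖w.1‖, sq_nonneg ‖w.2.1‖, mul_nonneg h2 (sq_nonneg w.2.2),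
    mul_nonneg h2 (sq_nonneg ‖w.2.1‖)]

/-- The risk of the true score in the same form. -/
theorem oracleRisk_eq (hP : P.SparseCoding) (ℓ : LossKind) (d : ℕ) :
    Integrable (fun ω => respAvg ℓ P.s (P.score d (featureVec ω))
      (ℓ.loss (P.score d (featureVec ω)))) (baseLaw P d) ∧
    P.oracleRisk ℓ d = ∫ ω, respAvg ℓ P.s (P.score d (featureVec ω))
      (ℓ.loss (P.score d (featureVec ω))) ∂baseLaw P d :=
  integral_dataLaw hP ℓ (integrable_oracle hP ℓ d)

/-- A network whose coefficients of each feature have constant sign cannot beat the true score, not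
even under attack: the attack moves every pre-activation against the response, and the clean
prediction is no better than the Bayes prediction. -/
theorem oracleRisk_le_risk (hP : P.SparseCoding) (hd : 0 < d) {N : Network d (P.H d)}
    (hN : ∀ h, 1 ≤ P.nodeCount N h)
    (hsign : ∀ i h h', 0 ≤ P.coef N i h * P.coef N i h') (ℓ : LossKind) {e : ℝ} (he : 0 ≤ e) :
    P.oracleRisk ℓ d ≤ P.risk ℓ e N := by
  obtain ⟨i0, e0⟩ := integrable_advLoss hP hd hN ℓ 0
  obtain ⟨i1, e1⟩ := integrable_advLoss hP hd hN ℓ e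
  have h1 : P.risk ℓ 0 N ≤ P.risk ℓ e N := by
    rw [Model.risk, Model.risk, integral_congr_ae e0, integral_congr_ae e1]
    refine integral_mono i0 i1 fun w => stepLoss_zero_le ℓ he N (fun h h' => ?_) _ _
    rw [inner_col hP]
    exact Finset.sum_nonneg fun i _ => hsign i h h'
  refine le_trans ?_ h1
  obtain ⟨j0, f0⟩ := risk_eq hP hd hN ℓ 0
  obtain ⟨j1, f1⟩ := oracleRisk_eq hP ℓ d
  rw [f0, f1]
  refine integral_mono j1 j0 fun ω => ?_
  have : stepLoss ℓ 0 N (inputVec P d ω) = ℓ.loss (N.predict (inputVec P d ω)) := by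
    funext y; exact stepLoss_zero ℓ N _ y
  simp only [this]
  exact respAvg_loss_score_le ℓ _ _ _

end Risk

/-! ### Networks of groups of features -/

section StepError

theorem abs_gate_sub_le {v e : ℝ} (he : 0 ≤ e) : |gate v e - v| ≤ e := by
  unfold gate
  split_ifs with h
  · simpa using he
  · push Not at h
    simpa using h.le

theorem gate_mul {c : ℝ} (hc : 0 < c) (v e : ℝ) : gate (c * v) (c * e) = c * gate v e := by
  unfold gate
  rw [abs_mul, abs_of_pos hc]
  by_cases h : e ≤ |v|
  · rw [if_pos h, if_pos (by gcongr)]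
  · rw [if_neg h, if_neg (by rwa [mul_le_mul_iff_right₀ hc]), mul_zero]

theorem sum_sq_le_sum_sq {κ : Type*} (s : Finset κ) {T : κ → ℝ} (hT : ∀ g, 0 ≤ T g) :
    ∑ g ∈ s, T g ^ 2 ≤ (∑ g ∈ s, T g) ^ 2 := by
  classical
  rw [sq, Finset.sum_mul]
  refine Finset.sum_le_sum fun g hg => ?_
  rw [sq]
  exact mul_le_mul_of_nonneg_left (Finset.single_le_sum (fun g _ => hT g) hg) (hT g)

/-- Enlarging the index set by `u` increases a Euclidean norm at most by the `ℓ¹` norm on `u`. -/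
theorem sqrt_sum_sq_le {κ : Type*} {s t u : Finset κ} (hst : ∀ g ∈ s, g ∈ t ∨ g ∈ u)
    {T : κ → ℝ} (hT : ∀ g, 0 ≤ T g) :
    √(∑ g ∈ s, T g ^ 2) ≤ √(∑ g ∈ t, T g ^ 2) + ∑ g ∈ u, T g := by
  classical
  have hu : 0 ≤ ∑ g ∈ u, T g := Finset.sum_nonneg fun g _ => hT g
  have ht : 0 ≤ ∑ g ∈ t, T g ^ 2 := Finset.sum_nonneg fun g _ => sq_nonneg _
  rw [Real.sqrt_le_left (by positivity), add_sq, Real.sq_sqrt ht]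
  have h1 : ∑ g ∈ s, T g ^ 2 ≤ ∑ g ∈ t ∪ u, T g ^ 2 :=
    Finset.sum_le_sum_of_subset_of_nonneg (fun g hg => by simpa using hst g hg)
      fun g _ _ => sq_nonneg _
  have h2 : ∑ g ∈ t ∪ u, T g ^ 2 ≤ ∑ g ∈ t, T g ^ 2 + ∑ g ∈ u, T g ^ 2 := by
    rw [← Finset.sum_union_inter]
    exact le_add_of_nonneg_right (Finset.sum_nonneg fun g _ => sq_nonneg _)
  have h3 := sum_sq_le_sum_sq u hT
  have h4 : 0 ≤ 2 * √(∑ g ∈ t, T g ^ 2) * ∑ g ∈ u, T g := by positivity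
  linarith

variable {κ : Type*} [Fintype κ]

open scoped Classical in
/-- The change of a sum of gated units along its normalized gradient.  The units in `act` are meant
to be open and the others closed, with a margin; this may fail for the units in `bad`, each of
which contributes an error of the order of its threshold. -/
theorem abs_step_sub_le {v T β : κ → ℝ} {act bad : κ → Prop} {ε t : ℝ}
    (hT : ∀ g, 0 ≤ T g) (hβ : ∀ g, 0 ≤ β g) (hε : ∀ g, ε * T g ≤ β g) (ht : |t| ≤ ε)
    (hopen : ∀ g, ¬ bad g → act g → 2 * β g ≤ |v g|)
    (hclosed : ∀ g, ¬ bad g → ¬ act g → |v g| < β g) :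
    |∑ g, gate (v g + t * (if β g ≤ |v g| then
          T g ^ 2 / √(∑ g with β g ≤ |v g|, T g ^ 2) else 0)) (β g)
        - ∑ g, gate (v g) (β g) - t * √(∑ g with act g, T g ^ 2)| ≤
      2 * ∑ g with bad g, β g := by
  set nrm := √(∑ g with β g ≤ |v g|, T g ^ 2) with hnrm
  have hε0 : 0 ≤ ε := (abs_nonneg t).trans ht
  have hTn : ∀ g, β g ≤ |v g| → T g ^ 2 / nrm ≤ T g := by
    intro g hg
    have h1 : T g ≤ nrm := Real.le_sqrt_of_sq_le
      (Finset.single_le_sum (f := fun g => T g ^ 2) (fun g _ => sq_nonneg _) (by simpa using hg))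
    rcases (hT g).eq_or_lt with h0 | h0
    · rw [← h0]; simp
    · rw [div_le_iff₀ (h0.trans_le h1), sq]
      exact mul_le_mul_of_nonneg_left h1 (hT g)
  have hshift : ∀ g, β g ≤ |v g| → |t * (T g ^ 2 / nrm)| ≤ β g := by
    intro g hg
    rw [abs_mul, abs_of_nonneg (show 0 ≤ T g ^ 2 / nrm by positivity)]
    exact (mul_le_mul ht (hTn g hg) (by positivity) hε0).trans (hε g)
  have hsum : ∑ g, (if β g ≤ |v g| then t * (T g ^ 2 / nrm) else 0) = t * nrm := by
    rw [← Finset.sum_filter, ← Finset.mul_sum, ← Finset.sum_div]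
    congr 1
    rw [hnrm, Real.div_sqrt]
  have hunit : ∀ g, |gate (v g + t * (if β g ≤ |v g| then T g ^ 2 / nrm else 0)) (β g)
      - gate (v g) (β g) - (if β g ≤ |v g| then t * (T g ^ 2 / nrm) else 0)| ≤
      if bad g then β g else 0 := by
    intro g
    by_cases hg : β g ≤ |v g|
    · rw [if_pos hg, if_pos hg, show gate (v g) (β g) = v g from if_pos hg]
      by_cases hb : bad g
      · rw [if_pos hb, sub_sub]
        exact abs_gate_sub_le (hβ g)
      · rw [if_neg hb]
        have ha : act g := by
          by_contra ha
          exact absurd (hclosed g hb ha) (not_lt.2 hg)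
        have h1 := hopen g hb ha
        have h2 := hshift g hg
        have h3 : β g ≤ |v g + t * (T g ^ 2 / nrm)| := by
          have := abs_sub_abs_le_abs_sub (v g) (-(t * (T g ^ 2 / nrm)))
          rw [abs_neg, sub_neg_eq_add] at this
          linarith
        rw [show gate (v g + t * (T g ^ 2 / nrm)) (β g) = _ from if_pos h3]
        simp
    · rw [if_neg hg, if_neg hg]
      simp only [mul_zero, add_zero, sub_self, abs_zero]
      split_ifs
      · exact hβ g
      · exact le_rfl
  -- The two sources of error: units which open or close, and the norm of the gradient.
  have h1 : |∑ g, gate (v g + t * (if β g ≤ |v g| then T g ^ 2 / nrm else 0)) (β g)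
      - ∑ g, gate (v g) (β g) - t * nrm| ≤ ∑ g with bad g, β g := by
    rw [← hsum, ← Finset.sum_sub_distrib, ← Finset.sum_sub_distrib, Finset.sum_filter]
    exact (Finset.abs_sum_le_sum_abs _ _).trans (Finset.sum_le_sum fun g _ => hunit g)
  have h2 : |nrm - √(∑ g with act g, T g ^ 2)| ≤ ∑ g with bad g, T g := by
    rw [abs_sub_le_iff]
    constructor
    · rw [sub_le_iff_le_add, add_comm]
      refine sqrt_sum_sq_le (fun g hg => ?_) hT
      simp only [Finset.mem_filter, Finset.mem_univ, true_and] at hg ⊢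
      by_contra! hcon
      exact absurd (hclosed g hcon.2 hcon.1) (not_lt.2 hg)
    · rw [sub_le_iff_le_add, add_comm]
      refine sqrt_sum_sq_le (fun g hg => ?_) hT
      simp only [Finset.mem_filter, Finset.mem_univ, true_and] at hg ⊢
      by_contra! hcon
      linarith [hopen g hcon.2 hg, hβ g]
  have h3 : |t * nrm - t * √(∑ g with act g, T g ^ 2)| ≤ ∑ g with bad g, β g := by
    rw [← mul_sub, abs_mul]
    calc |t| * |nrm - √(∑ g with act g, T g ^ 2)| ≤ ε * ∑ g with bad g, T g := by gcongr
      _ ≤ ∑ g with bad g, β g := by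
        rw [Finset.mul_sum]
        exact Finset.sum_le_sum fun g _ => hε g
  have h4 := abs_add_le (∑ g, gate (v g + t * (if β g ≤ |v g| then T g ^ 2 / nrm else 0)) (β g)
      - ∑ g, gate (v g) (β g) - t * nrm) (t * nrm - t * √(∑ g with act g, T g ^ 2))
  rw [sub_add_sub_cancel] at h4
  linarith

end StepError

section GroupNetwork

variable {d Γ H : ℕ}

/-- The features of the group `g`. -/
def fibre (φ : Fin d → Fin Γ) (g : Fin Γ) : Finset (Fin d) := Finset.univ.filter fun i => φ i = g

/-- The number of the nodes `h < H` which carry the group `g`, when nodes are assigned to groups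
periodically. -/
def nodesOf (H Γ : ℕ) (g : ℕ) : ℕ := (Finset.univ.filter fun h : Fin H => (h : ℕ) % Γ = g).card

/-- The coefficients of a grouping `φ` of the features: the nodes `h ≡ g` modulo `Γ` carry the
features of the group `g`, and the coefficient `θ i` is shared equally among the nodes of the group
of `i`. -/
noncomputable def groupCoef (H : ℕ) (θ : Vec d) (φ : Fin d → Fin Γ) : Matrix (Fin d) (Fin H) ℝ :=
  fun i h => if (h : ℕ) % Γ = φ i then θ i / nodesOf H Γ (φ i) else 0

/-- The network of a grouping of the features.  The intercepts are the geometric mean of the two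
bounds in the definition of the class. -/
noncomputable def groupNetwork (P : Model) (φ : Fin d → Fin Γ) : Network d (P.H d) where
  weight := P.M d * groupCoef (P.H d) (P.θ₀ d) φ
  intercept h := P.nodeScale ⟨P.M d * groupCoef (P.H d) (P.θ₀ d) φ, 0⟩ h / √(Real.log d)

/-- The norm of the coefficients of the group `g`. -/
noncomputable def groupNorm (P : Model) (φ : Fin d → Fin Γ) (g : Fin Γ) : ℝ :=
  √(∑ i ∈ fibre φ g, P.θ₀ d i ^ 2)

/-- The activation threshold of the group `g`. -/
noncomputable def groupThr (P : Model) (φ : Fin d → Fin Γ) (g : Fin Γ) : ℝ :=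
  groupNorm P φ g / √(P.k d * (fibre φ g).card) / √(Real.log d)

/-- The contribution of the features of the group `g` to the score. -/
def featSum (P : Model) (φ : Fin d → Fin Γ) (g : Fin Γ) (ω : Fin d ⊕ Fin d → ℝ) : ℝ :=
  ∑ i ∈ fibre φ g, P.θ₀ d i * ω (Sum.inl i)

/-- The input noise seen by the group `g`. -/
def noiseSum (P : Model) (φ : Fin d → Fin Γ) (g : Fin Γ) (ω : Fin d ⊕ Fin d → ℝ) : ℝ :=
  ∑ i ∈ fibre φ g, P.θ₀ d i * ω (Sum.inr i)

/-- Some feature of the group `g` is active. -/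
def GroupActive (φ : Fin d → Fin Γ) (g : Fin Γ) (ω : Fin d ⊕ Fin d → ℝ) : Prop :=
  ∃ i ∈ fibre φ g, ω (Sum.inl i) ≠ 0

/-- Two features of the group `g` are active, or its noise exceeds the threshold. -/
def GroupBad (P : Model) (φ : Fin d → Fin Γ) (g : Fin Γ) (ω : Fin d ⊕ Fin d → ℝ) : Prop :=
  (∃ i ∈ fibre φ g, ∃ j ∈ fibre φ g, i ≠ j ∧ ω (Sum.inl i) ≠ 0 ∧ ω (Sum.inl j) ≠ 0) ∨
    groupThr P φ g ≤ |noiseSum P φ g ω|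

open scoped Classical in
/-- The norm of the gradient of the prediction when precisely the groups with an active feature are
open. -/
noncomputable def idealGrad (P : Model) (φ : Fin d → Fin Γ) (ω : Fin d ⊕ Fin d → ℝ) : ℝ :=
  √(∑ g with GroupActive φ g ω, groupNorm P φ g ^ 2)

/-- The total threshold of the bad groups. -/
noncomputable def badThr (P : Model) (φ : Fin d → Fin Γ) (ω : Fin d ⊕ Fin d → ℝ) : ℝ :=
  open scoped Classical in ∑ g with GroupBad P φ g ω, groupThr P φ g

variable {P : Model}

theorem mem_fibre {φ : Fin d → Fin Γ} {g : Fin Γ} {i : Fin d} : i ∈ fibre φ g ↔ φ i = g := by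
  simp [fibre]

theorem sum_fibre {M : Type*} [AddCommMonoid M] (φ : Fin d → Fin Γ) (f : Fin d → M) :
    ∑ g, ∑ i ∈ fibre φ g, f i = ∑ i, f i :=
  Finset.sum_fiberwise _ _ _

theorem groupNorm_nonneg (φ : Fin d → Fin Γ) (g : Fin Γ) : 0 ≤ groupNorm P φ g :=
  Real.sqrt_nonneg _

theorem groupNorm_sq (φ : Fin d → Fin Γ) (g : Fin Γ) :
    groupNorm P φ g ^ 2 = ∑ i ∈ fibre φ g, P.θ₀ d i ^ 2 :=
  Real.sq_sqrt (Finset.sum_nonneg fun _ _ => sq_nonneg _)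

theorem groupThr_nonneg (φ : Fin d → Fin Γ) (g : Fin Γ) : 0 ≤ groupThr P φ g :=
  div_nonneg (div_nonneg (groupNorm_nonneg φ g) (Real.sqrt_nonneg _)) (Real.sqrt_nonneg _)

theorem badThr_nonneg (φ : Fin d → Fin Γ) (ω : Fin d ⊕ Fin d → ℝ) : 0 ≤ badThr P φ ω :=
  Finset.sum_nonneg fun g _ => groupThr_nonneg φ g

theorem nodesOf_pos (hH : Γ ≤ H) (g : Fin Γ) : 0 < nodesOf H Γ g :=
  Finset.card_pos.2 ⟨⟨g, g.2.trans_le hH⟩, by simp [Nat.mod_eq_of_lt g.2]⟩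

theorem nodesOf_eq (hΓ : 0 < Γ) (g : ℕ) (hg : g < Γ) :
    nodesOf H Γ g = H / Γ + if g < H % Γ then 1 else 0 := by
  have h1 := Nat.count_modEq_card H hΓ g
  rw [Nat.mod_eq_of_lt hg] at h1
  rw [← h1, Nat.count_eq_card_filter_range, nodesOf]
  refine Finset.card_bij (fun h _ => (h : ℕ)) ?_ ?_ ?_
  · intro h hh
    simp only [Finset.mem_filter, Finset.mem_univ, true_and] at hh
    simp [Nat.ModEq, hh, Nat.mod_eq_of_lt hg]
  · intro a _ b _ hab
    exact Fin.ext hab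
  · intro b hb
    simp only [Finset.mem_filter, Finset.mem_range, Nat.ModEq, Nat.mod_eq_of_lt hg] at hb
    exact ⟨⟨b, hb.1⟩, by simpa using hb.2, rfl⟩

/-- Every group is carried by `H / Γ` nodes up to a factor `2`. -/
theorem nodesOf_bounds (hΓ : 0 < Γ) (hH : Γ ≤ H) (g : Fin Γ) :
    (H : ℝ) / Γ / 2 ≤ nodesOf H Γ g ∧ (nodesOf H Γ g : ℝ) ≤ 2 * (H / Γ) := by
  have hΓ' : (0 : ℝ) < Γ := by exact_mod_cast hΓ
  have h0 : 1 ≤ H / Γ := (Nat.one_le_div_iff hΓ).2 hH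
  have h1 : H / Γ * Γ ≤ H := Nat.div_mul_le_self H Γ
  have h2 : H < (H / Γ + 1) * Γ := by
    have := Nat.lt_div_mul_add (a := H) hΓ
    linarith [add_mul (H / Γ) 1 Γ]
  have e := nodesOf_eq (H := H) hΓ g g.2
  have h3 : H / Γ ≤ nodesOf H Γ g := by rw [e]; exact Nat.le_add_right _ _
  have h4 : nodesOf H Γ g ≤ H / Γ + 1 := by rw [e]; split_ifs <;> omega
  have h0' : (1 : ℝ) ≤ (H / Γ : ℕ) := by exact_mod_cast h0
  have h1' : ((H / Γ : ℕ) : ℝ) * Γ ≤ H := by exact_mod_cast h1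
  have h2' : (H : ℝ) < ((H / Γ : ℕ) + 1) * Γ := by exact_mod_cast h2
  have h3' : ((H / Γ : ℕ) : ℝ) ≤ nodesOf H Γ g := by exact_mod_cast h3
  have h4' : (nodesOf H Γ g : ℝ) ≤ (H / Γ : ℕ) + 1 := by exact_mod_cast h4
  constructor
  · rw [div_div, div_le_iff₀ (by positivity)]
    nlinarith
  · have : ((H / Γ : ℕ) : ℝ) ≤ H / Γ := (le_div_iff₀ hΓ').2 h1'
    linarith

theorem coef_groupNetwork (hP : P.SparseCoding) (φ : Fin d → Fin Γ) :
    P.coef (groupNetwork P φ) = groupCoef (P.H d) (P.θ₀ d) φ := by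
  rw [Model.coef, groupNetwork, ← Matrix.mul_assoc, transpose_mul_self_of_orthogonal hP,
    Matrix.one_mul]

theorem sum_coef_groupNetwork (hP : P.SparseCoding) (φ : Fin d → Fin Γ) (h : Fin (P.H d))
    (g : Fin Γ) (hg : (h : ℕ) % Γ = g) (f : Fin d → ℝ → ℝ) (hf : ∀ i, f i 0 = 0) :
    ∑ i, f i (P.coef (groupNetwork P φ) i h) =
      ∑ i ∈ fibre φ g, f i (P.θ₀ d i / nodesOf (P.H d) Γ g) := by
  rw [coef_groupNetwork hP, fibre, Finset.sum_filter]
  refine Finset.sum_congr rfl fun i _ => ?_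
  simp only [groupCoef, hg]
  by_cases h' : φ i = g
  · rw [if_pos (by rw [h']), if_pos h', h']
  · rw [if_neg (fun h'' => h' (Fin.ext h''.symm)), if_neg h', hf]

theorem nodeSupport_groupNetwork (hP : P.SparseCoding) (hθ : ∀ i, P.θ₀ d i ≠ 0)
    (hH : Γ ≤ P.H d) (φ : Fin d → Fin Γ) (h : Fin (P.H d)) (g : Fin Γ) (hg : (h : ℕ) % Γ = g) :
    P.nodeSupport (groupNetwork P φ) h = fibre φ g := by
  ext i
  rw [mem_fibre, Model.nodeSupport, coef_groupNetwork hP]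
  simp only [Finset.mem_filter, Finset.mem_univ, true_and, groupCoef, hg]
  constructor
  · intro h'
    by_contra hne
    exact h' (if_neg fun h'' => hne (Fin.ext h''.symm))
  · intro h'
    rw [if_pos (by rw [h'])]
    have := nodesOf_pos hH (φ i)
    exact div_ne_zero (hθ i) (by positivity)

theorem nodeNorm_groupNetwork (hP : P.SparseCoding) (φ : Fin d → Fin Γ) (h : Fin (P.H d))
    (g : Fin Γ) (hg : (h : ℕ) % Γ = g) :
    P.nodeNorm (groupNetwork P φ) h = groupNorm P φ g / nodesOf (P.H d) Γ g := by
  rw [Model.nodeNorm, sum_coef_groupNetwork hP φ h g hg (fun _ x => x ^ 2) (by simp), groupNorm]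
  simp only [div_pow]
  rw [← Finset.sum_div, Real.sqrt_div' _ (by positivity), Real.sqrt_sq (by positivity)]

theorem intercept_groupNetwork (hP : P.SparseCoding) (hθ : ∀ i, P.θ₀ d i ≠ 0)
    (hH : Γ ≤ P.H d) (φ : Fin d → Fin Γ) (h : Fin (P.H d)) (g : Fin Γ) (hg : (h : ℕ) % Γ = g) :
    (groupNetwork P φ).intercept h = (nodesOf (P.H d) Γ g : ℝ)⁻¹ * groupThr P φ g := by
  change P.nodeScale (groupNetwork P φ) h / √(Real.log d) = _
  rw [Model.nodeScale, nodeNorm_groupNetwork hP φ h g hg, Model.nodeCount,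
    nodeSupport_groupNetwork hP hθ hH φ h g hg, groupThr]
  ring

/-- A sum over the nodes of quantities which depend only on the group of the node. -/
theorem sum_nodes (hΓ : 0 < Γ) (F : Fin H → ℝ) (K : Fin Γ → ℝ)
    (hF : ∀ (h : Fin H) (g : Fin Γ), (h : ℕ) % Γ = g → F h = K g) :
    ∑ h, F h = ∑ g : Fin Γ, nodesOf H Γ g * K g := by
  have := Finset.sum_fiberwise (Finset.univ : Finset (Fin H))
    (fun h => (⟨(h : ℕ) % Γ, Nat.mod_lt _ hΓ⟩ : Fin Γ)) F
  rw [← this]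
  refine Finset.sum_congr rfl fun g _ => ?_
  rw [nodesOf, ← nsmul_eq_mul, ← Finset.sum_const]
  have hset : (Finset.univ.filter fun h : Fin H =>
      (⟨(h : ℕ) % Γ, Nat.mod_lt _ hΓ⟩ : Fin Γ) = g) =
      Finset.univ.filter fun h : Fin H => (h : ℕ) % Γ = g := by
    ext h; simp [Fin.ext_iff]
  rw [hset]
  refine Finset.sum_congr rfl fun h hh => hF h g ?_
  simpa using hh

/-- The coefficients of a feature add up to its coefficient in the true score. -/
theorem matches_groupNetwork (hP : P.SparseCoding) (hH : Γ ≤ P.H d) (φ : Fin d → Fin Γ) :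
    P.Matches (groupNetwork P φ) := by
  intro i
  rw [coef_groupNetwork hP]
  have hpos := nodesOf_pos hH (φ i)
  simp only [groupCoef]
  rw [← Finset.sum_filter, Finset.sum_const, nsmul_eq_mul, ← nodesOf]
  field_simp

theorem pre_groupNetwork (hP : P.SparseCoding) (φ : Fin d → Fin Γ) (h : Fin (P.H d))
    (g : Fin Γ) (hg : (h : ℕ) % Γ = g) (ω : Fin d ⊕ Fin d → ℝ) :
    (groupNetwork P φ).pre (inputVec P d ω) h =
      (nodesOf (P.H d) Γ g : ℝ)⁻¹ * (featSum P φ g ω + noiseSum P φ g ω) := by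
  rw [pre_inputVec, sum_coef_groupNetwork hP φ h g hg (fun i x => x * ω (Sum.inl i)) (by simp),
    sum_coef_groupNetwork hP φ h g hg (fun i x => x * ω (Sum.inr i)) (by simp), featSum, noiseSum,
    mul_add, Finset.mul_sum, Finset.mul_sum]
  congr 1 <;> exact Finset.sum_congr rfl fun i _ => by ring

theorem inner_col_groupNetwork (hP : P.SparseCoding) (φ : Fin d → Fin Γ) (h h' : Fin (P.H d))
    (g g' : Fin Γ) (hg : (h : ℕ) % Γ = g) (hg' : (h' : ℕ) % Γ = g') :
    inner ℝ ((groupNetwork P φ).col h) ((groupNetwork P φ).col h') =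
      if g = g' then (groupNorm P φ g / nodesOf (P.H d) Γ g) ^ 2 else 0 := by
  rw [inner_col hP, sum_coef_groupNetwork hP φ h g hg
    (fun i x => x * P.coef (groupNetwork P φ) i h') (by simp)]
  split_ifs with hgg
  · subst hgg
    rw [div_pow, groupNorm_sq, Finset.sum_div]
    refine Finset.sum_congr rfl fun i hi => ?_
    rw [mem_fibre] at hi
    rw [coef_groupNetwork hP, groupCoef, if_pos (by rw [hg', hi]), hi]
    ring
  · refine Finset.sum_eq_zero fun i hi => ?_
    rw [mem_fibre] at hi
    rw [coef_groupNetwork hP, groupCoef, if_neg, mul_zero]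
    rw [hg', hi]
    exact fun h'' => hgg (Fin.ext h''.symm)

/-- The prediction of a group network after a step along its normalized gradient: open groups move
in proportion to their squared norm, closed groups do not move. -/
theorem predict_step_groupNetwork (hP : P.SparseCoding) (hθ : ∀ i, P.θ₀ d i ≠ 0) (hΓ : 0 < Γ)
    (hH : Γ ≤ P.H d) (φ : Fin d → Fin Γ) (ω : Fin d ⊕ Fin d → ℝ) (t : ℝ) :
    (groupNetwork P φ).predict (inputVec P d ω + t • (groupNetwork P φ).dir (inputVec P d ω)) =
      ∑ g, gate (featSum P φ g ω + noiseSum P φ g ω +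
        t * (if groupThr P φ g ≤ |featSum P φ g ω + noiseSum P φ g ω| then groupNorm P φ g ^ 2 /
          √(∑ g with groupThr P φ g ≤ |featSum P φ g ω + noiseSum P φ g ω|, groupNorm P φ g ^ 2)
          else 0)) (groupThr P φ g) := by
  set N := groupNetwork P φ with hN
  set z := inputVec P d ω with hz
  set v : Fin Γ → ℝ := fun g => featSum P φ g ω + noiseSum P φ g ω with hv
  have hr (g : Fin Γ) : (0 : ℝ) < nodesOf (P.H d) Γ g := by exact_mod_cast nodesOf_pos hH g
  have hpre (h : Fin (P.H d)) (g : Fin Γ) (hg : (h : ℕ) % Γ = g) :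
      N.pre z h = (nodesOf (P.H d) Γ g : ℝ)⁻¹ * v g := pre_groupNetwork hP φ h g hg ω
  have hact (h : Fin (P.H d)) (g : Fin Γ) (hg : (h : ℕ) % Γ = g) :
      N.intercept h ≤ |N.pre z h| ↔ groupThr P φ g ≤ |v g| := by
    rw [hpre h g hg, hN, intercept_groupNetwork hP hθ hH φ h g hg, abs_mul,
      abs_of_pos (inv_pos.2 (hr g)), mul_le_mul_iff_right₀ (inv_pos.2 (hr g))]
  -- the gradient pairs with a node of an open group to the squared norm of the group
  have hgrad (h : Fin (P.H d)) (g : Fin Γ) (hg : (h : ℕ) % Γ = g) :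
      inner ℝ (N.col h) (N.activeGrad z) =
        if groupThr P φ g ≤ |v g| then (nodesOf (P.H d) Γ g : ℝ)⁻¹ * groupNorm P φ g ^ 2
        else 0 := by
    rw [Network.activeGrad, inner_sum]
    rw [sum_nodes hΓ _ (fun g' => if g = g' then (if groupThr P φ g ≤ |v g| then
      (groupNorm P φ g / nodesOf (P.H d) Γ g) ^ 2 else 0) else 0)]
    · rw [Finset.sum_eq_single g]
      · rw [if_pos rfl]
        have := (hr g).ne'
        split_ifs
        · field_simp
        · simp
      · intro g' _ hne
        rw [if_neg (Ne.symm hne), mul_zero]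
      · simp
    · intro h' g' hg'
      by_cases ha : N.intercept h' ≤ |N.pre z h'|
      · rw [if_pos ha, hN, inner_col_groupNetwork hP φ h h' g g' hg hg']
        rw [hact h' g' hg'] at ha
        by_cases hgg : g = g'
        · subst hgg; rw [if_pos rfl, if_pos rfl, if_pos ha]
        · rw [if_neg hgg, if_neg hgg]
      · rw [if_neg ha, inner_zero_right]
        rw [hact h' g' hg'] at ha
        by_cases hgg : g = g'
        · subst hgg; rw [if_pos rfl, if_neg ha]
        · rw [if_neg hgg]
  have hnorm : ‖N.activeGrad z‖ =
      √(∑ g with groupThr P φ g ≤ |v g|, groupNorm P φ g ^ 2) := by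
    rw [eq_comm, Real.sqrt_eq_iff_mul_self_eq (Finset.sum_nonneg fun _ _ => sq_nonneg _)
      (norm_nonneg _), ← real_inner_self_eq_norm_mul_norm]
    have hi : inner ℝ (N.activeGrad z) (N.activeGrad z) =
        ∑ h, inner ℝ (if N.intercept h ≤ |N.pre z h| then N.col h else 0) (N.activeGrad z) :=
      sum_inner _ _ _
    rw [hi, sum_nodes hΓ _ (fun g => if groupThr P φ g ≤ |v g| then
      (nodesOf (P.H d) Γ g : ℝ)⁻¹ * groupNorm P φ g ^ 2 else 0), Finset.sum_filter]
    · refine Finset.sum_congr rfl fun g _ => ?_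
      have := (hr g).ne'
      split_ifs
      · field_simp
      · simp
    · intro h g hg
      by_cases ha : N.intercept h ≤ |N.pre z h|
      · rw [if_pos ha, hgrad h g hg]
      · rw [if_neg ha, inner_zero_left, if_neg (by rwa [← hact h g hg])]
  rw [N.predict_eq, sum_nodes hΓ _ (fun g => (nodesOf (P.H d) Γ g : ℝ)⁻¹ *
    gate (v g + t * (if groupThr P φ g ≤ |v g| then groupNorm P φ g ^ 2 /
      √(∑ g with groupThr P φ g ≤ |v g|, groupNorm P φ g ^ 2) else 0)) (groupThr P φ g))]
  · refine Finset.sum_congr rfl fun g _ => ?_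
    rw [← mul_assoc, mul_inv_cancel₀ (hr g).ne', one_mul]
  · intro h g hg
    rw [← gate_mul (inv_pos.2 (hr g)), hN, intercept_groupNetwork hP hθ hH φ h g hg, ← hN,
      N.pre_add_smul, hpre h g hg]
    congr 1
    rw [N.pre_eq_inner, Network.dir, inner_smul_right, hgrad h g hg, hnorm]
    split_ifs
    · ring
    · ring

/-- The parameters at dimension `d` are in the asymptotic regime, with constants `c` and `C`.  By
`log_large` the activation threshold of a group is at most a third of the contribution of an active
feature, and by `log_large'` the features of a group are active with a total probability of at most
`1 / 4`. -/
structure Regime (P : Model) (d : ℕ) (c C : ℝ) : Prop where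
  d_pos : 0 < d
  two_le_k : 2 ≤ P.k d
  two_le_m : 2 ≤ P.mstar d
  one_le_log : 1 ≤ Real.log d
  le_coef : ∀ i, c ≤ |P.θ₀ d i|
  coef_le : ∀ i, |P.θ₀ d i| ≤ C
  log_large : 3 * C ≤ c * √(Real.log d)
  log_large' : 4 * C ≤ Real.log d ^ 2
  le_prob : c * (P.k d / d) ≤ (P.coordLaw d).real {x | x ≠ 0}
  prob_le : (P.coordLaw d).real {x | x ≠ 0} ≤ C * (P.k d / d)
  moment_le : ∫ x, x ^ 2 ∂(P.coordLaw d) ≤ C / d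
  sparse : P.k d * P.mstar d * Real.log d ^ 2 ≤ d
  nodes : d ≤ P.H d

/-- The nonzero features of a sample point are at least `1 / √k`. -/
def FeatureRange (P : Model) (d : ℕ) (ω : Fin d ⊕ Fin d → ℝ) : Prop :=
  ∀ i, ω (Sum.inl i) = 0 ∨ 1 / √(P.k d) ≤ |ω (Sum.inl i)|

theorem ae_featureRange (hP : P.SparseCoding) (d : ℕ) : ∀ᵐ ω ∂baseLaw P d, FeatureRange P d ω := by
  have := hP.prob d
  refine ae_all_iff.2 fun i => ?_
  have h := (measurePreserving_inl (μ := P.coordLaw d)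
    (v := (P.ζ ^ 2 / (d : ℝ)).toNNReal) i).quasiMeasurePreserving.ae (hP.range d)
  filter_upwards [h] with ω hω
  exact hω.imp_right And.left

variable {c C : ℝ}

theorem groupNorm_le (hR : Regime P d c C) (φ : Fin d → Fin Γ) (g : Fin Γ) :
    groupNorm P φ g ^ 2 ≤ C ^ 2 * (fibre φ g).card := by
  rw [groupNorm_sq, mul_comm, ← nsmul_eq_mul, ← Finset.sum_const]
  refine Finset.sum_le_sum fun i _ => ?_
  rw [← sq_abs]
  gcongr
  exact hR.coef_le i

theorem const_nonneg (hR : Regime P d c C) : 0 ≤ C :=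
  (abs_nonneg _).trans (hR.coef_le ⟨0, hR.d_pos⟩)

theorem groupThr_le (hR : Regime P d c C) (φ : Fin d → Fin Γ) (g : Fin Γ) :
    groupThr P φ g ≤ C / √(P.k d) / √(Real.log d) := by
  have hk : 0 < P.k d := by linarith [hR.two_le_k]
  have hC := const_nonneg hR
  unfold groupThr
  refine div_le_div_of_nonneg_right ?_ (Real.sqrt_nonneg _)
  rcases Nat.eq_zero_or_pos (fibre φ g).card with h0 | h0
  · rw [h0]; simp only [Nat.cast_zero, mul_zero, Real.sqrt_zero, div_zero]; positivity
  · have h0' : (0 : ℝ) < (fibre φ g).card := by exact_mod_cast h0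
    rw [Real.sqrt_mul hk.le, div_le_div_iff₀ (by positivity) (by positivity)]
    have h1 : groupNorm P φ g ≤ C * √((fibre φ g).card : ℝ) := by
      refine Real.sqrt_le_iff.2 ⟨by positivity, ?_⟩
      rw [mul_pow, Real.sq_sqrt h0'.le, ← groupNorm_sq]
      exact groupNorm_le hR φ g
    calc groupNorm P φ g * √(P.k d) ≤ C * √((fibre φ g).card : ℝ) * √(P.k d) := by gcongr
      _ = C * (√(P.k d) * √((fibre φ g).card : ℝ)) := by ring

theorem groupThr_le' (hR : Regime P d c C) (φ : Fin d → Fin Γ) (g : Fin Γ) :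
    groupThr P φ g ≤ C / √(P.k d) := by
  refine (groupThr_le hR φ g).trans (div_le_self ?_ ?_)
  · have := const_nonneg hR; positivity
  · rw [Real.one_le_sqrt]; exact hR.one_le_log

theorem groupThr_le_const (hR : Regime P d c C) (φ : Fin d → Fin Γ) (g : Fin Γ) :
    groupThr P φ g ≤ C := by
  have hk := hR.two_le_k
  exact (groupThr_le' hR φ g).trans
    (div_le_self (const_nonneg hR) (by rw [Real.one_le_sqrt]; linarith))

/-- The margin of the gating: an active feature contributes at least `c / √k`, from which the noise
and an attack can each remove one threshold. -/
theorem three_groupThr_le (hR : Regime P d c C) (φ : Fin d → Fin Γ) (g : Fin Γ) :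
    3 * groupThr P φ g ≤ c / √(P.k d) := by
  have hL : 0 < √(Real.log d) := Real.sqrt_pos.2 (by linarith [hR.one_le_log])
  have hk : 0 < √(P.k d) := Real.sqrt_pos.2 (by linarith [hR.two_le_k])
  have h1 := groupThr_le hR φ g
  have h2 : 3 * (C / √(P.k d) / √(Real.log d)) ≤ c / √(P.k d) := by
    rw [div_div, ← mul_div_assoc, div_le_div_iff₀ (by positivity) hk]
    have := mul_le_mul_of_nonneg_right hR.log_large hk.le
    linarith
  linarith

/-- A group which is neither bad nor active is closed. -/
theorem closed_of_not_bad {φ : Fin d → Fin Γ} {g : Fin Γ} {ω : Fin d ⊕ Fin d → ℝ}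
    (hb : ¬ GroupBad P φ g ω) (ha : ¬ GroupActive φ g ω) :
    featSum P φ g ω = 0 ∧ |featSum P φ g ω + noiseSum P φ g ω| < groupThr P φ g := by
  have h0 : featSum P φ g ω = 0 := by
    refine Finset.sum_eq_zero fun i hi => ?_
    have : ω (Sum.inl i) = 0 := by
      by_contra hne
      exact ha ⟨i, hi, hne⟩
    rw [this, mul_zero]
  refine ⟨h0, ?_⟩
  rw [h0, zero_add]
  exact not_le.1 fun h => hb (Or.inr h)

/-- An active group which is not bad is open, with a margin: it has a single active feature, and its
noise is below the threshold. -/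
theorem open_of_not_bad (hR : Regime P d c C) {φ : Fin d → Fin Γ} {g : Fin Γ}
    {ω : Fin d ⊕ Fin d → ℝ} (hω : FeatureRange P d ω)
    (hb : ¬ GroupBad P φ g ω) (ha : GroupActive φ g ω) :
    2 * groupThr P φ g ≤ |featSum P φ g ω + noiseSum P φ g ω| := by
  obtain ⟨i, hi, hne⟩ := ha
  have hS : featSum P φ g ω = P.θ₀ d i * ω (Sum.inl i) := by
    refine Finset.sum_eq_single i (fun j hj hji => ?_) fun h => absurd hi h
    have : ω (Sum.inl j) = 0 := by
      by_contra hne'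
      exact hb (Or.inl ⟨i, hi, j, hj, hji.symm, hne, hne'⟩)
    rw [this, mul_zero]
  have h1 : c / √(P.k d) ≤ |featSum P φ g ω| := by
    rw [hS, abs_mul, div_eq_mul_one_div]
    exact mul_le_mul (hR.le_coef i) ((hω i).resolve_left hne) (by positivity) (abs_nonneg _)
  have h2 : |noiseSum P φ g ω| < groupThr P φ g := not_le.1 fun h => hb (Or.inr h)
  have h3 := three_groupThr_le hR φ g
  have h4 := abs_sub_abs_le_abs_sub (featSum P φ g ω) (-noiseSum P φ g ω)
  rw [abs_neg, sub_neg_eq_add] at h4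
  linarith

/-- The clean error of a group: the gated pre-activation minus the contribution of the features. -/
noncomputable def groupErr (P : Model) (φ : Fin d → Fin Γ) (g : Fin Γ) (ω : Fin d ⊕ Fin d → ℝ) :
    ℝ :=
  gate (featSum P φ g ω + noiseSum P φ g ω) (groupThr P φ g) - featSum P φ g ω

open scoped Classical in
/-- The error of a good group is its noise if the group is active, and zero otherwise; the error of a
bad group is at most its noise plus its threshold. -/
theorem groupErr_sq_le (hR : Regime P d c C) (φ : Fin d → Fin Γ) (g : Fin Γ)
    {ω : Fin d ⊕ Fin d → ℝ} (hω : FeatureRange P d ω) :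
    groupErr P φ g ω ^ 2 ≤ (if GroupActive φ g ω then noiseSum P φ g ω ^ 2 else 0) +
      (if GroupBad P φ g ω then 2 * (noiseSum P φ g ω ^ 2 + groupThr P φ g ^ 2) else 0) := by
  have h0 : 0 ≤ if GroupActive φ g ω then noiseSum P φ g ω ^ 2 else 0 := by
    split_ifs <;> positivity
  by_cases hb : GroupBad P φ g ω
  · rw [if_pos hb]
    have h1 := abs_gate_sub_le (v := featSum P φ g ω + noiseSum P φ g ω)
      (groupThr_nonneg (P := P) φ g)
    have h2 : groupErr P φ g ω ^ 2 ≤ 2 * (noiseSum P φ g ω ^ 2 + groupThr P φ g ^ 2) := by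
      have e : groupErr P φ g ω = (gate (featSum P φ g ω + noiseSum P φ g ω) (groupThr P φ g) -
        (featSum P φ g ω + noiseSum P φ g ω)) + noiseSum P φ g ω := by rw [groupErr]; ring
      rw [e]
      have h3 := sq_le_sq' (abs_le.1 h1).1 (abs_le.1 h1).2
      nlinarith [sq_nonneg (gate (featSum P φ g ω + noiseSum P φ g ω) (groupThr P φ g) -
        (featSum P φ g ω + noiseSum P φ g ω) - noiseSum P φ g ω)]
    linarith
  · rw [if_neg hb, add_zero]
    by_cases ha : GroupActive φ g ω
    · have h1 := open_of_not_bad hR hω hb ha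
      have h2 := groupThr_nonneg (P := P) φ g
      rw [if_pos ha, groupErr, show gate _ _ = _ from if_pos (by linarith)]
      simp
    · obtain ⟨h1, h2⟩ := closed_of_not_bad hb ha
      rw [if_neg ha, groupErr, show gate _ _ = _ from if_neg (not_le.2 h2), h1]
      simp

/-- The prediction error of a group network is the sum of the errors of the groups. -/
theorem predict_groupNetwork_sub_score (hP : P.SparseCoding) (hθ : ∀ i, P.θ₀ d i ≠ 0)
    (hΓ : 0 < Γ) (hH : Γ ≤ P.H d) (φ : Fin d → Fin Γ) (ω : Fin d ⊕ Fin d → ℝ) :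
    (groupNetwork P φ).predict (inputVec P d ω) - P.score d (featureVec ω) =
      ∑ g, groupErr P φ g ω := by
  have h := predict_step_groupNetwork hP hθ hΓ hH φ ω 0
  simp only [zero_smul, add_zero, zero_mul] at h
  rw [h]
  simp only [groupErr, Finset.sum_sub_distrib]
  congr 1
  exact (sum_fibre φ fun i => P.θ₀ d i * ω (Sum.inl i)).symm

/-- An attack of strength `ε` shifts the prediction of a group network by `ε` times the ideal
gradient norm, up to the thresholds of the bad groups. -/
theorem abs_predict_step_sub_le (hP : P.SparseCoding) (hc : 0 < c) (hR : Regime P d c C)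
    (hΓ : 0 < Γ) (hH : Γ ≤ P.H d) (φ : Fin d → Fin Γ)
    {ω : Fin d ⊕ Fin d → ℝ} (hω : FeatureRange P d ω) {ε t : ℝ}
    (hε : ∀ g, ε * groupNorm P φ g ≤ groupThr P φ g) (ht : |t| ≤ ε) :
    |(groupNetwork P φ).predict (inputVec P d ω + t • (groupNetwork P φ).dir (inputVec P d ω)) -
      (groupNetwork P φ).predict (inputVec P d ω) - t * idealGrad P φ ω| ≤ 2 * badThr P φ ω := by
  have hθ : ∀ i, P.θ₀ d i ≠ 0 := fun i => abs_pos.1 (hc.trans_le (hR.le_coef i))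
  have h0 := predict_step_groupNetwork hP hθ hΓ hH φ ω 0
  simp only [zero_smul, add_zero, zero_mul] at h0
  rw [predict_step_groupNetwork hP hθ hΓ hH φ ω t, h0]
  exact abs_step_sub_le (fun g => groupNorm_nonneg φ g) (fun g => groupThr_nonneg φ g) hε ht
    (fun g hb ha => open_of_not_bad hR hω hb ha) (fun g hb ha => (closed_of_not_bad hb ha).2)

end GroupNetwork

/-! ### Moments of active and bad groups -/

section Moments

variable {d Γ : ℕ} {P : Model} {c C : ℝ}

/-- The indicator of the event that the feature `i` is active. -/
noncomputable def actInd (i : Fin d) (ω : Fin d ⊕ Fin d → ℝ) : ℝ :=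
  if ω (Sum.inl i) = 0 then 0 else 1

/-- The probability that a feature is active. -/
noncomputable def actProb (P : Model) (d : ℕ) : ℝ := (P.coordLaw d).real {x | x ≠ 0}

theorem isProbabilityMeasure_baseLaw (hP : P.SparseCoding) (d : ℕ) :
    IsProbabilityMeasure (baseLaw P d) := by
  have := hP.prob d
  unfold baseLaw; infer_instance

theorem actInd_nonneg (i : Fin d) (ω : Fin d ⊕ Fin d → ℝ) : 0 ≤ actInd i ω := by
  unfold actInd; split_ifs <;> norm_num

theorem actInd_le_one (i : Fin d) (ω : Fin d ⊕ Fin d → ℝ) : actInd i ω ≤ 1 := by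
  unfold actInd; split_ifs <;> norm_num

theorem measurable_actInd (i : Fin d) : Measurable (actInd (d := d) i) :=
  Measurable.ite (measurableSet_eq_fun (by fun_prop) measurable_const) measurable_const
    measurable_const

theorem dependsOn_actInd (i : Fin d) : DependsOn (actInd (d := d) i) {Sum.inl i} := by
  intro x y hxy
  simp only [actInd, hxy (Sum.inl i) rfl]

theorem integrable_of_bounded (hP : P.SparseCoding) {F : (Fin d ⊕ Fin d → ℝ) → ℝ}
    (hF : Measurable F) {B : ℝ} (hB : ∀ ω, |F ω| ≤ B) : Integrable F (baseLaw P d) := by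
  have := isProbabilityMeasure_baseLaw hP d
  exact (integrable_const B).mono' hF.aestronglyMeasurable (Eventually.of_forall hB)

theorem integrable_actInd (hP : P.SparseCoding) (i : Fin d) :
    Integrable (actInd i) (baseLaw P d) :=
  integrable_of_bounded hP (measurable_actInd i) (B := 1) fun ω => by
    rw [abs_of_nonneg (actInd_nonneg i ω)]; exact actInd_le_one i ω

theorem integral_inl (hP : P.SparseCoding) (i : Fin d) {f : ℝ → ℝ} (hf : Measurable f) :
    ∫ ω, f (ω (Sum.inl i)) ∂baseLaw P d = ∫ x, f x ∂P.coordLaw d := by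
  have := hP.prob d
  have h := measurePreserving_inl (μ := P.coordLaw d) (v := (P.ζ ^ 2 / (d : ℝ)).toNNReal) i
  rw [← h.map_eq, integral_map h.measurable.aemeasurable hf.aestronglyMeasurable]
  rfl

theorem integral_actInd (hP : P.SparseCoding) (i : Fin d) :
    ∫ ω, actInd i ω ∂baseLaw P d = actProb P d := by
  have hm : MeasurableSet {x : ℝ | x ≠ 0} := (measurableSet_singleton 0).compl
  have h := integral_inl hP i (f := fun x => if x = 0 then 0 else 1)
    (Measurable.ite (measurableSet_singleton 0) measurable_const measurable_const)
  refine h.trans ?_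
  have e : (fun x : ℝ => if x = 0 then (0 : ℝ) else 1) = {x : ℝ | x ≠ 0}.indicator 1 := by
    funext x
    by_cases hx : x = 0 <;> simp [hx]
  rw [e, integral_indicator_one hm, actProb]

theorem actProb_nonneg : 0 ≤ actProb P d := measureReal_nonneg

theorem integral_actInd_mul (hP : P.SparseCoding) {i j : Fin d} (hij : i ≠ j) :
    ∫ ω, actInd i ω * actInd j ω ∂baseLaw P d = actProb P d ^ 2 := by
  have := hP.prob d
  have h := integral_mul_of_dependsOn (μ := P.coordLaw d)
    (v := (P.ζ ^ 2 / (d : ℝ)).toNNReal) (measurable_actInd i) (measurable_actInd j)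
    (dependsOn_actInd i) (dependsOn_actInd j) (by simpa using hij)
  change ∫ ω, actInd i ω * actInd j ω ∂baseLaw P d =
    (∫ ω, actInd i ω ∂baseLaw P d) * ∫ ω, actInd j ω ∂baseLaw P d at h
  rw [h, integral_actInd hP i, integral_actInd hP j, sq]

/-- The variance of the noise of the group `g`. -/
noncomputable def noiseVar (P : Model) (φ : Fin d → Fin Γ) (g : Fin Γ) : ℝ :=
  P.ζ ^ 2 / d * groupNorm P φ g ^ 2

theorem noiseVar_nonneg (φ : Fin d → Fin Γ) (g : Fin Γ) : 0 ≤ noiseVar P φ g := by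
  unfold noiseVar; positivity

theorem noiseSum_eq (φ : Fin d → Fin Γ) (g : Fin Γ) (ω : Fin d ⊕ Fin d → ℝ) :
    noiseSum P φ g ω = ∑ i, (if φ i = g then P.θ₀ d i else 0) * ω (Sum.inr i) := by
  rw [noiseSum, fibre, Finset.sum_filter]
  exact Finset.sum_congr rfl fun i _ => by split_ifs <;> simp

theorem measurable_noiseSum (φ : Fin d → Fin Γ) (g : Fin Γ) : Measurable (noiseSum P φ g) := by
  unfold noiseSum; fun_prop

theorem measurable_featSum (φ : Fin d → Fin Γ) (g : Fin Γ) : Measurable (featSum P φ g) := by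
  unfold featSum; fun_prop

theorem integral_noiseSum_pow (hP : P.SparseCoding) (φ : Fin d → Fin Γ) (g : Fin Γ) (q : ℕ) :
    Integrable (fun ω => |noiseSum P φ g ω| ^ q) (baseLaw P d) ∧
    ∫ ω, |noiseSum P φ g ω| ^ q ∂baseLaw P d = √(noiseVar P φ g) ^ q * gaussMoment q := by
  have := hP.prob d
  simp only [noiseSum_eq]
  refine ⟨integrable_noise_pow _ q, ?_⟩
  rw [baseLaw, integral_noise_pow, Real.coe_toNNReal _ (by positivity), noiseVar, groupNorm_sq]
  congr 4
  rw [fibre, Finset.sum_filter]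
  exact Finset.sum_congr rfl fun i _ => by split_ifs <;> simp

/-- Noise moments factor out of integrals with functions of the features. -/
theorem integral_noiseSum_pow_mul (hP : P.SparseCoding) (φ : Fin d → Fin Γ) (g : Fin Γ) (q : ℕ)
    {F : (Fin d ⊕ Fin d → ℝ) → ℝ} (hF : Measurable F) (hdep : DependsOn F (Set.range Sum.inl))
    {B : ℝ} (hB : ∀ ω, |F ω| ≤ B) :
    Integrable (fun ω => |noiseSum P φ g ω| ^ q * F ω) (baseLaw P d) ∧
    ∫ ω, |noiseSum P φ g ω| ^ q * F ω ∂baseLaw P d =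
      √(noiseVar P φ g) ^ q * gaussMoment q * ∫ ω, F ω ∂baseLaw P d := by
  have := hP.prob d
  have hm : Measurable fun ω => |noiseSum P φ g ω| ^ q := (measurable_noiseSum φ g).abs.pow_const q
  have hd : DependsOn (fun ω => |noiseSum P φ g ω| ^ q) (Set.range Sum.inr) := by
    intro x y hxy
    simp only [noiseSum]
    congr 2
    exact Finset.sum_congr rfl fun i _ => by rw [hxy _ ⟨i, rfl⟩]
  obtain ⟨h1, h2⟩ := integral_noiseSum_pow hP φ g q
  refine ⟨h1.mul_bdd (c := B) hF.aestronglyMeasurable (Eventually.of_forall hB), ?_⟩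
  rw [← h2]
  exact integral_mul_of_dependsOn (μ := P.coordLaw d) (v := (P.ζ ^ 2 / (d : ℝ)).toNNReal)
    hm hF hd hdep Set.isCompl_range_inl_range_inr.disjoint.symm

theorem groupThr_sq (hR : Regime P d c C) (φ : Fin d → Fin Γ) (g : Fin Γ) :
    groupThr P φ g ^ 2 =
      groupNorm P φ g ^ 2 / (P.k d * (fibre φ g).card * Real.log d) := by
  have hk : 0 ≤ P.k d := by linarith [hR.two_le_k]
  rw [groupThr, div_pow, div_pow, Real.sq_sqrt (by positivity),
    Real.sq_sqrt (by linarith [hR.one_le_log]), div_div]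

theorem groupNorm_pos (hc : 0 < c) (hR : Regime P d c C) (φ : Fin d → Fin Γ) (g : Fin Γ)
    (hg : 1 ≤ (fibre φ g).card) : 0 < groupNorm P φ g := by
  obtain ⟨i, hi⟩ := Finset.card_pos.1 hg
  refine Real.sqrt_pos.2 (Finset.sum_pos' (fun _ _ => sq_nonneg _) ⟨i, hi, ?_⟩)
  have := abs_pos.1 (hc.trans_le (hR.le_coef i))
  positivity

theorem groupThr_pos (hc : 0 < c) (hR : Regime P d c C) (φ : Fin d → Fin Γ) (g : Fin Γ)
    (hg : 1 ≤ (fibre φ g).card) : 0 < groupThr P φ g := by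
  have h1 := groupNorm_pos hc hR φ g hg
  have hk : 0 < P.k d := by linarith [hR.two_le_k]
  have hL : 0 < Real.log d := by linarith [hR.one_le_log]
  have hg' : (0 : ℝ) < (fibre φ g).card := by exact_mod_cast hg
  unfold groupThr
  positivity

/-- The density `k |A_g| / d` of active features, for the group `g`. -/
noncomputable def groupDensity (P : Model) (φ : Fin d → Fin Γ) (g : Fin Γ) : ℝ :=
  P.k d * (fibre φ g).card / d

theorem groupDensity_nonneg (hR : Regime P d c C) (φ : Fin d → Fin Γ) (g : Fin Γ) :
    0 ≤ groupDensity P φ g := by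
  have hk : 0 ≤ P.k d := by linarith [hR.two_le_k]
  unfold groupDensity; positivity

/-- The noise variance is small compared with the squared threshold, which makes the eighth moment
of their ratio of the order of the squared density. -/
theorem noise_ratio_le (hc : 0 < c) (hR : Regime P d c C) (φ : Fin d → Fin Γ) (g : Fin Γ)
    (hg : 1 ≤ (fibre φ g).card) (hgm : (fibre φ g).card ≤ P.mstar d) :
    √(noiseVar P φ g) ^ 8 / groupThr P φ g ^ 8 ≤ P.ζ ^ 8 * groupDensity P φ g ^ 2 := by
  have hk : 0 < P.k d := by linarith [hR.two_le_k]
  have hL : 0 < Real.log d := by linarith [hR.one_le_log]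
  have hg' : (0 : ℝ) < (fibre φ g).card := by exact_mod_cast hg
  have hgm' : ((fibre φ g).card : ℝ) ≤ P.mstar d := by exact_mod_cast hgm
  have hd : (0 : ℝ) < d := by exact_mod_cast hR.d_pos
  have hT := groupNorm_pos hc hR φ g hg
  have h1 : √(noiseVar P φ g) ^ 8 = noiseVar P φ g ^ 4 := by
    rw [show (8 : ℕ) = 2 * 4 by norm_num, pow_mul, Real.sq_sqrt (noiseVar_nonneg φ g)]
  have h2 : groupThr P φ g ^ 8 = (groupThr P φ g ^ 2) ^ 4 := by rw [← pow_mul]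
  rw [h1, h2, groupThr_sq hR, ← div_pow]
  have h3 : noiseVar P φ g / (groupNorm P φ g ^ 2 / (P.k d * (fibre φ g).card * Real.log d)) =
      P.ζ ^ 2 * (groupDensity P φ g * Real.log d) := by
    rw [noiseVar, groupDensity]; field_simp
  rw [h3]
  have h4 : groupDensity P φ g * Real.log d ^ 2 ≤ 1 := by
    rw [groupDensity, div_mul_eq_mul_div, div_le_one hd]
    refine le_trans ?_ hR.sparse
    gcongr
  have h5 : 0 ≤ groupDensity P φ g := groupDensity_nonneg hR φ g
  calc (P.ζ ^ 2 * (groupDensity P φ g * Real.log d)) ^ 4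
      = P.ζ ^ 8 * groupDensity P φ g ^ 2 * (groupDensity P φ g * Real.log d ^ 2) ^ 2 := by ring
    _ ≤ P.ζ ^ 8 * groupDensity P φ g ^ 2 * 1 ^ 2 := by gcongr
    _ = _ := by ring

open scoped Classical in
/-- The indicator of a bad group. -/
noncomputable def badInd (P : Model) (φ : Fin d → Fin Γ) (g : Fin Γ) (ω : Fin d ⊕ Fin d → ℝ) : ℝ :=
  if GroupBad P φ g ω then 1 else 0

open scoped Classical in
/-- The indicator of an active group. -/
noncomputable def groupInd (φ : Fin d → Fin Γ) (g : Fin Γ) (ω : Fin d ⊕ Fin d → ℝ) : ℝ :=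
  if GroupActive φ g ω then 1 else 0

theorem measurableSet_groupActive (φ : Fin d → Fin Γ) (g : Fin Γ) :
    MeasurableSet {ω | GroupActive φ g ω} := by
  have : {ω : Fin d ⊕ Fin d → ℝ | GroupActive φ g ω} =
      ⋃ i ∈ fibre φ g, {ω | ω (Sum.inl i) = 0}ᶜ := by
    ext ω; simp [GroupActive]
  rw [this]
  exact Finset.measurableSet_biUnion _ fun i _ =>
    (measurableSet_eq_fun (by fun_prop) measurable_const).compl

theorem measurableSet_groupBad (φ : Fin d → Fin Γ) (g : Fin Γ) :
    MeasurableSet {ω | GroupBad P φ g ω} := by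
  have h0 (i : Fin d) : MeasurableSet {ω : Fin d ⊕ Fin d → ℝ | ω (Sum.inl i) = 0} :=
    measurableSet_eq_fun (by fun_prop) measurable_const
  have : {ω : Fin d ⊕ Fin d → ℝ | GroupBad P φ g ω} =
      (⋃ i ∈ fibre φ g, ⋃ j ∈ (fibre φ g).erase i,
        {ω | ω (Sum.inl i) = 0}ᶜ ∩ {ω | ω (Sum.inl j) = 0}ᶜ) ∪
      {ω | groupThr P φ g ≤ |noiseSum P φ g ω|} := by
    ext ω
    simp only [GroupBad, Set.mem_ofPred_eq, Set.mem_union, Set.mem_iUnion, Set.mem_inter_iff,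
      Set.mem_compl_iff, Finset.mem_erase, exists_prop]
    refine or_congr_left (exists_congr fun i => and_congr_right fun _ => exists_congr fun j => ?_)
    constructor
    · rintro ⟨h1, h2, h3⟩; exact ⟨⟨Ne.symm h2, h1⟩, h3⟩
    · rintro ⟨⟨h1, h2⟩, h3⟩; exact ⟨h2, Ne.symm h1, h3⟩
  rw [this]
  exact (Finset.measurableSet_biUnion _ fun i _ => Finset.measurableSet_biUnion _ fun j _ =>
    (h0 i).compl.inter (h0 j).compl).union
    (measurableSet_le measurable_const (measurable_noiseSum φ g).abs)

theorem measurable_badInd (φ : Fin d → Fin Γ) (g : Fin Γ) : Measurable (badInd P φ g) :=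
  Measurable.ite (measurableSet_groupBad φ g) measurable_const measurable_const

theorem measurable_groupInd (φ : Fin d → Fin Γ) (g : Fin Γ) : Measurable (groupInd φ g) :=
  Measurable.ite (measurableSet_groupActive φ g) measurable_const measurable_const

theorem badInd_nonneg (φ : Fin d → Fin Γ) (g : Fin Γ) (ω : Fin d ⊕ Fin d → ℝ) :
    0 ≤ badInd P φ g ω := by
  unfold badInd; split_ifs <;> norm_num

theorem badInd_le_one (φ : Fin d → Fin Γ) (g : Fin Γ) (ω : Fin d ⊕ Fin d → ℝ) :
    badInd P φ g ω ≤ 1 := by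
  unfold badInd; split_ifs <;> norm_num

theorem groupInd_nonneg (φ : Fin d → Fin Γ) (g : Fin Γ) (ω : Fin d ⊕ Fin d → ℝ) :
    0 ≤ groupInd φ g ω := by
  unfold groupInd; split_ifs <;> norm_num

theorem groupInd_le_one (φ : Fin d → Fin Γ) (g : Fin Γ) (ω : Fin d ⊕ Fin d → ℝ) :
    groupInd φ g ω ≤ 1 := by
  unfold groupInd; split_ifs <;> norm_num

theorem groupInd_le_sum (φ : Fin d → Fin Γ) (g : Fin Γ) (ω : Fin d ⊕ Fin d → ℝ) :
    groupInd φ g ω ≤ ∑ i ∈ fibre φ g, actInd i ω := by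
  unfold groupInd
  split_ifs with h
  · obtain ⟨i, hi, hne⟩ := h
    refine le_trans (le_of_eq ?_) (Finset.single_le_sum (fun i _ => actInd_nonneg i ω) hi)
    simp [actInd, hne]
  · exact Finset.sum_nonneg fun i _ => actInd_nonneg i ω

/-- Union bound for the event that a group is bad, with Markov's inequality for its noise. -/
theorem badInd_le (hc : 0 < c) (hR : Regime P d c C) (φ : Fin d → Fin Γ) (g : Fin Γ)
    (hg : 1 ≤ (fibre φ g).card) (ω : Fin d ⊕ Fin d → ℝ) :
    badInd P φ g ω ≤ ∑ i ∈ fibre φ g, ∑ j ∈ (fibre φ g).erase i, actInd i ω * actInd j ω +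
      |noiseSum P φ g ω| ^ 8 / groupThr P φ g ^ 8 := by
  have hthr := groupThr_pos hc hR φ g hg
  have hS (i : Fin d) : 0 ≤ ∑ j ∈ (fibre φ g).erase i, actInd i ω * actInd j ω :=
    Finset.sum_nonneg fun j _ => mul_nonneg (actInd_nonneg _ _) (actInd_nonneg _ _)
  have h1 : 0 ≤ ∑ i ∈ fibre φ g, ∑ j ∈ (fibre φ g).erase i, actInd i ω * actInd j ω :=
    Finset.sum_nonneg fun i _ => hS i
  have h2 : 0 ≤ |noiseSum P φ g ω| ^ 8 / groupThr P φ g ^ 8 := by positivity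
  unfold badInd
  split_ifs with h
  · rcases h with ⟨i, hi, j, hj, hij, hi0, hj0⟩ | h
    · have h3 : 1 ≤ ∑ j ∈ (fibre φ g).erase i, actInd i ω * actInd j ω := by
        refine le_trans (le_of_eq ?_) (Finset.single_le_sum
          (fun j _ => mul_nonneg (actInd_nonneg i ω) (actInd_nonneg j ω))
          (Finset.mem_erase.2 ⟨hij.symm, hj⟩))
        simp [actInd, hi0, hj0]
      have h4 := Finset.single_le_sum (fun i _ => hS i) hi
      linarith
    · have : 1 ≤ |noiseSum P φ g ω| ^ 8 / groupThr P φ g ^ 8 := by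
        rw [← div_pow]
        exact one_le_pow₀ ((one_le_div hthr).2 h)
      linarith
  · linarith

/-- Moments of the noise of a group on the event that the group is bad. -/
theorem integral_noise_badInd_le (hP : P.SparseCoding) (hc : 0 < c) (hR : Regime P d c C)
    (φ : Fin d → Fin Γ) (g : Fin Γ) (hg : 1 ≤ (fibre φ g).card)
    (hgm : (fibre φ g).card ≤ P.mstar d) (q : ℕ) :
    Integrable (fun ω => |noiseSum P φ g ω| ^ q * badInd P φ g ω) (baseLaw P d) ∧
    ∫ ω, |noiseSum P φ g ω| ^ q * badInd P φ g ω ∂baseLaw P d ≤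
      √(noiseVar P φ g) ^ q *
        ((C ^ 2 * gaussMoment q + P.ζ ^ 8 * gaussMoment (q + 8)) * groupDensity P φ g ^ 2) := by
  have hthr := groupThr_pos hc hR φ g hg
  set Pr : (Fin d ⊕ Fin d → ℝ) → ℝ := fun ω =>
    ∑ i ∈ fibre φ g, ∑ j ∈ (fibre φ g).erase i, actInd i ω * actInd j ω with hPr
  have hint : Integrable (fun ω => |noiseSum P φ g ω| ^ q * badInd P φ g ω) (baseLaw P d) :=
    (integral_noiseSum_pow hP φ g q).1.mul_bdd (c := 1) (measurable_badInd φ g).aestronglyMeasurable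
      (Eventually.of_forall fun ω => by
        rw [Real.norm_eq_abs, abs_of_nonneg (badInd_nonneg φ g ω)]; exact badInd_le_one φ g ω)
  refine ⟨hint, ?_⟩
  have hPrm : Measurable Pr := Finset.measurable_sum _ fun i _ => Finset.measurable_sum _ fun j _ =>
    (measurable_actInd i).mul (measurable_actInd j)
  have hPrd : DependsOn Pr (Set.range Sum.inl) := by
    intro x y hxy
    have h (i : Fin d) : actInd i x = actInd i y := by
      simp only [actInd, hxy (Sum.inl i) ⟨i, rfl⟩]
    simp only [hPr, h]
  have hPrb : ∀ ω, |Pr ω| ≤ ∑ i ∈ fibre φ g, ∑ j ∈ (fibre φ g).erase i, (1 : ℝ) := by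
    intro ω
    rw [abs_of_nonneg (Finset.sum_nonneg fun i _ => Finset.sum_nonneg fun j _ =>
      mul_nonneg (actInd_nonneg _ _) (actInd_nonneg _ _))]
    exact Finset.sum_le_sum fun i _ => Finset.sum_le_sum fun j _ =>
      mul_le_one₀ (actInd_le_one _ _) (actInd_nonneg _ _) (actInd_le_one _ _)
  -- Bad by two active features: independent of the noise.  Bad by noise: eight more noise moments.
  obtain ⟨i1, e1⟩ := integral_noiseSum_pow_mul hP φ g q hPrm hPrd hPrb
  obtain ⟨i2, e2⟩ := integral_noiseSum_pow hP φ g (q + 8)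
  have h1 : ∫ ω, |noiseSum P φ g ω| ^ q * badInd P φ g ω ∂baseLaw P d ≤
      ∫ ω, (|noiseSum P φ g ω| ^ q * Pr ω + |noiseSum P φ g ω| ^ (q + 8) / groupThr P φ g ^ 8)
        ∂baseLaw P d := by
    refine integral_mono hint (i1.add (i2.div_const _)) fun ω => ?_
    have h2 := mul_le_mul_of_nonneg_left (badInd_le hc hR φ g hg ω)
      (pow_nonneg (abs_nonneg (noiseSum P φ g ω)) q)
    refine h2.trans (le_of_eq ?_)
    simp only [hPr]
    ring
  have h2 : ∫ ω, Pr ω ∂baseLaw P d ≤ C ^ 2 * groupDensity P φ g ^ 2 := by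
    have hpair (i j : Fin d) : Integrable (fun ω => actInd i ω * actInd j ω) (baseLaw P d) :=
      integrable_of_bounded hP ((measurable_actInd i).mul (measurable_actInd j)) (B := 1) fun ω => by
        rw [abs_of_nonneg (mul_nonneg (actInd_nonneg i ω) (actInd_nonneg j ω))]
        exact mul_le_one₀ (actInd_le_one _ _) (actInd_nonneg _ _) (actInd_le_one _ _)
    rw [integral_finsetSum _ fun i _ => integrable_finsetSum _ fun j _ => hpair i j]
    have h3 : ∀ i ∈ fibre φ g, ∫ ω, ∑ j ∈ (fibre φ g).erase i, actInd i ω * actInd j ω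
        ∂baseLaw P d ≤ (fibre φ g).card * actProb P d ^ 2 := by
      intro i hi
      rw [integral_finsetSum _ fun j _ => hpair i j, ← nsmul_eq_mul]
      refine (Finset.sum_le_card_nsmul _ _ (actProb P d ^ 2) fun j hj => ?_).trans ?_
      · rw [integral_actInd_mul hP (Finset.ne_of_mem_erase hj).symm]
      · exact nsmul_le_nsmul_left (sq_nonneg _) (Finset.card_le_card (Finset.erase_subset _ _))
    refine (Finset.sum_le_card_nsmul _ _ _ h3).trans ?_
    rw [nsmul_eq_mul]
    have hp := hR.prob_le
    rw [← actProb] at hp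
    have hp0 : 0 ≤ actProb P d := actProb_nonneg
    calc ((fibre φ g).card : ℝ) * ((fibre φ g).card * actProb P d ^ 2)
        ≤ (fibre φ g).card * ((fibre φ g).card * (C * (P.k d / d)) ^ 2) := by gcongr
      _ = C ^ 2 * groupDensity P φ g ^ 2 := by rw [groupDensity]; ring
  rw [integral_add i1 (i2.div_const _), integral_div, e1, e2] at h1
  refine h1.trans ?_
  have h3 := noise_ratio_le hc hR φ g hg hgm
  have hq := gaussMoment_nonneg q
  have hq8 := gaussMoment_nonneg (q + 8)
  have hs : 0 ≤ √(noiseVar P φ g) ^ q := by positivity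
  calc √(noiseVar P φ g) ^ q * gaussMoment q * ∫ ω, Pr ω ∂baseLaw P d +
        √(noiseVar P φ g) ^ (q + 8) * gaussMoment (q + 8) / groupThr P φ g ^ 8
      = √(noiseVar P φ g) ^ q * gaussMoment q * ∫ ω, Pr ω ∂baseLaw P d +
        √(noiseVar P φ g) ^ q * gaussMoment (q + 8) *
          (√(noiseVar P φ g) ^ 8 / groupThr P φ g ^ 8) := by rw [pow_add]; ring
    _ ≤ √(noiseVar P φ g) ^ q * gaussMoment q * (C ^ 2 * groupDensity P φ g ^ 2) +
        √(noiseVar P φ g) ^ q * gaussMoment (q + 8) * (P.ζ ^ 8 * groupDensity P φ g ^ 2) := by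
        gcongr
    _ = _ := by ring

end Moments

/-! ### Total errors of a group network -/

section Totals

variable {d Γ : ℕ} {P : Model} {c C : ℝ}

/-- A grouping of the features into nonempty groups of at most `m*` features. -/
def Admissible (P : Model) (φ : Fin d → Fin Γ) : Prop :=
  ∀ g, 1 ≤ (fibre φ g).card ∧ (fibre φ g).card ≤ P.mstar d

/-- The order `(m*)² k³ / d` of all error terms. -/
noncomputable def errOrder (P : Model) (d : ℕ) : ℝ := (P.mstar d : ℝ) ^ 2 * P.k d ^ 3 / d

theorem badThr_eq (φ : Fin d → Fin Γ) (ω : Fin d ⊕ Fin d → ℝ) :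
    badThr P φ ω = ∑ g, groupThr P φ g * badInd P φ g ω := by
  classical
  rw [badThr, Finset.sum_filter]
  refine Finset.sum_congr rfl fun g _ => ?_
  unfold badInd
  split_ifs <;> simp

theorem idealGrad_sq (φ : Fin d → Fin Γ) (ω : Fin d ⊕ Fin d → ℝ) :
    idealGrad P φ ω ^ 2 = ∑ g, groupNorm P φ g ^ 2 * groupInd φ g ω := by
  classical
  rw [idealGrad, Real.sq_sqrt (Finset.sum_nonneg fun _ _ => sq_nonneg _), Finset.sum_filter]
  refine Finset.sum_congr rfl fun g _ => ?_
  unfold groupInd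
  split_ifs <;> simp

theorem idealGrad_nonneg (φ : Fin d → Fin Γ) (ω : Fin d ⊕ Fin d → ℝ) : 0 ≤ idealGrad P φ ω :=
  Real.sqrt_nonneg _

theorem measurable_idealGrad (φ : Fin d → Fin Γ) : Measurable (idealGrad P φ) := by
  have : idealGrad P φ = fun ω => √(∑ g, groupNorm P φ g ^ 2 * groupInd φ g ω) := by
    funext ω
    rw [← idealGrad_sq, Real.sqrt_sq (idealGrad_nonneg φ ω)]
  rw [this]
  exact (Finset.measurable_sum _ fun g _ => (measurable_groupInd φ g).const_mul _).sqrt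

theorem measurable_groupErr (φ : Fin d → Fin Γ) (g : Fin Γ) : Measurable (groupErr P φ g) :=
  ((measurable_gate _).comp ((measurable_featSum φ g).add (measurable_noiseSum φ g))).sub
    (measurable_featSum φ g)

/-- The coordinates of the features and of the noise of the group `g`. -/
def groupCoords (φ : Fin d → Fin Γ) (g : Fin Γ) : Set (Fin d ⊕ Fin d) :=
  {j | φ (Sum.elim id id j) = g}

theorem disjoint_groupCoords (φ : Fin d → Fin Γ) {g g' : Fin Γ} (h : g ≠ g') :
    Disjoint (groupCoords φ g) (groupCoords φ g') := by
  rw [Set.disjoint_left]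
  intro j hj hj'
  exact h (Eq.trans (Eq.symm hj) hj')

theorem featSum_congr {φ : Fin d → Fin Γ} {g : Fin Γ} {x y : Fin d ⊕ Fin d → ℝ}
    (h : ∀ j ∈ groupCoords φ g, x j = y j) : featSum P φ g x = featSum P φ g y :=
  Finset.sum_congr rfl fun i hi => by rw [h (Sum.inl i) (mem_fibre.1 hi)]

theorem noiseSum_congr {φ : Fin d → Fin Γ} {g : Fin Γ} {x y : Fin d ⊕ Fin d → ℝ}
    (h : ∀ j ∈ groupCoords φ g, x j = y j) : noiseSum P φ g x = noiseSum P φ g y :=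
  Finset.sum_congr rfl fun i hi => by rw [h (Sum.inr i) (mem_fibre.1 hi)]

theorem dependsOn_groupErr (φ : Fin d → Fin Γ) (g : Fin Γ) :
    DependsOn (groupErr P φ g) (groupCoords φ g) := by
  intro x y hxy
  simp only [groupErr, featSum_congr hxy, noiseSum_congr hxy]

theorem dependsOn_badInd (φ : Fin d → Fin Γ) (g : Fin Γ) :
    DependsOn (badInd P φ g) (groupCoords φ g) := by
  intro x y hxy
  have h : GroupBad P φ g x ↔ GroupBad P φ g y := by
    unfold GroupBad
    rw [noiseSum_congr hxy]
    refine or_congr_left (exists_congr fun i => and_congr_right fun hi => exists_congr fun j =>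
      and_congr_right fun hj => ?_)
    rw [hxy (Sum.inl i) (mem_fibre.1 hi), hxy (Sum.inl j) (mem_fibre.1 hj)]
  unfold badInd
  by_cases hx : GroupBad P φ g x
  · rw [if_pos hx, if_pos (h.1 hx)]
  · rw [if_neg hx, if_neg (mt h.2 hx)]

/-- Functions of different groups are independent. -/
theorem indepFun_groups (hP : P.SparseCoding) (φ : Fin d → Fin Γ)
    {F : Fin Γ → (Fin d ⊕ Fin d → ℝ) → ℝ} (hm : ∀ g, Measurable (F g))
    (hF : ∀ g, DependsOn (F g) (groupCoords φ g)) (s : Set (Fin Γ)) :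
    s.Pairwise fun g g' => IndepFun (F g) (F g') (baseLaw P d) := by
  have := hP.prob d
  intro g _ g' _ hne
  exact indepFun_of_dependsOn (hm g) (hm g') (hF g) (hF g') (disjoint_groupCoords φ hne)

theorem sum_card_sq_le {φ : Fin d → Fin Γ} (hφ : Admissible P φ) :
    ∑ g, ((fibre φ g).card : ℝ) ^ 2 ≤ P.mstar d * d := by
  have h1 : ∑ g, ((fibre φ g).card : ℝ) = d := by
    have := sum_fibre φ fun _ => (1 : ℝ)
    simpa using this
  calc ∑ g, ((fibre φ g).card : ℝ) ^ 2 ≤ ∑ g, (P.mstar d : ℝ) * (fibre φ g).card := by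
        refine Finset.sum_le_sum fun g _ => ?_
        rw [sq]
        gcongr
        exact (hφ g).2
    _ = P.mstar d * d := by rw [← Finset.mul_sum, h1]

theorem sum_density_sq_le (hR : Regime P d c C) {φ : Fin d → Fin Γ} (hφ : Admissible P φ) :
    ∑ g, groupDensity P φ g ^ 2 ≤ P.mstar d * P.k d ^ 2 / d := by
  have hd : (0 : ℝ) < d := by exact_mod_cast hR.d_pos
  have h := sum_card_sq_le hφ
  have e : ∑ g, groupDensity P φ g ^ 2 = (P.k d / d) ^ 2 * ∑ g, ((fibre φ g).card : ℝ) ^ 2 := by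
    rw [Finset.mul_sum]
    exact Finset.sum_congr rfl fun g _ => by rw [groupDensity]; ring
  rw [e]
  calc (P.k d / d) ^ 2 * ∑ g, ((fibre φ g).card : ℝ) ^ 2
      ≤ (P.k d / d) ^ 2 * (P.mstar d * d) := by gcongr
    _ = _ := by field_simp

theorem sum_density_sq_le_errOrder (hR : Regime P d c C) {φ : Fin d → Fin Γ}
    (hφ : Admissible P φ) : ∑ g, groupDensity P φ g ^ 2 ≤ errOrder P d := by
  refine (sum_density_sq_le hR hφ).trans ?_
  have hk := hR.two_le_k
  have hm : (2 : ℝ) ≤ P.mstar d := by exact_mod_cast hR.two_le_m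
  unfold errOrder
  gcongr ?_ / _
  have h1 : 1 ≤ (P.mstar d : ℝ) * P.k d := by nlinarith
  calc (P.mstar d : ℝ) * P.k d ^ 2 = (P.mstar d * P.k d ^ 2) * 1 := by ring
    _ ≤ (P.mstar d * P.k d ^ 2) * (P.mstar d * P.k d) := by gcongr
    _ = _ := by ring

theorem integral_badInd_le (hP : P.SparseCoding) (hc : 0 < c) (hR : Regime P d c C)
    {φ : Fin d → Fin Γ} (hφ : Admissible P φ) (g : Fin Γ) :
    Integrable (badInd P φ g) (baseLaw P d) ∧ ∫ ω, badInd P φ g ω ∂baseLaw P d ≤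
      (C ^ 2 * gaussMoment 0 + P.ζ ^ 8 * gaussMoment 8) * groupDensity P φ g ^ 2 := by
  have h := integral_noise_badInd_le hP hc hR φ g (hφ g).1 (hφ g).2 0
  simpa using h

/-- The constants of the moment bounds, which depend only on the noise level and the regime. -/
noncomputable def errConst (P : Model) (C : ℝ) : ℝ :=
  (C ^ 2 * gaussMoment 0 + P.ζ ^ 8 * gaussMoment 8) +
    P.ζ ^ 2 * (C ^ 2 * gaussMoment 2 + P.ζ ^ 8 * gaussMoment 10) + P.ζ ^ 2 * gaussMoment 2

theorem errConst_bounds (P : Model) (C : ℝ) :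
    0 ≤ C ^ 2 * gaussMoment 0 + P.ζ ^ 8 * gaussMoment 8 ∧
    C ^ 2 * gaussMoment 0 + P.ζ ^ 8 * gaussMoment 8 ≤ errConst P C ∧
    P.ζ ^ 2 * (C ^ 2 * gaussMoment 2 + P.ζ ^ 8 * gaussMoment 10) ≤ errConst P C ∧
    P.ζ ^ 2 * gaussMoment 2 ≤ errConst P C ∧ 0 ≤ errConst P C := by
  have h0 := gaussMoment_nonneg 0
  have h2 := gaussMoment_nonneg 2
  have h8 := gaussMoment_nonneg 8
  have h10 := gaussMoment_nonneg 10
  have a : 0 ≤ C ^ 2 * gaussMoment 0 + P.ζ ^ 8 * gaussMoment 8 := by positivity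
  have b : 0 ≤ P.ζ ^ 2 * (C ^ 2 * gaussMoment 2 + P.ζ ^ 8 * gaussMoment 10) := by positivity
  have e : 0 ≤ P.ζ ^ 2 * gaussMoment 2 := by positivity
  unfold errConst
  exact ⟨a, by linarith, by linarith, by linarith, by linarith⟩

theorem errOrder_nonneg (hR : Regime P d c C) : 0 ≤ errOrder P d := by
  have := hR.two_le_k
  unfold errOrder
  positivity

/-- Mean of the total threshold of the bad groups, and its square: a threshold is of order `1 / √k` and
a group is bad with a probability of the order of its squared density. -/
theorem integral_badThr_le (hP : P.SparseCoding) (hc : 0 < c) (hR : Regime P d c C)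
    {φ : Fin d → Fin Γ} (hφ : Admissible P φ) :
    Integrable (badThr P φ) (baseLaw P d) ∧
    ∫ ω, badThr P φ ω ∂baseLaw P d ≤ C * errConst P C * errOrder P d ∧
    (∫ ω, badThr P φ ω ∂baseLaw P d) ^ 2 ≤ (C * errConst P C) ^ 2 * errOrder P d := by
  obtain ⟨hK0, hK, -, -, hE⟩ := errConst_bounds P C
  have hC := const_nonneg hR
  have hk := hR.two_le_k
  have hm : (2 : ℝ) ≤ P.mstar d := by exact_mod_cast hR.two_le_m
  have hd : (0 : ℝ) < d := by exact_mod_cast hR.d_pos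
  have hi (g : Fin Γ) := (integral_badInd_le hP hc hR hφ g).1.const_mul (groupThr P φ g)
  have heq : badThr P φ = fun ω => ∑ g, groupThr P φ g * badInd P φ g ω := funext (badThr_eq φ)
  have hint : Integrable (badThr P φ) (baseLaw P d) := by
    rw [heq]; exact integrable_finsetSum _ fun g _ => hi g
  have hle : ∫ ω, badThr P φ ω ∂baseLaw P d ≤
      C * errConst P C * (P.mstar d * P.k d ^ 2 / √(P.k d) / d) := by
    rw [heq, integral_finsetSum _ fun g _ => hi g]
    calc ∑ g, ∫ ω, groupThr P φ g * badInd P φ g ω ∂baseLaw P d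
        ≤ ∑ g, C / √(P.k d) * (errConst P C * groupDensity P φ g ^ 2) := by
          refine Finset.sum_le_sum fun g _ => ?_
          rw [integral_const_mul]
          refine mul_le_mul (groupThr_le' hR φ g) ?_
            (integral_nonneg fun ω => badInd_nonneg φ g ω) (by positivity)
          exact (integral_badInd_le hP hc hR hφ g).2.trans (by gcongr)
      _ = C / √(P.k d) * errConst P C * ∑ g, groupDensity P φ g ^ 2 := by
          rw [Finset.mul_sum]
          exact Finset.sum_congr rfl fun g _ => by ring
      _ ≤ C / √(P.k d) * errConst P C * (P.mstar d * P.k d ^ 2 / d) := by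
          gcongr
          exact sum_density_sq_le hR hφ
      _ = _ := by ring
  have hnn : 0 ≤ ∫ ω, badThr P φ ω ∂baseLaw P d := integral_nonneg fun ω => badThr_nonneg φ ω
  have hk1 : 1 ≤ √(P.k d) := by rw [Real.one_le_sqrt]; linarith
  refine ⟨hint, hle.trans ?_, ?_⟩
  · unfold errOrder
    gcongr ?_ * (?_ / _)
    refine (div_le_self (by positivity) hk1).trans ?_
    have h1 : 1 ≤ (P.mstar d : ℝ) * P.k d := by nlinarith
    calc (P.mstar d : ℝ) * P.k d ^ 2 = (P.mstar d * P.k d ^ 2) * 1 := by ring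
      _ ≤ (P.mstar d * P.k d ^ 2) * (P.mstar d * P.k d) := by gcongr
      _ = _ := by ring
  · calc (∫ ω, badThr P φ ω ∂baseLaw P d) ^ 2
        ≤ (C * errConst P C * (P.mstar d * P.k d ^ 2 / √(P.k d) / d)) ^ 2 := by gcongr
      _ = (C * errConst P C) ^ 2 * (errOrder P d / d) := by
          rw [mul_pow, div_pow, div_pow, Real.sq_sqrt (by linarith), errOrder]
          have : P.k d ≠ 0 := by linarith
          field_simp
      _ ≤ (C * errConst P C) ^ 2 * errOrder P d := by
          have h1 : (1 : ℝ) ≤ d := by exact_mod_cast hR.d_pos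
          gcongr
          exact div_le_self (errOrder_nonneg hR) h1

/-- Second moment of the total threshold of the bad groups, by independence of the groups. -/
theorem integral_badThr_sq_le (hP : P.SparseCoding) (hc : 0 < c) (hR : Regime P d c C)
    {φ : Fin d → Fin Γ} (hφ : Admissible P φ) :
    Integrable (fun ω => badThr P φ ω ^ 2) (baseLaw P d) ∧
    ∫ ω, badThr P φ ω ^ 2 ∂baseLaw P d ≤
      (C ^ 2 * errConst P C + (C * errConst P C) ^ 2) * errOrder P d := by
  have := isProbabilityMeasure_baseLaw hP d
  obtain ⟨hK0, hK, -, -, hE⟩ := errConst_bounds P C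
  have hC := const_nonneg hR
  have hk := hR.two_le_k
  have hL (g : Fin Γ) : MemLp (fun ω => groupThr P φ g * badInd P φ g ω) 2 (baseLaw P d) := by
    refine MemLp.of_bound ((measurable_badInd φ g).const_mul _).aestronglyMeasurable
      (groupThr P φ g) (Eventually.of_forall fun ω => ?_)
    rw [Real.norm_eq_abs, abs_of_nonneg (mul_nonneg (groupThr_nonneg φ g) (badInd_nonneg φ g ω))]
    exact mul_le_of_le_one_right (groupThr_nonneg φ g) (badInd_le_one φ g ω)
  have heq : badThr P φ = fun ω => ∑ g, groupThr P φ g * badInd P φ g ω := funext (badThr_eq φ)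
  have hL2 : MemLp (badThr P φ) 2 (baseLaw P d) := by
    rw [heq]; exact memLp_finsetSum _ fun g _ => hL g
  refine ⟨hL2.integrable_sq, ?_⟩
  have h := integral_sum_sq_le Finset.univ (Q := baseLaw P d)
    (F := fun g ω => groupThr P φ g * badInd P φ g ω) (fun g _ => hL g)
    (indepFun_groups hP φ (fun g => (measurable_badInd φ g).const_mul _)
      (fun g x y hxy => by simp only [dependsOn_badInd φ g hxy]) _)
  have hmean : ∑ g, ∫ ω, groupThr P φ g * badInd P φ g ω ∂baseLaw P d =
      ∫ ω, badThr P φ ω ∂baseLaw P d := by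
    rw [heq, integral_finsetSum _ fun g _ => (integral_badInd_le hP hc hR hφ g).1.const_mul _]
  rw [hmean] at h
  simp only [← badThr_eq] at h
  have h2 := (integral_badThr_le hP hc hR hφ).2.2
  have h3 : ∑ g, ∫ ω, (groupThr P φ g * badInd P φ g ω) ^ 2 ∂baseLaw P d ≤
      C ^ 2 * errConst P C * errOrder P d := by
    calc ∑ g, ∫ ω, (groupThr P φ g * badInd P φ g ω) ^ 2 ∂baseLaw P d
        ≤ ∑ g, C ^ 2 * (errConst P C * groupDensity P φ g ^ 2) := by
          refine Finset.sum_le_sum fun g _ => ?_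
          have e (ω : Fin d ⊕ Fin d → ℝ) : (groupThr P φ g * badInd P φ g ω) ^ 2 =
              groupThr P φ g ^ 2 * badInd P φ g ω := by
            unfold badInd; split_ifs <;> ring
          simp only [e]
          rw [integral_const_mul]
          have hthr := groupThr_le_const hR φ g
          have h0 := groupThr_nonneg (P := P) φ g
          refine mul_le_mul (by gcongr) ?_ (integral_nonneg fun ω => badInd_nonneg φ g ω)
            (by positivity)
          exact (integral_badInd_le hP hc hR hφ g).2.trans (by gcongr)
      _ = C ^ 2 * errConst P C * ∑ g, groupDensity P φ g ^ 2 := by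
          rw [Finset.mul_sum]
          exact Finset.sum_congr rfl fun g _ => by ring
      _ ≤ _ := by
          gcongr
          exact sum_density_sq_le_errOrder hR hφ
  linarith

theorem noiseVar_le (hR : Regime P d c C) {φ : Fin d → Fin Γ} (g : Fin Γ) :
    noiseVar P φ g ≤ P.ζ ^ 2 * C ^ 2 * ((fibre φ g).card / d) := by
  have h := groupNorm_le hR φ g
  calc noiseVar P φ g ≤ P.ζ ^ 2 / d * (C ^ 2 * (fibre φ g).card) := by
        unfold noiseVar; gcongr
    _ = _ := by ring

theorem dependsOn_groupInd (φ : Fin d → Fin Γ) (g : Fin Γ) :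
    DependsOn (groupInd φ g) (Set.range Sum.inl) := by
  intro x y hxy
  have h : GroupActive φ g x ↔ GroupActive φ g y := by
    unfold GroupActive
    exact exists_congr fun i => and_congr_right fun _ => by rw [hxy (Sum.inl i) ⟨i, rfl⟩]
  unfold groupInd
  by_cases hx : GroupActive φ g x
  · rw [if_pos hx, if_pos (h.1 hx)]
  · rw [if_neg hx, if_neg (mt h.2 hx)]

theorem integrable_groupInd (hP : P.SparseCoding) (φ : Fin d → Fin Γ) (g : Fin Γ) :
    Integrable (groupInd φ g) (baseLaw P d) :=
  integrable_of_bounded hP (measurable_groupInd φ g) (B := 1) fun ω => by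
    rw [abs_of_nonneg (groupInd_nonneg φ g ω)]; exact groupInd_le_one φ g ω

theorem integral_groupInd_le (hP : P.SparseCoding) (hR : Regime P d c C) (φ : Fin d → Fin Γ)
    (g : Fin Γ) :
    ∫ ω, groupInd φ g ω ∂baseLaw P d ≤ (fibre φ g).card * (C * (P.k d / d)) := by
  have h2 : ∫ ω, groupInd φ g ω ∂baseLaw P d ≤
      ∫ ω, ∑ i ∈ fibre φ g, actInd i ω ∂baseLaw P d :=
    integral_mono (integrable_groupInd hP φ g)
      (integrable_finsetSum _ fun i _ => integrable_actInd hP i) fun ω => groupInd_le_sum φ g ω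
  rw [integral_finsetSum _ fun i _ => integrable_actInd hP i] at h2
  simp only [integral_actInd hP, Finset.sum_const, nsmul_eq_mul] at h2
  have := hR.prob_le
  rw [← actProb] at this
  refine h2.trans ?_
  gcongr

theorem memLp_groupErr (hP : P.SparseCoding) (φ : Fin d → Fin Γ) (g : Fin Γ) :
    MemLp (groupErr P φ g) 2 (baseLaw P d) := by
  have := isProbabilityMeasure_baseLaw hP d
  have hN : MemLp (noiseSum P φ g) 2 (baseLaw P d) := by
    rw [memLp_two_iff_integrable_sq (measurable_noiseSum φ g).aestronglyMeasurable]
    have h := (integral_noiseSum_pow hP φ g 2).1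
    simp only [sq_abs] at h
    exact h
  have hB : MemLp (fun ω => groupThr P φ g + |noiseSum P φ g ω|) 2 (baseLaw P d) :=
    (memLp_const (groupThr P φ g)).add hN.norm
  refine hB.mono' (measurable_groupErr φ g).aestronglyMeasurable
    (Eventually.of_forall fun ω => ?_)
  have h1 := abs_gate_sub_le (v := featSum P φ g ω + noiseSum P φ g ω)
    (groupThr_nonneg (P := P) φ g)
  have h2 := abs_add_le (gate (featSum P φ g ω + noiseSum P φ g ω) (groupThr P φ g) -
    (featSum P φ g ω + noiseSum P φ g ω)) (noiseSum P φ g ω)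
  have e : groupErr P φ g ω = (gate (featSum P φ g ω + noiseSum P φ g ω) (groupThr P φ g) -
    (featSum P φ g ω + noiseSum P φ g ω)) + noiseSum P φ g ω := by rw [groupErr]; ring
  rw [Real.norm_eq_abs, e]
  linarith

/-- The errors of the groups are odd functions of features and noise. -/
theorem integral_groupErr (hP : P.SparseCoding) (φ : Fin d → Fin Γ) (g : Fin Γ) :
    ∫ ω, groupErr P φ g ω ∂baseLaw P d = 0 := by
  have := hP.prob d
  refine integral_eq_zero_of_odd (hP.symm d) fun ω => ?_
  have h1 : featSum P φ g (-ω) = -featSum P φ g ω := by simp [featSum]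
  have h2 : noiseSum P φ g (-ω) = -noiseSum P φ g ω := by simp [noiseSum]
  rw [groupErr, groupErr, h1, h2, ← neg_add, gate, gate, abs_neg]
  split_ifs <;> ring

theorem groupErr_sq_le_ind (hR : Regime P d c C) (φ : Fin d → Fin Γ) (g : Fin Γ)
    {ω : Fin d ⊕ Fin d → ℝ} (hω : FeatureRange P d ω) :
    groupErr P φ g ω ^ 2 ≤ |noiseSum P φ g ω| ^ 2 * groupInd φ g ω +
      (2 * (|noiseSum P φ g ω| ^ 2 * badInd P φ g ω) +
        2 * groupThr P φ g ^ 2 * badInd P φ g ω) := by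
  refine (groupErr_sq_le hR φ g hω).trans (le_of_eq ?_)
  simp only [groupInd, badInd, sq_abs]
  split_ifs <;> ring

/-- The first term is the noise of an active group, the second one comes from bad groups. -/
theorem integral_groupErr_sq_le (hP : P.SparseCoding) (hc : 0 < c) (hR : Regime P d c C)
    {φ : Fin d → Fin Γ} (hφ : Admissible P φ) (g : Fin Γ) :
    ∫ ω, groupErr P φ g ω ^ 2 ∂baseLaw P d ≤
      C ^ 3 * errConst P C * (P.k d / d * ((fibre φ g).card / d) * (fibre φ g).card) +
        4 * (C ^ 2 * errConst P C) * groupDensity P φ g ^ 2 := by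
  obtain ⟨hK0, hK, hK2, hK3, hE⟩ := errConst_bounds P C
  have hC := const_nonneg hR
  have hk := hR.two_le_k
  have hd : (0 : ℝ) < d := by exact_mod_cast hR.d_pos
  have hg2 := gaussMoment_nonneg 2
  obtain ⟨i1, e1⟩ := integral_noiseSum_pow_mul hP φ g 2 (F := groupInd φ g) (B := 1)
    (measurable_groupInd φ g) (dependsOn_groupInd φ g)
    (fun ω => by rw [abs_of_nonneg (groupInd_nonneg φ g ω)]; exact groupInd_le_one φ g ω)
  obtain ⟨i2, e2⟩ := integral_noise_badInd_le hP hc hR φ g (hφ g).1 (hφ g).2 2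
  obtain ⟨i3, e3⟩ := integral_badInd_le hP hc hR hφ g
  have i4 : Integrable (fun ω => 2 * (|noiseSum P φ g ω| ^ 2 * badInd P φ g ω) +
      2 * groupThr P φ g ^ 2 * badInd P φ g ω) (baseLaw P d) :=
    (i2.const_mul 2).add (i3.const_mul _)
  have h1 : ∫ ω, groupErr P φ g ω ^ 2 ∂baseLaw P d ≤
      ∫ ω, (|noiseSum P φ g ω| ^ 2 * groupInd φ g ω + (2 * (|noiseSum P φ g ω| ^ 2 *
        badInd P φ g ω) + 2 * groupThr P φ g ^ 2 * badInd P φ g ω)) ∂baseLaw P d := by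
    refine integral_mono_ae (memLp_groupErr hP φ g).integrable_sq (i1.add i4) ?_
    filter_upwards [ae_featureRange hP d] with ω hω
    exact groupErr_sq_le_ind hR φ g hω
  rw [integral_add i1 i4, integral_add (i2.const_mul 2) (i3.const_mul _), integral_const_mul,
    integral_const_mul, e1, Real.sq_sqrt (noiseVar_nonneg φ g)] at h1
  rw [Real.sq_sqrt (noiseVar_nonneg φ g)] at e2
  have hv := noiseVar_le hR (φ := φ) g
  have hact := integral_groupInd_le hP hR φ g
  have hcard : ((fibre φ g).card : ℝ) / d ≤ 1 := by
    rw [div_le_one hd]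
    have h3 := Finset.card_le_univ (fibre φ g)
    rw [Fintype.card_fin] at h3
    exact_mod_cast h3
  have hthr := groupThr_le_const hR φ g
  have h0 := groupThr_nonneg (P := P) φ g
  have hact0 : 0 ≤ ∫ ω, groupInd φ g ω ∂baseLaw P d :=
    integral_nonneg fun ω => groupInd_nonneg φ g ω
  have t1 : noiseVar P φ g * gaussMoment 2 * ∫ ω, groupInd φ g ω ∂baseLaw P d ≤
      C ^ 3 * errConst P C * (P.k d / d * ((fibre φ g).card / d) * (fibre φ g).card) := by
    calc noiseVar P φ g * gaussMoment 2 * ∫ ω, groupInd φ g ω ∂baseLaw P d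
        ≤ P.ζ ^ 2 * C ^ 2 * ((fibre φ g).card / d) * gaussMoment 2 *
          ((fibre φ g).card * (C * (P.k d / d))) := by gcongr
      _ = C ^ 3 * (P.ζ ^ 2 * gaussMoment 2) *
          (P.k d / d * ((fibre φ g).card / d) * (fibre φ g).card) := by ring
      _ ≤ _ := by gcongr
  have hden : 0 ≤ groupDensity P φ g ^ 2 := sq_nonneg _
  have hG : 0 ≤ (C ^ 2 * gaussMoment 2 + P.ζ ^ 8 * gaussMoment (2 + 8)) *
      groupDensity P φ g ^ 2 := by
    have := gaussMoment_nonneg (2 + 8)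
    positivity
  have t2 : ∫ ω, |noiseSum P φ g ω| ^ 2 * badInd P φ g ω ∂baseLaw P d ≤
      C ^ 2 * errConst P C * groupDensity P φ g ^ 2 := by
    refine e2.trans ?_
    calc noiseVar P φ g * ((C ^ 2 * gaussMoment 2 + P.ζ ^ 8 * gaussMoment (2 + 8)) *
          groupDensity P φ g ^ 2)
        ≤ (P.ζ ^ 2 * C ^ 2 * 1) * ((C ^ 2 * gaussMoment 2 + P.ζ ^ 8 * gaussMoment (2 + 8)) *
          groupDensity P φ g ^ 2) := by
          gcongr
          exact hv.trans (by gcongr)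
      _ = C ^ 2 * (P.ζ ^ 2 * (C ^ 2 * gaussMoment 2 + P.ζ ^ 8 * gaussMoment 10)) *
          groupDensity P φ g ^ 2 := by norm_num; ring
      _ ≤ _ := by gcongr
  have t3 : groupThr P φ g ^ 2 * ∫ ω, badInd P φ g ω ∂baseLaw P d ≤
      C ^ 2 * errConst P C * groupDensity P φ g ^ 2 := by
    rw [mul_assoc]
    refine mul_le_mul (by gcongr) (e3.trans (by gcongr))
      (integral_nonneg fun ω => badInd_nonneg φ g ω) (by positivity)
  linarith

theorem sum_groupErr_order_le (hR : Regime P d c C) {φ : Fin d → Fin Γ} (hφ : Admissible P φ) :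
    ∑ g, P.k d / d * ((fibre φ g).card / d) * ((fibre φ g).card : ℝ) ≤ errOrder P d := by
  have hk := hR.two_le_k
  have hd : (0 : ℝ) < d := by exact_mod_cast hR.d_pos
  have hm : (2 : ℝ) ≤ P.mstar d := by exact_mod_cast hR.two_le_m
  have e : ∑ g, P.k d / d * ((fibre φ g).card / d) * ((fibre φ g).card : ℝ) =
      P.k d / d ^ 2 * ∑ g, ((fibre φ g).card : ℝ) ^ 2 := by
    rw [Finset.mul_sum]
    exact Finset.sum_congr rfl fun g _ => by field_simp
  rw [e]
  calc P.k d / d ^ 2 * ∑ g, ((fibre φ g).card : ℝ) ^ 2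
      ≤ P.k d / d ^ 2 * (P.mstar d * d) := by
        gcongr
        exact sum_card_sq_le hφ
    _ = P.mstar d * P.k d / d := by field_simp
    _ ≤ errOrder P d := by
        unfold errOrder
        gcongr ?_ / _
        have h1 : 1 ≤ (P.mstar d : ℝ) * P.k d ^ 2 := by nlinarith
        calc (P.mstar d : ℝ) * P.k d = (P.mstar d * P.k d) * 1 := by ring
          _ ≤ (P.mstar d * P.k d) * (P.mstar d * P.k d ^ 2) := by gcongr
          _ = _ := by ring

/-- The prediction of a group network has a mean squared error of the order `errOrder` about the
score: the errors of the groups are independent and centred. -/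
theorem integral_sum_groupErr_sq_le (hP : P.SparseCoding) (hc : 0 < c) (hR : Regime P d c C)
    {φ : Fin d → Fin Γ} (hφ : Admissible P φ) :
    Integrable (fun ω => (∑ g, groupErr P φ g ω) ^ 2) (baseLaw P d) ∧
    ∫ ω, (∑ g, groupErr P φ g ω) ^ 2 ∂baseLaw P d ≤
      (C ^ 3 * errConst P C + 4 * (C ^ 2 * errConst P C)) * errOrder P d := by
  have := isProbabilityMeasure_baseLaw hP d
  have hE := (errConst_bounds P C).2.2.2.2
  have hC := const_nonneg hR
  refine ⟨(memLp_finsetSum _ fun g _ => memLp_groupErr hP φ g).integrable_sq, ?_⟩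
  have h := integral_sum_sq_le Finset.univ (Q := baseLaw P d) (F := groupErr P φ)
    (fun g _ => memLp_groupErr hP φ g)
    (indepFun_groups hP φ (measurable_groupErr φ) (dependsOn_groupErr φ) _)
  simp only [integral_groupErr hP, Finset.sum_const_zero, ne_eq, OfNat.ofNat_ne_zero,
    not_false_eq_true, zero_pow, add_zero] at h
  refine h.trans ((Finset.sum_le_sum fun g _ => integral_groupErr_sq_le hP hc hR hφ g).trans ?_)
  rw [Finset.sum_add_distrib, ← Finset.mul_sum, ← Finset.mul_sum, add_mul]
  have h1 := sum_groupErr_order_le hR hφ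
  have h2 := sum_density_sq_le_errOrder hR hφ
  gcongr

theorem integral_idealGrad_sq_le (hP : P.SparseCoding) (hR : Regime P d c C)
    {φ : Fin d → Fin Γ} (hφ : Admissible P φ) :
    Integrable (fun ω => idealGrad P φ ω ^ 2) (baseLaw P d) ∧
    ∫ ω, idealGrad P φ ω ^ 2 ∂baseLaw P d ≤ C ^ 3 * (P.mstar d * P.k d) := by
  have hC := const_nonneg hR
  have hk := hR.two_le_k
  have hd : (0 : ℝ) < d := by exact_mod_cast hR.d_pos
  simp only [idealGrad_sq]
  refine ⟨integrable_finsetSum _ fun g _ => (integrable_groupInd hP φ g).const_mul _, ?_⟩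
  rw [integral_finsetSum _ fun g _ => (integrable_groupInd hP φ g).const_mul _]
  calc ∑ g, ∫ ω, groupNorm P φ g ^ 2 * groupInd φ g ω ∂baseLaw P d
      ≤ ∑ g, C ^ 3 * (P.k d / d) * ((fibre φ g).card : ℝ) ^ 2 := by
        refine Finset.sum_le_sum fun g _ => ?_
        rw [integral_const_mul]
        calc groupNorm P φ g ^ 2 * ∫ ω, groupInd φ g ω ∂baseLaw P d
            ≤ C ^ 2 * (fibre φ g).card * ((fibre φ g).card * (C * (P.k d / d))) := by
              refine mul_le_mul (groupNorm_le hR φ g) (integral_groupInd_le hP hR φ g)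
                (integral_nonneg fun ω => groupInd_nonneg φ g ω) (by positivity)
          _ = _ := by ring
    _ = C ^ 3 * (P.k d / d) * ∑ g, ((fibre φ g).card : ℝ) ^ 2 := by rw [Finset.mul_sum]
    _ ≤ C ^ 3 * (P.k d / d) * (P.mstar d * d) := by
        gcongr
        exact sum_card_sq_le hφ
    _ = _ := by field_simp

end Totals

/-! ### First-order expansion of the adversarial risk -/

section Expansion

variable {d Γ : ℕ} {P : Model} {c C : ℝ}

theorem Regime.coef_ne_zero (hc : 0 < c) (hR : Regime P d c C) (i : Fin d) : P.θ₀ d i ≠ 0 :=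
  abs_pos.1 (hc.trans_le (hR.le_coef i))

theorem nodeCount_groupNetwork (hP : P.SparseCoding) (hθ : ∀ i, P.θ₀ d i ≠ 0) (hΓ : 0 < Γ)
    (hH : Γ ≤ P.H d) (φ : Fin d → Fin Γ) (h : Fin (P.H d)) :
    P.nodeCount (groupNetwork P φ) h = (fibre φ ⟨h % Γ, Nat.mod_lt _ hΓ⟩).card := by
  rw [Model.nodeCount, nodeSupport_groupNetwork hP hθ hH φ h ⟨h % Γ, Nat.mod_lt _ hΓ⟩ rfl]

/-- An attack of at most this size keeps the open nodes of a good group open. -/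
theorem mul_groupNorm_le_groupThr (hR : Regime P d c C) {φ : Fin d → Fin Γ}
    (hφ : Admissible P φ) {ε : ℝ} (hε0 : 0 ≤ ε) (hε : ε * P.rootMK d * √(Real.log d) ≤ 1)
    (g : Fin Γ) : ε * groupNorm P φ g ≤ groupThr P φ g := by
  have hk := hR.two_le_k
  have hl := hR.one_le_log
  have hn : (1 : ℝ) ≤ (fibre φ g).card := by exact_mod_cast (hφ g).1
  have hnm : ((fibre φ g).card : ℝ) ≤ P.mstar d := by exact_mod_cast (hφ g).2
  have h0 : 0 ≤ groupNorm P φ g := Real.sqrt_nonneg _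
  have h1 : 0 < √(P.k d * (fibre φ g).card) := Real.sqrt_pos.2 (by positivity)
  have h2 : 0 < √(Real.log d) := Real.sqrt_pos.2 (by positivity)
  rw [groupThr, le_div_iff₀ h2, le_div_iff₀ h1]
  have h3 : √(P.k d * (fibre φ g).card) ≤ P.rootMK d := by
    rw [Model.rootMK, mul_comm]
    exact Real.sqrt_le_sqrt (by gcongr)
  calc ε * groupNorm P φ g * √(Real.log d) * √(P.k d * (fibre φ g).card)
      ≤ ε * groupNorm P φ g * √(Real.log d) * P.rootMK d := by gcongr
    _ = ε * P.rootMK d * √(Real.log d) * groupNorm P φ g := by ring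
    _ ≤ _ := mul_le_of_le_one_left h0 hε

theorem memLp_idealGrad (hP : P.SparseCoding) (hR : Regime P d c C) {φ : Fin d → Fin Γ}
    (hφ : Admissible P φ) : MemLp (idealGrad P φ) 2 (baseLaw P d) := by
  rw [memLp_two_iff_integrable_sq (measurable_idealGrad φ).aestronglyMeasurable]
  exact (integral_idealGrad_sq_le hP hR hφ).1

theorem measurable_score_featureVec : Measurable fun ω => P.score d (featureVec ω) :=
  continuous_score.measurable.comp measurable_featureVec

theorem integrable_attackWeight_mul (hP : P.SparseCoding) (hR : Regime P d c C) (ℓ : LossKind)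
    {φ : Fin d → Fin Γ} (hφ : Admissible P φ) :
    Integrable (fun ω => attackWeight ℓ P.s (P.score d (featureVec ω)) * idealGrad P φ ω)
      (baseLaw P d) := by
  have := isProbabilityMeasure_baseLaw hP d
  obtain ⟨W, hW0, hW⟩ := exists_attackWeight_le ℓ P.s
  refine (((memLp_idealGrad hP hR hφ).integrable (by norm_num)).const_mul W).mono'
    (((measurable_attackWeight ℓ P.s).comp measurable_score_featureVec).mul
      (measurable_idealGrad φ)).aestronglyMeasurable (Eventually.of_forall fun ω => ?_)
  rw [Real.norm_eq_abs, abs_of_nonneg (mul_nonneg (attackWeight_nonneg ℓ P.s _)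
    (idealGrad_nonneg φ ω))]
  exact mul_le_mul_of_nonneg_right (hW _) (idealGrad_nonneg φ ω)

/-- The mean cost of an attack on a group network, per unit of attack size. -/
noncomputable def attackCost (P : Model) (ℓ : LossKind) (φ : Fin d → Fin Γ) : ℝ :=
  ∫ ω, attackWeight ℓ P.s (P.score d (featureVec ω)) * idealGrad P φ ω ∂baseLaw P d

theorem sq_integral_le {Ω : Type*} [MeasurableSpace Ω] {Q : Measure Ω} [IsProbabilityMeasure Q]
    {F : Ω → ℝ} (hF : MemLp F 2 Q) : (∫ ω, F ω ∂Q) ^ 2 ≤ ∫ ω, F ω ^ 2 ∂Q := by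
  have h := variance_nonneg F Q
  rw [variance_eq_sub hF] at h
  simpa using h

/-- The mean gradient norm is at most of order `√(m* k)`. -/
theorem attackCost_le (hP : P.SparseCoding) (hR : Regime P d c C) (ℓ : LossKind) {W : ℝ}
    (hW0 : 0 ≤ W) (hW : ∀ t, attackWeight ℓ P.s t ≤ W) {φ : Fin d → Fin Γ}
    (hφ : Admissible P φ) : attackCost P ℓ φ ≤ W * (√(C ^ 3) * P.rootMK d) := by
  have := isProbabilityMeasure_baseLaw hP d
  have hL := memLp_idealGrad hP hR hφ
  have hi := hL.integrable (by norm_num)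
  have hC := const_nonneg hR
  calc attackCost P ℓ φ ≤ ∫ ω, W * idealGrad P φ ω ∂baseLaw P d :=
        integral_mono (integrable_attackWeight_mul hP hR ℓ hφ) (hi.const_mul W)
          fun ω => mul_le_mul_of_nonneg_right (hW _) (idealGrad_nonneg φ ω)
    _ = W * ∫ ω, idealGrad P φ ω ∂baseLaw P d := integral_const_mul _ _
    _ ≤ W * (√(C ^ 3) * P.rootMK d) := by
        gcongr
        rw [Model.rootMK, ← Real.sqrt_mul (by positivity)]
        exact Real.le_sqrt_of_sq_le ((sq_integral_le hL).trans (integral_idealGrad_sq_le hP hR hφ).2)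

/-- To first order in the size of the attack, the risk of a group network exceeds the risk of the
true score by the cost of the attack on an ideally gated network. -/
theorem exists_abs_risk_sub_le (hP : P.SparseCoding) (ℓ : LossKind) (hc : 0 < c) :
    ∃ K, 0 < K ∧ ∀ (d Γ : ℕ) (φ : Fin d → Fin Γ) (ε : ℝ), Regime P d c C → 0 < Γ → Γ ≤ P.H d →
      Admissible P φ → 0 ≤ ε → ε * P.rootMK d * √(Real.log d) ≤ 1 →
      |P.risk ℓ ε (groupNetwork P φ) - P.oracleRisk ℓ d - ε * attackCost P ℓ φ| ≤
        K * (errOrder P d + ε ^ 2 * (P.mstar d * P.k d)) := by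
  obtain ⟨A, hA0, hA⟩ := exists_respAvg_attack ℓ hP.response_noise
  refine ⟨A * (|C ^ 3 * errConst P C + 4 * (C ^ 2 * errConst P C)| + |C ^ 3| +
    2 * |C * errConst P C| + 4 * |C ^ 2 * errConst P C + (C * errConst P C) ^ 2| + 1),
    by positivity, ?_⟩
  intro d Γ φ ε hR hΓ hH hφ hε0 hε
  have := isProbabilityMeasure_baseLaw hP d
  have hθ := hR.coef_ne_zero hc
  have hcount (h : Fin (P.H d)) : 1 ≤ P.nodeCount (groupNetwork P φ) h := by
    rw [nodeCount_groupNetwork hP hθ hΓ hH]; exact (hφ _).1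
  obtain ⟨i1, e1⟩ := risk_eq hP hR.d_pos hcount ℓ ε
  obtain ⟨i2, e2⟩ := oracleRisk_eq hP ℓ d
  have i3 := (integrable_attackWeight_mul hP hR ℓ hφ).const_mul ε
  obtain ⟨j1, b1⟩ := integral_sum_groupErr_sq_le hP hc hR hφ
  obtain ⟨j2, b2⟩ := integral_idealGrad_sq_le hP hR hφ
  obtain ⟨j3, b3, -⟩ := integral_badThr_le hP hc hR hφ
  obtain ⟨j4, b4⟩ := integral_badThr_sq_le hP hc hR hφ
  have hpt : ∀ᵐ ω ∂baseLaw P d,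
      |(respAvg ℓ P.s (P.score d (featureVec ω)) (stepLoss ℓ ε (groupNetwork P φ) (inputVec P d ω)) -
        respAvg ℓ P.s (P.score d (featureVec ω)) (ℓ.loss (P.score d (featureVec ω)))) -
        ε * (attackWeight ℓ P.s (P.score d (featureVec ω)) * idealGrad P φ ω)| ≤
      A * (((∑ g, groupErr P φ g ω) ^ 2 + ε ^ 2 * idealGrad P φ ω ^ 2) +
        (2 * badThr P φ ω + 4 * badThr P φ ω ^ 2)) := by
    filter_upwards [ae_featureRange hP d] with ω hω
    have hstep (t : ℝ) (ht : |t| ≤ ε) := abs_predict_step_sub_le hP hc hR hΓ hH φ hω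
      (fun g => mul_groupNorm_le_groupThr hR hφ hε0 hε g) ht
    have hb := badThr_nonneg (P := P) φ ω
    have h := hA (P.score d (featureVec ω)) ((groupNetwork P φ).predict (inputVec P d ω))
      (ε * idealGrad P φ ω) (2 * badThr P φ ω)
      (fun τ => (groupNetwork P φ).predict
        (inputVec P d ω + (ε * τ) • (groupNetwork P φ).dir (inputVec P d ω)))
      (mul_nonneg hε0 (idealGrad_nonneg φ ω)) (by positivity) (by simp)
      (by simpa using hstep ε (abs_of_nonneg hε0).le)
      (by
        have h1 := hstep (-ε) (by rw [abs_neg, abs_of_nonneg hε0])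
        simpa [sub_eq_add_neg] using h1)
    rw [predict_groupNetwork_sub_score hP hθ hΓ hH φ ω] at h
    have e : attackWeight ℓ P.s (P.score d (featureVec ω)) * (ε * idealGrad P φ ω) =
      ε * (attackWeight ℓ P.s (P.score d (featureVec ω)) * idealGrad P φ ω) := by ring
    rw [e] at h
    refine h.trans (le_of_eq ?_)
    ring
  have jA : Integrable (fun ω => (∑ g, groupErr P φ g ω) ^ 2 + ε ^ 2 * idealGrad P φ ω ^ 2)
    (baseLaw P d) := j1.add (j2.const_mul _)
  have jB : Integrable (fun ω => 2 * badThr P φ ω + 4 * badThr P φ ω ^ 2) (baseLaw P d) :=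
    (j3.const_mul 2).add (j4.const_mul 4)
  have hmain := abs_integral_sub_integral_le (i1.sub i2).aestronglyMeasurable i3
    ((jA.add jB).const_mul A) hpt
  simp only [Pi.sub_apply] at hmain
  rw [integral_sub i1 i2, ← e1, ← e2, integral_const_mul] at hmain
  refine hmain.trans ?_
  simp only [Pi.add_apply]
  rw [integral_const_mul, integral_add jA jB, integral_add j1 (j2.const_mul _),
    integral_add (j3.const_mul 2) (j4.const_mul 4), integral_const_mul, integral_const_mul,
    integral_const_mul, mul_assoc]
  refine mul_le_mul_of_nonneg_left ?_ hA0.le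
  have hO := errOrder_nonneg hR
  have hX : 0 ≤ (P.mstar d : ℝ) * P.k d := by
    have := hR.two_le_k
    positivity
  have hY : 0 ≤ ε ^ 2 * ((P.mstar d : ℝ) * P.k d) := by positivity
  have t1 := b1.trans (mul_le_mul_of_nonneg_right (le_abs_self _) hO)
  have t2 : ε ^ 2 * ∫ ω, idealGrad P φ ω ^ 2 ∂baseLaw P d ≤
      |C ^ 3| * (ε ^ 2 * ((P.mstar d : ℝ) * P.k d)) := by
    calc ε ^ 2 * ∫ ω, idealGrad P φ ω ^ 2 ∂baseLaw P d
        ≤ ε ^ 2 * (|C ^ 3| * (P.mstar d * P.k d)) := by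
          gcongr
          exact b2.trans (mul_le_mul_of_nonneg_right (le_abs_self _) hX)
      _ = _ := by ring
  have t3 := b3.trans (mul_le_mul_of_nonneg_right (le_abs_self _) hO)
  have t4 := b4.trans (mul_le_mul_of_nonneg_right (le_abs_self _) hO)
  have p0 := mul_nonneg (abs_nonneg (C ^ 3 * errConst P C + 4 * (C ^ 2 * errConst P C))) hY
  have p1 := mul_nonneg (abs_nonneg (C ^ 3)) hO
  have p2 := mul_nonneg (abs_nonneg (C * errConst P C)) hY
  have p3 := mul_nonneg (abs_nonneg (C ^ 2 * errConst P C + (C * errConst P C) ^ 2)) hY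
  linarith

end Expansion

/-! ### The gap between the attack costs -/

section Gap

variable {d Γ : ℕ} {P : Model} {c C : ℝ}

theorem indepFun_baseLaw (hP : P.SparseCoding) {F G : (Fin d ⊕ Fin d → ℝ) → ℝ}
    (hF : Measurable F) (hG : Measurable G) {s t : Set (Fin d ⊕ Fin d)} (hs : DependsOn F s)
    (ht : DependsOn G t) (hst : Disjoint s t) : IndepFun F G (baseLaw P d) := by
  have := hP.prob d
  exact indepFun_of_dependsOn hF hG hs ht hst

theorem memLp_actInd (hP : P.SparseCoding) (i : Fin d) : MemLp (actInd i) 2 (baseLaw P d) := by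
  have := isProbabilityMeasure_baseLaw hP d
  exact MemLp.of_bound (measurable_actInd i).aestronglyMeasurable 1
    (Eventually.of_forall fun ω => by
      rw [Real.norm_eq_abs, abs_of_nonneg (actInd_nonneg i ω)]; exact actInd_le_one i ω)

theorem integral_sum_actInd_sq_le (hP : P.SparseCoding) (s : Finset (Fin d)) :
    Integrable (fun ω => (∑ i ∈ s, actInd i ω) ^ 2) (baseLaw P d) ∧
    ∫ ω, (∑ i ∈ s, actInd i ω) ^ 2 ∂baseLaw P d ≤
      s.card * actProb P d + (s.card * actProb P d) ^ 2 := by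
  have := isProbabilityMeasure_baseLaw hP d
  refine ⟨(memLp_finsetSum _ fun i _ => memLp_actInd hP i).integrable_sq, ?_⟩
  have h := integral_sum_sq_le s (Q := baseLaw P d) (F := fun i => actInd i)
    (fun i _ => memLp_actInd hP i) fun i _ j _ hij => indepFun_baseLaw hP (measurable_actInd i)
      (measurable_actInd j) (dependsOn_actInd i) (dependsOn_actInd j) (by simpa using hij)
  have e (i : Fin d) (ω : Fin d ⊕ Fin d → ℝ) : actInd i ω ^ 2 = actInd i ω := by
    unfold actInd; split_ifs <;> norm_num
  simpa only [e, integral_actInd hP, Finset.sum_const, nsmul_eq_mul] using h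

/-- An inclusion–exclusion bound for the probability that a group is active. -/
theorem le_integral_groupInd (hP : P.SparseCoding) (φ : Fin d → Fin Γ) (g : Fin Γ) :
    (fibre φ g).card * actProb P d - ((fibre φ g).card * actProb P d) ^ 2 ≤
      ∫ ω, groupInd φ g ω ∂baseLaw P d := by
  obtain ⟨i1, h1⟩ := integral_sum_actInd_sq_le hP (fibre φ g)
  have i2 : Integrable (fun ω => ∑ i ∈ fibre φ g, actInd i ω) (baseLaw P d) :=
    integrable_finsetSum _ fun i _ => integrable_actInd hP i
  have h2 : ∫ ω, (2 * ∑ i ∈ fibre φ g, actInd i ω - (∑ i ∈ fibre φ g, actInd i ω) ^ 2)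
      ∂baseLaw P d ≤ ∫ ω, groupInd φ g ω ∂baseLaw P d := by
    refine integral_mono ((i2.const_mul 2).sub i1) (integrable_groupInd hP φ g) fun ω => ?_
    change 2 * ∑ i ∈ fibre φ g, actInd i ω - (∑ i ∈ fibre φ g, actInd i ω) ^ 2 ≤ groupInd φ g ω
    by_cases h : GroupActive φ g ω
    · rw [groupInd, if_pos h]
      nlinarith [sq_nonneg (∑ i ∈ fibre φ g, actInd i ω - 1)]
    · have h0 : ∑ i ∈ fibre φ g, actInd i ω = 0 := by
        refine Finset.sum_eq_zero fun i hi => ?_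
        have : ω (Sum.inl i) = 0 := by
          by_contra hne
          exact h ⟨i, hi, hne⟩
        simp [actInd, this]
      rw [groupInd, if_neg h, h0]
      norm_num
  rw [integral_sub (i2.const_mul 2) i1, integral_const_mul,
    integral_finsetSum _ fun i _ => integrable_actInd hP i] at h2
  simp only [integral_actInd hP, Finset.sum_const, nsmul_eq_mul] at h2
  linarith

/-- The number of inactive features whose group is active. -/
noncomputable def surplus (φ : Fin d → Fin Γ) (ω : Fin d ⊕ Fin d → ℝ) : ℝ :=
  ∑ i, (groupInd φ (φ i) ω - actInd i ω)

/-- The number of features whose group is active. -/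
noncomputable def covered (φ : Fin d → Fin Γ) (ω : Fin d ⊕ Fin d → ℝ) : ℝ :=
  ∑ i, groupInd φ (φ i) ω

theorem actInd_le_groupInd (φ : Fin d → Fin Γ) (i : Fin d) (ω : Fin d ⊕ Fin d → ℝ) :
    actInd i ω ≤ groupInd φ (φ i) ω := by
  by_cases h : ω (Sum.inl i) = 0
  · rw [actInd, if_pos h]; exact groupInd_nonneg φ _ ω
  · rw [actInd, if_neg h, groupInd, if_pos ⟨i, mem_fibre.2 rfl, h⟩]

theorem groupInd_id (i : Fin d) (ω : Fin d ⊕ Fin d → ℝ) : groupInd id i ω = actInd i ω := by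
  refine le_antisymm ?_ (actInd_le_groupInd id i ω)
  have h := groupInd_le_sum id i ω
  have e : fibre (id : Fin d → Fin d) i = {i} := by ext j; simp [mem_fibre]
  rwa [e, Finset.sum_singleton] at h

theorem surplus_nonneg (φ : Fin d → Fin Γ) (ω : Fin d ⊕ Fin d → ℝ) : 0 ≤ surplus φ ω :=
  Finset.sum_nonneg fun i _ => sub_nonneg.2 (actInd_le_groupInd φ i ω)

theorem surplus_le_covered (φ : Fin d → Fin Γ) (ω : Fin d ⊕ Fin d → ℝ) :
    surplus φ ω ≤ covered φ ω :=
  Finset.sum_le_sum fun i _ => sub_le_self _ (actInd_nonneg i ω)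

theorem covered_nonneg (φ : Fin d → Fin Γ) (ω : Fin d ⊕ Fin d → ℝ) : 0 ≤ covered φ ω :=
  Finset.sum_nonneg fun _ _ => groupInd_nonneg φ _ ω

theorem covered_le_mul {φ : Fin d → Fin Γ} (hφ : Admissible P φ) (ω : Fin d ⊕ Fin d → ℝ) :
    covered φ ω ≤ P.mstar d * ∑ j, actInd j ω := by
  calc covered φ ω ≤ ∑ i, ∑ j ∈ fibre φ (φ i), actInd j ω :=
        Finset.sum_le_sum fun i _ => groupInd_le_sum φ (φ i) ω
    _ = ∑ g, ∑ i ∈ fibre φ g, ∑ j ∈ fibre φ (φ i), actInd j ω := (sum_fibre φ _).symm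
    _ = ∑ g, (fibre φ g).card * ∑ j ∈ fibre φ g, actInd j ω := by
        refine Finset.sum_congr rfl fun g _ => ?_
        rw [← nsmul_eq_mul, ← Finset.sum_const]
        exact Finset.sum_congr rfl fun i hi => by rw [mem_fibre.1 hi]
    _ ≤ ∑ g, (P.mstar d : ℝ) * ∑ j ∈ fibre φ g, actInd j ω := by
        refine Finset.sum_le_sum fun g _ => ?_
        have h1 : ((fibre φ g).card : ℝ) ≤ P.mstar d := by exact_mod_cast (hφ g).2
        have h2 : 0 ≤ ∑ j ∈ fibre φ g, actInd j ω := Finset.sum_nonneg fun j _ => actInd_nonneg j ω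
        gcongr
    _ = _ := by rw [← Finset.mul_sum, sum_fibre]

theorem measurable_surplus (φ : Fin d → Fin Γ) : Measurable (surplus φ) :=
  Finset.measurable_sum _ fun i _ => (measurable_groupInd φ _).sub (measurable_actInd i)

theorem measurable_covered (φ : Fin d → Fin Γ) : Measurable (covered φ) :=
  Finset.measurable_sum _ fun _ _ => measurable_groupInd φ _

theorem covered_le_card (φ : Fin d → Fin Γ) (ω : Fin d ⊕ Fin d → ℝ) : covered φ ω ≤ d := by
  calc covered φ ω ≤ ∑ _i : Fin d, (1 : ℝ) := Finset.sum_le_sum fun _ _ => groupInd_le_one φ _ ω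
    _ = d := by simp

theorem idealGrad_sq_eq_sum (φ : Fin d → Fin Γ) (ω : Fin d ⊕ Fin d → ℝ) :
    idealGrad P φ ω ^ 2 = ∑ i, P.θ₀ d i ^ 2 * groupInd φ (φ i) ω := by
  rw [idealGrad_sq, ← sum_fibre φ]
  refine Finset.sum_congr rfl fun g _ => ?_
  rw [groupNorm_sq, Finset.sum_mul]
  exact Finset.sum_congr rfl fun i hi => by rw [mem_fibre.1 hi]

/-- The gradient of a group network exceeds the gradient of the network which learns the features
separately, in proportion to the surplus. -/
theorem surplus_le_mul_sub (hc : 0 < c) (hR : Regime P d c C) (φ : Fin d → Fin Γ)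
    (ω : Fin d ⊕ Fin d → ℝ) :
    idealGrad P id ω ≤ idealGrad P φ ω ∧
    c ^ 2 * surplus φ ω ≤
      (idealGrad P φ ω - idealGrad P id ω) * (2 * C * √(covered φ ω)) := by
  have hC := const_nonneg hR
  have h1 : idealGrad P φ ω ^ 2 - idealGrad P id ω ^ 2 =
      ∑ i, P.θ₀ d i ^ 2 * (groupInd φ (φ i) ω - actInd i ω) := by
    rw [idealGrad_sq_eq_sum, idealGrad_sq_eq_sum, ← Finset.sum_sub_distrib]
    refine Finset.sum_congr rfl fun i _ => ?_
    rw [id, groupInd_id]; ring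
  have h2 : c ^ 2 * surplus φ ω ≤ idealGrad P φ ω ^ 2 - idealGrad P id ω ^ 2 := by
    rw [h1, surplus, Finset.mul_sum]
    refine Finset.sum_le_sum fun i _ => ?_
    have h3 := sub_nonneg.2 (actInd_le_groupInd φ i ω)
    have h4 : c ^ 2 ≤ P.θ₀ d i ^ 2 := by
      rw [← sq_abs (P.θ₀ d i)]
      have := hR.le_coef i
      gcongr
    gcongr
  have hS := surplus_nonneg φ ω
  have hle : idealGrad P id ω ≤ idealGrad P φ ω := by
    refine (sq_le_sq₀ (idealGrad_nonneg _ ω) (idealGrad_nonneg _ ω)).1 ?_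
    have : 0 ≤ c ^ 2 * surplus φ ω := by positivity
    linarith
  have hG : idealGrad P φ ω ≤ C * √(covered φ ω) := by
    rw [← Real.sqrt_sq hC, ← Real.sqrt_mul (sq_nonneg C)]
    refine Real.le_sqrt_of_sq_le ?_
    rw [idealGrad_sq_eq_sum, covered, Finset.mul_sum]
    refine Finset.sum_le_sum fun i _ => ?_
    have h4 : P.θ₀ d i ^ 2 ≤ C ^ 2 := by
      rw [← sq_abs (P.θ₀ d i)]
      have := hR.coef_le i
      gcongr
    have := groupInd_nonneg φ (φ i) ω
    gcongr
  refine ⟨hle, h2.trans ?_⟩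
  calc idealGrad P φ ω ^ 2 - idealGrad P id ω ^ 2
      = (idealGrad P φ ω - idealGrad P id ω) * (idealGrad P φ ω + idealGrad P id ω) := by ring
    _ ≤ _ := by
        refine mul_le_mul_of_nonneg_left ?_ (sub_nonneg.2 hle)
        linarith

/-- A truncated form of the gap between the two gradients: a product `q (1 - t²/K² - n/λ)` is
positive only if `|t| ≤ K` and `n ≤ λ`. -/
theorem weighted_gap_ge {w δ q t n K L w₀ c C : ℝ} (hK : 0 < K) (hL : 0 < L) (hC : 0 < C)
    (hw : 0 ≤ w) (hδ : 0 ≤ δ) (hq : 0 ≤ q) (hn : 0 ≤ n) (hw0 : 0 ≤ w₀) (hwt : |t| ≤ K → w₀ ≤ w)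
    (h : c ^ 2 * q ≤ δ * (2 * C * √n)) :
    w₀ * c ^ 2 / (2 * C * √L) * (q - q * t ^ 2 / K ^ 2 - q * n / L) ≤ w * δ := by
  have hsL : 0 < √L := Real.sqrt_pos.2 hL
  have e : q - q * t ^ 2 / K ^ 2 - q * n / L = q * (1 - t ^ 2 / K ^ 2 - n / L) := by ring
  rw [e]
  have a1 : 0 ≤ t ^ 2 / K ^ 2 := by positivity
  have a2 : 0 ≤ n / L := by positivity
  by_cases hpos : 0 ≤ 1 - t ^ 2 / K ^ 2 - n / L
  · have ht : |t| ≤ K := by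
      have : t ^ 2 / K ^ 2 ≤ 1 := by linarith
      rw [div_le_one (by positivity)] at this
      exact abs_le_of_sq_le_sq this hK.le
    have hnL : n ≤ L := by
      have : n / L ≤ 1 := by linarith
      rwa [div_le_one hL] at this
    have hδq : c ^ 2 * q / (2 * C * √L) ≤ δ := by
      rw [div_le_iff₀ (by positivity)]
      refine h.trans ?_
      gcongr
    calc w₀ * c ^ 2 / (2 * C * √L) * (q * (1 - t ^ 2 / K ^ 2 - n / L))
        ≤ w₀ * c ^ 2 / (2 * C * √L) * (q * 1) := by
          gcongr
          linarith
      _ = w₀ * (c ^ 2 * q / (2 * C * √L)) := by ring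
      _ ≤ w * δ := mul_le_mul (hwt ht) hδq (by positivity) hw
  · refine le_trans (mul_nonpos_of_nonneg_of_nonpos (by positivity) ?_) (mul_nonneg hw hδ)
    exact mul_nonpos_of_nonneg_of_nonpos hq (not_le.1 hpos).le

theorem mul_actProb_le (hR : Regime P d c C) : P.mstar d * actProb P d ≤ 1 / 4 := by
  have hd : (0 : ℝ) < d := by exact_mod_cast hR.d_pos
  have hl := hR.one_le_log
  have h1 := hR.prob_le
  rw [← actProb] at h1
  have h2 := hR.log_large'
  have h3 := hR.sparse
  have hk := hR.two_le_k
  have hm : (0 : ℝ) ≤ P.mstar d := Nat.cast_nonneg _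
  have h4 : P.mstar d * actProb P d ≤ P.mstar d * (C * (P.k d / d)) := by gcongr
  refine h4.trans ?_
  have e : P.mstar d * (C * (P.k d / d)) = (P.mstar d * P.k d * C) / d := by ring
  rw [e, div_le_iff₀ hd]
  have h5 : P.mstar d * P.k d * (4 * C) ≤ P.mstar d * P.k d * Real.log d ^ 2 := by gcongr
  linarith

theorem integral_surplus (hP : P.SparseCoding) (φ : Fin d → Fin Γ) :
    ∫ ω, surplus φ ω ∂baseLaw P d =
      ∑ g, ((fibre φ g).card * ∫ ω, groupInd φ g ω ∂baseLaw P d -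
        (fibre φ g).card * actProb P d) := by
  unfold surplus
  have hi (i : Fin d) : Integrable (fun ω => groupInd φ (φ i) ω - actInd i ω) (baseLaw P d) :=
    (integrable_groupInd hP φ _).sub (integrable_actInd hP i)
  rw [integral_finsetSum _ fun i _ => hi i, ← sum_fibre φ]
  refine Finset.sum_congr rfl fun g _ => ?_
  rw [← mul_sub, ← nsmul_eq_mul, ← Finset.sum_const]
  refine Finset.sum_congr rfl fun i hi => ?_
  rw [integral_sub (integrable_groupInd hP φ _) (integrable_actInd hP i), integral_actInd hP,
    mem_fibre.1 hi]

/-- If the groups of the maximal size contain half of the features, the mean surplus is of order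
`m* k`: an active feature of such a group is accompanied by `m* - 1` mostly inactive ones. -/
theorem le_integral_surplus (hP : P.SparseCoding) (hR : Regime P d c C)
    {φ : Fin d → Fin Γ} (hφ : Admissible P φ)
    (hfull : (d : ℝ) ≤ 2 * P.mstar d *
      (Finset.univ.filter fun g => (fibre φ g).card = P.mstar d).card) :
    c / 8 * (P.mstar d * P.k d) ≤ ∫ ω, surplus φ ω ∂baseLaw P d := by
  have hm : (2 : ℝ) ≤ P.mstar d := by exact_mod_cast hR.two_le_m
  have hd : (0 : ℝ) < d := by exact_mod_cast hR.d_pos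
  have hmp := mul_actProb_le hR
  have hp := actProb_nonneg (P := P) (d := d)
  have hp1 := hR.le_prob
  rw [← actProb] at hp1
  rw [integral_surplus hP]
  have hg0 (g : Fin Γ) : 0 ≤ (fibre φ g).card * ∫ ω, groupInd φ g ω ∂baseLaw P d -
      (fibre φ g).card * actProb P d := by
    obtain ⟨i, hi⟩ := Finset.card_pos.1 (hφ g).1
    have : actProb P d ≤ ∫ ω, groupInd φ g ω ∂baseLaw P d := by
      rw [← integral_actInd hP i]
      refine integral_mono (integrable_actInd hP i) (integrable_groupInd hP φ g) fun ω => ?_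
      rw [← mem_fibre.1 hi]
      exact actInd_le_groupInd φ i ω
    rw [← mul_sub]
    exact mul_nonneg (Nat.cast_nonneg _) (sub_nonneg.2 this)
  calc c / 8 * (P.mstar d * P.k d) = (c * (P.k d / d)) * (P.mstar d * d / 8) := by
        field_simp
    _ ≤ actProb P d * (P.mstar d * (2 * P.mstar d *
        (Finset.univ.filter fun g => (fibre φ g).card = P.mstar d).card) / 8) := by gcongr
    _ = ∑ g with (fibre φ g).card = P.mstar d, P.mstar d ^ 2 * actProb P d / 4 := by
        rw [Finset.sum_const, nsmul_eq_mul]; ring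
    _ ≤ ∑ g with (fibre φ g).card = P.mstar d,
        ((fibre φ g).card * ∫ ω, groupInd φ g ω ∂baseLaw P d -
          (fibre φ g).card * actProb P d) := by
        refine Finset.sum_le_sum fun g hg => ?_
        have hcard := (Finset.mem_filter.1 hg).2
        have h := le_integral_groupInd hP φ g
        rw [hcard] at h ⊢
        have h1 : (P.mstar d : ℝ) * (P.mstar d * actProb P d - (P.mstar d * actProb P d) ^ 2) ≤
            P.mstar d * ∫ ω, groupInd φ g ω ∂baseLaw P d := by gcongr
        have h2 : (P.mstar d : ℝ) * (P.mstar d * actProb P d) * (P.mstar d * actProb P d) ≤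
            P.mstar d * (P.mstar d * actProb P d) * (1 / 4) := by gcongr
        have h3 : 2 * (P.mstar d * actProb P d) ≤ P.mstar d * (P.mstar d * actProb P d) := by
          gcongr
        nlinarith
    _ ≤ _ := Finset.sum_le_univ_sum_of_nonneg hg0

theorem memLp_coord (hP : P.SparseCoding) (i : Fin d) :
    MemLp (fun ω : Fin d ⊕ Fin d → ℝ => P.θ₀ d i * ω (Sum.inl i)) 2 (baseLaw P d) := by
  have := hP.prob d
  have := isProbabilityMeasure_baseLaw hP d
  refine MemLp.const_mul ?_ _
  have h : ∀ᵐ ω ∂baseLaw P d, |ω (Sum.inl i)| ≤ 1 :=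
    (measurePreserving_inl (μ := P.coordLaw d)
      (v := (P.ζ ^ 2 / (d : ℝ)).toNNReal) i).quasiMeasurePreserving.ae (coordLaw_abs_le_one hP d)
  exact MemLp.of_bound (measurable_pi_apply _).aestronglyMeasurable 1 h

theorem integral_coord_sq_le (hP : P.SparseCoding) (hR : Regime P d c C) (i : Fin d) :
    ∫ ω, (P.θ₀ d i * ω (Sum.inl i)) ^ 2 ∂baseLaw P d ≤ C ^ 3 / d := by
  have hC := const_nonneg hR
  simp only [mul_pow]
  rw [integral_const_mul, integral_inl hP i (f := fun x => x ^ 2) (by fun_prop)]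
  have h4 : P.θ₀ d i ^ 2 ≤ C ^ 2 := by
    rw [← sq_abs (P.θ₀ d i)]
    have := hR.coef_le i
    gcongr
  calc P.θ₀ d i ^ 2 * ∫ x, x ^ 2 ∂P.coordLaw d ≤ C ^ 2 * (C / d) :=
        mul_le_mul h4 hR.moment_le (integral_nonneg fun x => sq_nonneg x) (by positivity)
    _ = _ := by ring

theorem integral_partial_score_sq_le (hP : P.SparseCoding) (hR : Regime P d c C)
    (s : Finset (Fin d)) :
    ∫ ω, (∑ i ∈ s, P.θ₀ d i * ω (Sum.inl i)) ^ 2 ∂baseLaw P d ≤ C ^ 3 := by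
  have := hP.prob d
  have := isProbabilityMeasure_baseLaw hP d
  have hC := const_nonneg hR
  have hd : (0 : ℝ) < d := by exact_mod_cast hR.d_pos
  have hdep (i : Fin d) : DependsOn (fun ω : Fin d ⊕ Fin d → ℝ => P.θ₀ d i * ω (Sum.inl i))
      {Sum.inl i} := fun x y hxy => by simp only [hxy (Sum.inl i) rfl]
  have h := integral_sum_sq_le s (Q := baseLaw P d)
    (F := fun i ω => P.θ₀ d i * ω (Sum.inl i)) (fun i _ => memLp_coord hP i)
    fun i _ j _ hij => indepFun_baseLaw hP (by fun_prop) (by fun_prop) (hdep i) (hdep j)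
      (by simpa using hij)
  have hmean (i : Fin d) : ∫ ω, P.θ₀ d i * ω (Sum.inl i) ∂baseLaw P d = 0 :=
    integral_eq_zero_of_odd (hP.symm d) fun ω => by simp
  simp only [hmean, Finset.sum_const_zero, ne_eq, OfNat.ofNat_ne_zero, not_false_eq_true,
    zero_pow, add_zero] at h
  refine h.trans ((Finset.sum_le_sum fun i _ => integral_coord_sq_le hP hR i).trans ?_)
  rw [Finset.sum_const, nsmul_eq_mul]
  have hs : (s.card : ℝ) ≤ d := by
    have := Finset.card_le_univ s
    rw [Fintype.card_fin] at this
    exact_mod_cast this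
  calc (s.card : ℝ) * (C ^ 3 / d) ≤ d * (C ^ 3 / d) := by gcongr
    _ = _ := by field_simp

theorem score_featureVec (ω : Fin d ⊕ Fin d → ℝ) :
    P.score d (featureVec ω) = ∑ i, P.θ₀ d i * ω (Sum.inl i) := rfl

theorem memLp_score (hP : P.SparseCoding) :
    MemLp (fun ω => P.score d (featureVec ω)) 2 (baseLaw P d) := by
  simp only [score_featureVec]
  exact memLp_finsetSum _ fun i _ => memLp_coord hP i

/-- The number of active features times the squared score has a mean of order `k`. -/
theorem integral_sum_actInd_mul_score_sq_le (hP : P.SparseCoding) (hR : Regime P d c C) :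
    Integrable (fun ω => (∑ j, actInd j ω) * P.score d (featureVec ω) ^ 2) (baseLaw P d) ∧
    ∫ ω, (∑ j, actInd j ω) * P.score d (featureVec ω) ^ 2 ∂baseLaw P d ≤
      (C ^ 3 + 2 * C ^ 4) * P.k d := by
  have := hP.prob d
  have := isProbabilityMeasure_baseLaw hP d
  have hC := const_nonneg hR
  have hk := hR.two_le_k
  have hd : (0 : ℝ) < d := by exact_mod_cast hR.d_pos
  have hp := hR.prob_le
  rw [← actProb] at hp
  have hi (j : Fin d) {F : (Fin d ⊕ Fin d → ℝ) → ℝ} (hF : MemLp F 2 (baseLaw P d)) :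
      Integrable (fun ω => actInd j ω * F ω ^ 2) (baseLaw P d) := by
    refine hF.integrable_sq.mono'
      ((measurable_actInd j).aestronglyMeasurable.mul hF.integrable_sq.aestronglyMeasurable)
      (Eventually.of_forall fun ω => ?_)
    rw [Real.norm_eq_abs, abs_of_nonneg (mul_nonneg (actInd_nonneg j ω) (sq_nonneg _))]
    exact mul_le_of_le_one_left (sq_nonneg _) (actInd_le_one j ω)
  simp only [Finset.sum_mul]
  refine ⟨integrable_finsetSum _ fun j _ => hi j (memLp_score hP), ?_⟩
  rw [integral_finsetSum _ fun j _ => hi j (memLp_score hP)]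
  -- Split the score into the contribution of `j` and the rest, which is independent of `j`.
  have hj (j : Fin d) : ∫ ω, actInd j ω * P.score d (featureVec ω) ^ 2 ∂baseLaw P d ≤
      2 * (C ^ 3 / d) + 2 * (C * (P.k d / d) * C ^ 3) := by
    have hrest : MemLp (fun ω : Fin d ⊕ Fin d → ℝ =>
        ∑ i ∈ Finset.univ.erase j, P.θ₀ d i * ω (Sum.inl i)) 2 (baseLaw P d) :=
      memLp_finsetSum _ fun i _ => memLp_coord hP i
    have i1 := ((memLp_coord hP j).integrable_sq).const_mul 2
    have i2 := (hi j hrest).const_mul 2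
    have h1 : ∫ ω, actInd j ω * P.score d (featureVec ω) ^ 2 ∂baseLaw P d ≤
        ∫ ω, (2 * (P.θ₀ d j * ω (Sum.inl j)) ^ 2 + 2 * (actInd j ω *
          (∑ i ∈ Finset.univ.erase j, P.θ₀ d i * ω (Sum.inl i)) ^ 2)) ∂baseLaw P d := by
      refine integral_mono (hi j (memLp_score hP)) (i1.add i2) fun ω => ?_
      change actInd j ω * P.score d (featureVec ω) ^ 2 ≤ 2 * (P.θ₀ d j * ω (Sum.inl j)) ^ 2 +
        2 * (actInd j ω * (∑ i ∈ Finset.univ.erase j, P.θ₀ d i * ω (Sum.inl i)) ^ 2)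
      rw [score_featureVec, ← Finset.add_sum_erase _ _ (Finset.mem_univ j)]
      generalize P.θ₀ d j * ω (Sum.inl j) = x
      generalize ∑ i ∈ Finset.univ.erase j, P.θ₀ d i * ω (Sum.inl i) = y
      have h0 := actInd_nonneg j ω
      have h1 := actInd_le_one j ω
      have h2 : actInd j ω * (x + y) ^ 2 ≤ actInd j ω * (2 * x ^ 2 + 2 * y ^ 2) := by
        gcongr
        nlinarith [sq_nonneg (x - y)]
      have h3 : actInd j ω * x ^ 2 ≤ x ^ 2 := mul_le_of_le_one_left (sq_nonneg x) h1
      linarith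
    have hind : ∫ ω, actInd j ω *
        (∑ i ∈ Finset.univ.erase j, P.θ₀ d i * ω (Sum.inl i)) ^ 2 ∂baseLaw P d =
        (∫ ω, actInd j ω ∂baseLaw P d) *
          ∫ ω, (∑ i ∈ Finset.univ.erase j, P.θ₀ d i * ω (Sum.inl i)) ^ 2 ∂baseLaw P d := by
      refine integral_mul_of_dependsOn (G := fun ω => (∑ i ∈ Finset.univ.erase j,
        P.θ₀ d i * ω (Sum.inl i)) ^ 2) (measurable_actInd j) (by fun_prop) (dependsOn_actInd j)
        (t := {Sum.inl j}ᶜ) (fun x y hxy => ?_) (by simp)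
      have : ∀ i ∈ Finset.univ.erase j, P.θ₀ d i * x (Sum.inl i) = P.θ₀ d i * y (Sum.inl i) := by
        intro i hi
        rw [hxy (Sum.inl i) (by simpa using (Finset.mem_erase.1 hi).1)]
      simp only [Finset.sum_congr rfl this]
    rw [integral_add i1 i2, integral_const_mul, integral_const_mul, hind, integral_actInd hP] at h1
    refine h1.trans (add_le_add ?_ ?_)
    · gcongr
      exact integral_coord_sq_le hP hR j
    · have h5 := integral_partial_score_sq_le hP hR (Finset.univ.erase j)
      refine mul_le_mul_of_nonneg_left (mul_le_mul hp h5 (integral_nonneg fun _ => sq_nonneg _)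
        (by positivity)) (by norm_num)
  refine (Finset.sum_le_sum fun j _ => hj j).trans ?_
  rw [Finset.sum_const, nsmul_eq_mul, Finset.card_univ, Fintype.card_fin]
  have e : (d : ℝ) * (2 * (C ^ 3 / d) + 2 * (C * (P.k d / d) * C ^ 3)) =
      2 * C ^ 3 + 2 * C ^ 4 * P.k d := by field_simp
  rw [e]
  have : C ^ 3 * 2 ≤ C ^ 3 * P.k d := by gcongr
  linarith

theorem admissible_id {d : ℕ} (hR : Regime P d c C) : Admissible P (id : Fin d → Fin d) := by
  intro i
  have e : fibre (id : Fin d → Fin d) i = {i} := by ext j; simp [mem_fibre]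
  rw [e, Finset.card_singleton]
  exact ⟨le_rfl, by have := hR.two_le_m; omega⟩

/-- Learning the features in groups of the maximal size makes a constant fraction of the maximal
attack cost `√(m* k)` unavoidable, as compared with learning them separately. -/
theorem exists_attackCost_gap (hP : P.SparseCoding) (ℓ : LossKind) (hc : 0 < c) (hC : 0 < C) :
    ∃ κ, 0 < κ ∧ ∀ (d Γ : ℕ) (φ : Fin d → Fin Γ), Regime P d c C → Admissible P φ →
      (d : ℝ) ≤ 2 * P.mstar d * (Finset.univ.filter fun g => (fibre φ g).card = P.mstar d).card →
      attackCost P ℓ (id : Fin d → Fin d) + κ * P.rootMK d ≤ attackCost P ℓ φ := by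
  set A := C ^ 3 + 2 * C ^ 4
  have hA : 0 < A := by positivity
  set B := C + C ^ 2
  have hB : 0 < B := by positivity
  -- The truncation levels `|t| ≤ √(32 A / c)` for the score and `L = (32 B / c) m* k` for the covered
  -- features cost `c / 32 * m* k` each, out of the mean surplus, which is at least `c / 8 * m* k`.
  obtain ⟨w₀, hw0, hw⟩ := exists_le_attackWeight ℓ hP.response_noise √(32 * A / c)
  refine ⟨w₀ * c ^ 2 / (2 * C * √(32 * B / c)) * (c / 16), by positivity, ?_⟩
  intro d Γ φ hR hφ hfull
  have := isProbabilityMeasure_baseLaw hP d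
  have hk := hR.two_le_k
  have hm : (2 : ℝ) ≤ P.mstar d := by exact_mod_cast hR.two_le_m
  have hd : (0 : ℝ) < d := by exact_mod_cast hR.d_pos
  have hp := hR.prob_le
  rw [← actProb] at hp
  have hp0 := actProb_nonneg (P := P) (d := d)
  have hX : 0 < (P.mstar d : ℝ) * P.k d := by positivity
  set L := 32 * B / c * (P.mstar d * P.k d) with hLdef
  have hL : 0 < L := by positivity
  have hK : 0 < √(32 * A / c) := by positivity
  have iS : Integrable (surplus φ) (baseLaw P d) :=
    integrable_of_bounded hP (measurable_surplus φ) (B := d) fun ω => by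
      rw [abs_of_nonneg (surplus_nonneg φ ω)]
      exact (surplus_le_covered φ ω).trans (covered_le_card φ ω)
  have iSN : Integrable (fun ω => surplus φ ω * covered φ ω) (baseLaw P d) :=
    integrable_of_bounded hP ((measurable_surplus φ).mul (measurable_covered φ)) (B := d * d)
      fun ω => by
        rw [abs_of_nonneg (mul_nonneg (surplus_nonneg φ ω) (covered_nonneg φ ω))]
        exact mul_le_mul ((surplus_le_covered φ ω).trans (covered_le_card φ ω))
          (covered_le_card φ ω) (covered_nonneg φ ω) hd.le
  obtain ⟨iT, bT⟩ := integral_sum_actInd_mul_score_sq_le hP hR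
  have hST (ω : Fin d ⊕ Fin d → ℝ) : surplus φ ω * P.score d (featureVec ω) ^ 2 ≤
      P.mstar d * ((∑ j, actInd j ω) * P.score d (featureVec ω) ^ 2) := by
    rw [← mul_assoc]
    exact mul_le_mul_of_nonneg_right ((surplus_le_covered φ ω).trans (covered_le_mul hφ ω))
      (sq_nonneg _)
  have iST : Integrable (fun ω => surplus φ ω * P.score d (featureVec ω) ^ 2) (baseLaw P d) := by
    refine (iT.const_mul (P.mstar d : ℝ)).mono'
      ((measurable_surplus φ).mul (measurable_score_featureVec.pow_const 2)).aestronglyMeasurable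
      (Eventually.of_forall fun ω => ?_)
    rw [Real.norm_eq_abs, abs_of_nonneg (mul_nonneg (surplus_nonneg φ ω) (sq_nonneg _))]
    exact hST ω
  have eT : ∫ ω, surplus φ ω * P.score d (featureVec ω) ^ 2 ∂baseLaw P d ≤
      A * (P.mstar d * P.k d) := by
    refine (integral_mono iST (iT.const_mul _) hST).trans ?_
    rw [integral_const_mul]
    calc (P.mstar d : ℝ) * ∫ ω, (∑ j, actInd j ω) * P.score d (featureVec ω) ^ 2 ∂baseLaw P d
        ≤ P.mstar d * (A * P.k d) := by gcongr
      _ = _ := by ring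
  have eN : ∫ ω, surplus φ ω * covered φ ω ∂baseLaw P d ≤ B * (P.mstar d * P.k d) ^ 2 := by
    obtain ⟨i1, h1⟩ := integral_sum_actInd_sq_le hP (d := d) Finset.univ
    have h2 : ∫ ω, surplus φ ω * covered φ ω ∂baseLaw P d ≤
        ∫ ω, (P.mstar d : ℝ) ^ 2 * (∑ j, actInd j ω) ^ 2 ∂baseLaw P d := by
      refine integral_mono iSN (i1.const_mul _) fun ω => ?_
      change surplus φ ω * covered φ ω ≤ (P.mstar d : ℝ) ^ 2 * (∑ j, actInd j ω) ^ 2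
      have h3 := covered_le_mul hφ ω
      have h4 := covered_nonneg φ ω
      calc surplus φ ω * covered φ ω ≤ covered φ ω * covered φ ω := by
            gcongr
            exact surplus_le_covered φ ω
        _ ≤ (P.mstar d * ∑ j, actInd j ω) * (P.mstar d * ∑ j, actInd j ω) :=
            mul_le_mul h3 h3 h4 (h4.trans h3)
        _ = _ := by ring
    rw [integral_const_mul] at h2
    rw [Finset.card_univ, Fintype.card_fin] at h1
    have h5 : (d : ℝ) * actProb P d ≤ C * P.k d := by
      calc (d : ℝ) * actProb P d ≤ d * (C * (P.k d / d)) := by gcongr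
        _ = _ := by field_simp
    have h6 : (d : ℝ) * actProb P d + (d * actProb P d) ^ 2 ≤ B * P.k d ^ 2 := by
      have h7 : (d * actProb P d) ^ 2 ≤ (C * P.k d) ^ 2 := by gcongr
      have h8 : C * P.k d ≤ C * P.k d ^ 2 := by
        gcongr
        nlinarith
      have : B * P.k d ^ 2 = C * P.k d ^ 2 + (C * P.k d) ^ 2 := by simp only [B]; ring
      linarith
    calc ∫ ω, surplus φ ω * covered φ ω ∂baseLaw P d
        ≤ (P.mstar d : ℝ) ^ 2 * (B * P.k d ^ 2) := by
          refine h2.trans ?_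
          gcongr
          exact h1.trans h6
      _ = _ := by ring
  have i1 := integrable_attackWeight_mul hP hR ℓ hφ
  have i2 := integrable_attackWeight_mul hP hR ℓ (admissible_id hR)
  have iI : Integrable (fun ω => surplus φ ω - surplus φ ω * P.score d (featureVec ω) ^ 2 /
      √(32 * A / c) ^ 2 - surplus φ ω * covered φ ω / L) (baseLaw P d) :=
    (iS.sub (iST.div_const _)).sub (iSN.div_const _)
  have hmono := integral_mono (iI.const_mul (w₀ * c ^ 2 / (2 * C * √L))) (i1.sub i2) fun ω => by
    have h := surplus_le_mul_sub hc hR φ ω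
    have h2 := weighted_gap_ge (w := attackWeight ℓ P.s (P.score d (featureVec ω)))
      (t := P.score d (featureVec ω)) hK hL hC
      (attackWeight_nonneg ℓ P.s _) (sub_nonneg.2 h.1) (surplus_nonneg φ ω) (covered_nonneg φ ω)
      hw0.le (hw _) h.2
    rw [mul_sub (attackWeight ℓ P.s (P.score d (featureVec ω)))] at h2
    exact h2
  have iS2 : Integrable (fun ω => surplus φ ω - surplus φ ω * P.score d (featureVec ω) ^ 2 /
      √(32 * A / c) ^ 2) (baseLaw P d) := iS.sub (iST.div_const _)
  rw [integral_const_mul, integral_sub iS2 (iSN.div_const _), integral_sub iS (iST.div_const _),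
    integral_div, integral_div] at hmono
  simp only [Pi.sub_apply] at hmono
  rw [integral_sub i1 i2] at hmono
  have hS := le_integral_surplus hP hR hφ hfull
  have hT' : (∫ ω, surplus φ ω * P.score d (featureVec ω) ^ 2 ∂baseLaw P d) / √(32 * A / c) ^ 2 ≤
      c / 32 * (P.mstar d * P.k d) := by
    rw [Real.sq_sqrt (by positivity), div_le_iff₀ (by positivity)]
    refine eT.trans (le_of_eq ?_)
    field_simp
  have hN' : (∫ ω, surplus φ ω * covered φ ω ∂baseLaw P d) / L ≤
      c / 32 * (P.mstar d * P.k d) := by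
    rw [div_le_iff₀ hL]
    refine eN.trans (le_of_eq ?_)
    rw [hLdef]
    field_simp
  have hfin : c / 16 * (P.mstar d * P.k d) ≤ ∫ ω, surplus φ ω ∂baseLaw P d -
      (∫ ω, surplus φ ω * P.score d (featureVec ω) ^ 2 ∂baseLaw P d) / √(32 * A / c) ^ 2 -
      (∫ ω, surplus φ ω * covered φ ω ∂baseLaw P d) / L := by linarith
  have hlow := (mul_le_mul_of_nonneg_left hfin
    (by positivity : 0 ≤ w₀ * c ^ 2 / (2 * C * √L))).trans hmono
  have hroot : w₀ * c ^ 2 / (2 * C * √L) * (c / 16 * (P.mstar d * P.k d)) =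
      w₀ * c ^ 2 / (2 * C * √(32 * B / c)) * (c / 16) * P.rootMK d := by
    have e1 : √L = √(32 * B / c) * P.rootMK d := by
      rw [hLdef, Real.sqrt_mul (by positivity), Model.rootMK]
    have e2 : (P.mstar d : ℝ) * P.k d = P.rootMK d * P.rootMK d :=
      (Real.mul_self_sqrt hX.le).symm
    have e3 : P.rootMK d ≠ 0 := (Real.sqrt_pos.2 hX).ne'
    have e4 : √(32 * B / c) ≠ 0 := (Real.sqrt_pos.2 (by positivity)).ne'
    rw [e1, e2]
    field_simp
  rw [hroot] at hlow
  unfold attackCost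
  linarith

end Gap

/-! ### Membership in the class -/

section Membership

variable {P : Model} {c C : ℝ}

theorem tendsto_log_natCast : Tendsto (fun d : ℕ => Real.log (d : ℝ)) atTop atTop :=
  Real.tendsto_log_atTop.comp tendsto_natCast_atTop_atTop

theorem tendsto_sqrt_log_natCast : Tendsto (fun d : ℕ => √(Real.log (d : ℝ))) atTop atTop :=
  Real.tendsto_sqrt_atTop.comp tendsto_log_natCast

/-- In all large dimensions the assumptions hold with fixed constants. -/
theorem exists_regime (hP : P.SparseCoding) (hk : ∀ᶠ d in atTop, 2 ≤ P.k d)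
    (hm : ∀ᶠ d in atTop, 2 ≤ P.mstar d)
    (hkm : (fun d : ℕ => P.k d * (P.mstar d : ℝ) * Real.log (d : ℝ) ^ 2)
      =o[atTop] fun d : ℕ => (d : ℝ))
    (hH : (fun d : ℕ => (d : ℝ)) =o[atTop] fun d : ℕ => (P.H d : ℝ)) :
    ∃ c C : ℝ, 0 < c ∧ 0 < C ∧ ∀ᶠ d in atTop, Regime P d c C := by
  obtain ⟨c₀, C₀, hc₀, hθ⟩ := hP.coeff
  obtain ⟨C₁, hC₁, h1⟩ := hP.active.1.exists_pos
  obtain ⟨C₂, hC₂, h2⟩ := hP.active.2.exists_pos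
  obtain ⟨C₃, hC₃, h3⟩ := hP.moment_two.1.exists_pos
  set c := min c₀ (1 / C₂)
  have hc : 0 < c := lt_min hc₀ (by positivity)
  set C := max C₀ (max C₁ C₃)
  have hC : 0 < C := lt_max_of_lt_right (lt_max_of_lt_left hC₁)
  refine ⟨c, C, hc, hC, ?_⟩
  have hl2 : Tendsto (fun d : ℕ => Real.log (d : ℝ) ^ 2) atTop atTop :=
    (tendsto_pow_atTop two_ne_zero).comp tendsto_log_natCast
  filter_upwards [hk, hm, hθ, h1.bound, h2.bound, h3.bound, hkm.bound one_pos, hH.bound one_pos,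
    eventually_gt_atTop 0, tendsto_log_natCast.eventually_ge_atTop 1,
    tendsto_sqrt_log_natCast.eventually_ge_atTop (3 * C / c),
    hl2.eventually_ge_atTop (4 * C)] with d a1 a2 a3 a4 a5 a6 a7 a8 a9 a10 a11 a12
  have hd : (0 : ℝ) < d := by exact_mod_cast a9
  have hk0 : 0 ≤ P.k d / d := by positivity
  rw [Real.norm_of_nonneg measureReal_nonneg, Real.norm_of_nonneg hk0] at a4
  rw [Real.norm_of_nonneg measureReal_nonneg, Real.norm_of_nonneg hk0] at a5
  rw [Real.norm_of_nonneg (integral_nonneg fun x => sq_nonneg x),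
    Real.norm_of_nonneg (by positivity)] at a6
  rw [Real.norm_of_nonneg (by positivity), Real.norm_of_nonneg hd.le, one_mul] at a7
  rw [Real.norm_of_nonneg hd.le, Real.norm_of_nonneg (Nat.cast_nonneg _), one_mul] at a8
  refine ⟨a9, a1, a2, a10, fun i => (min_le_left _ _).trans (a3 i).1,
    fun i => (a3 i).2.trans (le_max_left _ _), ?_, a12, ?_, ?_, ?_, a7, by exact_mod_cast a8⟩
  · rw [div_le_iff₀ hc] at a11; linarith
  · calc c * (P.k d / d) ≤ 1 / C₂ * (P.k d / d) := by
          gcongr; exact min_le_right _ _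
      _ ≤ _ := by rw [one_div, inv_mul_le_iff₀ hC₂]; exact a5
  · exact a4.trans (by gcongr; exact (le_max_left _ _).trans (le_max_right _ _))
  · refine a6.trans ?_
    rw [mul_one_div]
    gcongr
    exact (le_max_right _ _).trans (le_max_right _ _)

theorem intercept_eq {d Γ : ℕ} (φ : Fin d → Fin Γ) (h : Fin (P.H d)) :
    (groupNetwork P φ).intercept h = P.nodeScale (groupNetwork P φ) h / √(Real.log d) := rfl

theorem nodeScale_nonneg {d : ℕ} (N : Network d (P.H d)) (h : Fin (P.H d)) :
    0 ≤ P.nodeScale N h := div_nonneg (Real.sqrt_nonneg _) (Real.sqrt_nonneg _)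

/-- Every sequence of networks of admissible groupings belongs to the class.  The scale of the
coefficients is the inverse `Γ / H` of the mean number of nodes per group. -/
theorem inClass_groupNetwork (hP : P.SparseCoding) (hc : 0 < c)
    (hR : ∀ᶠ d in atTop, Regime P d c C)
    (hkm : (fun d : ℕ => P.k d * (P.mstar d : ℝ) * Real.log (d : ℝ) ^ 2)
      =o[atTop] fun d : ℕ => (d : ℝ))
    {Γ : ℕ → ℕ} (hΓ : ∀ᶠ d in atTop, 0 < Γ d ∧ Γ d ≤ d)
    {N : ∀ d : ℕ, Network d (P.H d)}
    (hN : ∀ᶠ d in atTop, ∃ φ : Fin d → Fin (Γ d), Admissible P φ ∧ N d = groupNetwork P φ) :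
    P.InClass N where
  intercept_upper := by
    intro η hη
    filter_upwards [hR, hN, tendsto_sqrt_log_natCast.eventually_ge_atTop η⁻¹] with
      d hR ⟨φ, _, hφ⟩ hl h
    have hl0 : 0 < √(Real.log d) := (by positivity : 0 < η⁻¹).trans_le hl
    change (N d).intercept h ≤ η * P.nodeScale (N d) h
    rw [hφ, intercept_eq, div_le_iff₀ hl0]
    have h0 := nodeScale_nonneg (groupNetwork P φ) h
    have h1 : 1 ≤ η * √(Real.log d) := by
      rwa [inv_le_iff_one_le_mul₀' hη] at hl
    nlinarith
  intercept_lower := by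
    intro η hη
    filter_upwards [hR, hN, tendsto_sqrt_log_natCast.eventually_ge_atTop η⁻¹] with
      d hR ⟨φ, _, hφ⟩ hl h
    have hl0 : 0 < √(Real.log d) := (by positivity : 0 < η⁻¹).trans_le hl
    change P.nodeScale (N d) h / Real.log d ≤ η * (N d).intercept h
    have h0 := nodeScale_nonneg (groupNetwork P φ) h
    have h1 : 1 ≤ η * √(Real.log d) := by
      rwa [inv_le_iff_one_le_mul₀' hη] at hl
    have h2 : Real.log d = √(Real.log d) * √(Real.log d) :=
      (Real.mul_self_sqrt (by linarith [hR.one_le_log])).symm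
    rw [hφ, intercept_eq, h2, div_le_iff₀ (by positivity), Real.sqrt_mul_self hl0.le]
    have e : η * (P.nodeScale (groupNetwork P φ) h / √(Real.log d)) *
        (√(Real.log d) * √(Real.log d)) =
        P.nodeScale (groupNetwork P φ) h * (η * √(Real.log d)) := by field_simp
    rw [e]
    exact le_mul_of_one_le_right h0 h1
  noise_small := by
    intro η hη
    filter_upwards [hR, hN, hΓ, hkm.bound (sq_pos_of_pos hη)] with d hR ⟨φ, hA, hφ⟩ hΓ hb h
    have hd : (0 : ℝ) < d := by exact_mod_cast hR.d_pos
    have hl := hR.one_le_log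
    have hk := hR.two_le_k
    change P.nodeNorm (N d) h / √d ≤ η * (P.nodeScale (N d) h / Real.log d)
    have hcard := nodeCount_groupNetwork hP (hR.coef_ne_zero hc) hΓ.1 (hΓ.2.trans hR.nodes) φ h
    have hAg := hA ⟨h % Γ d, Nat.mod_lt _ hΓ.1⟩
    rw [← hcard] at hAg
    rw [hφ, Model.nodeScale]
    have hn1 : (1 : ℝ) ≤ P.nodeCount (groupNetwork P φ) h := by exact_mod_cast hAg.1
    have hn2 : (P.nodeCount (groupNetwork P φ) h : ℝ) ≤ P.mstar d := by exact_mod_cast hAg.2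
    rw [Real.norm_of_nonneg (by positivity), Real.norm_of_nonneg hd.le] at hb
    have h1 : √(P.k d * P.nodeCount (groupNetwork P φ) h) * Real.log d ≤ η * √d := by
      refine le_of_sq_le_sq ?_ (by positivity)
      rw [mul_pow, mul_pow, Real.sq_sqrt (by positivity), Real.sq_sqrt hd.le]
      refine le_trans ?_ hb
      gcongr
    have h0 : 0 ≤ P.nodeNorm (groupNetwork P φ) h := Real.sqrt_nonneg _
    have h2 : 0 < √(P.k d * P.nodeCount (groupNetwork P φ) h) * Real.log d := by
      have : 0 < √(P.k d * P.nodeCount (groupNetwork P φ) h) := Real.sqrt_pos.2 (by positivity)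
      positivity
    have h3 : 0 < √(d : ℝ) := Real.sqrt_pos.2 hd
    rw [div_div, ← mul_div_assoc, div_le_div_iff₀ h3 h2]
    calc P.nodeNorm (groupNetwork P φ) h *
          (√(P.k d * P.nodeCount (groupNetwork P φ) h) * Real.log d)
        ≤ P.nodeNorm (groupNetwork P φ) h * (η * √d) := by gcongr
      _ = _ := by ring
  features := by
    filter_upwards [hR, hN, hΓ] with d hR ⟨φ, hA, hφ⟩ hΓ h
    rw [hφ, nodeCount_groupNetwork hP (hR.coef_ne_zero hc) hΓ.1 (hΓ.2.trans hR.nodes)]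
    exact hA _
  same_sign := by
    filter_upwards [hN] with d ⟨φ, _, hφ⟩ i h h'
    rw [hφ, coef_groupNetwork hP]
    unfold groupCoef
    split_ifs
    · exact mul_self_nonneg _
    all_goals simp
  same_scale := by
    refine ⟨fun d => Γ d / P.H d, c / 2, 2 * C, by positivity, ?_⟩
    filter_upwards [hR, hN, hΓ] with d hR ⟨φ, _, hφ⟩ hΓ
    have hΓ0 : (0 : ℝ) < Γ d := by exact_mod_cast hΓ.1
    have hH : Γ d ≤ P.H d := hΓ.2.trans hR.nodes
    have hH0 : (0 : ℝ) < P.H d := by exact_mod_cast hΓ.1.trans_le hH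
    have hC := const_nonneg hR
    refine ⟨by positivity, fun i h hne => ?_⟩
    rw [hφ, coef_groupNetwork hP] at hne ⊢
    unfold groupCoef at hne ⊢
    split_ifs at hne ⊢ with hi
    · obtain ⟨b1, b2⟩ := nodesOf_bounds hΓ.1 hH (φ i)
      have hpos : (0 : ℝ) < nodesOf (P.H d) (Γ d) (φ i) := by
        exact_mod_cast nodesOf_pos hH (φ i)
      rw [abs_div, abs_of_pos hpos]
      constructor
      · rw [le_div_iff₀ hpos]
        calc c / 2 * (Γ d / P.H d) * nodesOf (P.H d) (Γ d) (φ i)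
            ≤ c / 2 * (Γ d / P.H d) * (2 * (P.H d / Γ d)) := by gcongr
          _ = c := by field_simp
          _ ≤ _ := hR.le_coef i
      · rw [div_le_iff₀ hpos]
        calc |P.θ₀ d i| ≤ C := hR.coef_le i
          _ = 2 * C * (Γ d / P.H d) * (P.H d / Γ d / 2) := by field_simp
          _ ≤ _ := by gcongr
    · exact absurd rfl hne

end Membership

/-! ### Many groupings -/

section Counting

variable {P : Model}

/-- The number of groups: `d / m*` groups of `m*` features, and one group for each of the remaining
features. -/
def groupNumber (P : Model) (d : ℕ) : ℕ := d / P.mstar d + d % P.mstar d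

/-- The groupings which define the non-robust networks: they are admissible, and at least half of
the features belong to groups of the maximal size. -/
def fullGroupings (P : Model) (d : ℕ) : Set (Fin d → Fin (groupNumber P d)) :=
  {φ | Admissible P φ ∧ (d : ℝ) ≤ 2 * P.mstar d *
    (Finset.univ.filter fun g => (fibre φ g).card = P.mstar d).card}

/-- The grouping of `m` rows of `G` features each, which puts one feature of every row into each of
the first `G` groups, as prescribed by the permutations `τ` of the rows.  The remaining features are
singletons. -/
def rowGrouping (d m G r : ℕ) (hd : d = G * m + r) (hG : 0 < G) (τ : ℕ → Equiv.Perm (Fin G))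
    (i : Fin d) : Fin (G + r) :=
  if h : (i : ℕ) < G * m then
    ⟨τ (i / G) ⟨i % G, Nat.mod_lt _ hG⟩, Nat.lt_add_right r (Fin.isLt _)⟩
  else ⟨G + (i - G * m), by omega⟩

/-- The rows `1, …, m - 1` are permuted by `σ`, and the row `0` is fixed. -/
def extendPerm {m G : ℕ} (σ : Fin (m - 1) → Equiv.Perm (Fin G)) (q : ℕ) : Equiv.Perm (Fin G) :=
  if h : 0 < q ∧ q < m then σ ⟨q - 1, by omega⟩ else 1

variable {d m G r : ℕ} {hd : d = G * m + r} {hG : 0 < G} {τ : ℕ → Equiv.Perm (Fin G)}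

theorem rowGrouping_of_lt {i : Fin d} (hi : (i : ℕ) < G * m) :
    (rowGrouping d m G r hd hG τ i : ℕ) = τ (i / G) ⟨i % G, Nat.mod_lt _ hG⟩ := by
  simp [rowGrouping, hi]

theorem rowGrouping_of_le {i : Fin d} (hi : G * m ≤ i) :
    (rowGrouping d m G r hd hG τ i : ℕ) = G + (i - G * m) := by
  simp [rowGrouping, not_lt.2 hi]

theorem rowGrouping_lt_iff {i : Fin d} :
    (rowGrouping d m G r hd hG τ i : ℕ) < G ↔ (i : ℕ) < G * m := by
  by_cases hi : (i : ℕ) < G * m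
  · rw [rowGrouping_of_lt hi]; simp [hi]
  · rw [rowGrouping_of_le (not_lt.1 hi)]; omega

theorem card_fibre_rowGrouping_of_lt {g : Fin (G + r)} (hg : (g : ℕ) < G) :
    (fibre (rowGrouping d m G r hd hG τ) g).card = m := by
  have hlt (q : ℕ) (hq : q < m) : ((τ q).symm ⟨g, hg⟩ : ℕ) + G * q < G * m := by
    have h1 := ((τ q).symm ⟨g, hg⟩).isLt
    calc ((τ q).symm ⟨g, hg⟩ : ℕ) + G * q < G + G * q := by omega
      _ = G * (q + 1) := by ring
      _ ≤ G * m := Nat.mul_le_mul_left _ hq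
  refine Eq.trans (Finset.card_bij (t := Finset.range m) (fun i _ => (i : ℕ) / G) ?_ ?_ ?_)
    (Finset.card_range m)
  · intro i hi
    have h1 : (i : ℕ) < G * m := rowGrouping_lt_iff.1 (by rw [mem_fibre.1 hi]; exact hg)
    exact Finset.mem_range.2 (Nat.div_lt_of_lt_mul h1)
  · intro i hi j hj hij
    have hi1 : (i : ℕ) < G * m := rowGrouping_lt_iff.1 (by rw [mem_fibre.1 hi]; exact hg)
    have hj1 : (j : ℕ) < G * m := rowGrouping_lt_iff.1 (by rw [mem_fibre.1 hj]; exact hg)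
    have h := (mem_fibre.1 hi).trans (mem_fibre.1 hj).symm
    have h2 := congrArg Fin.val h
    rw [rowGrouping_of_lt hi1, rowGrouping_of_lt hj1] at h2
    simp only [hij] at h2
    have h3 := congrArg Fin.val ((τ _).injective (Fin.ext h2))
    simp only at h3
    refine Fin.ext ?_
    rw [← Nat.div_add_mod (i : ℕ) G, ← Nat.div_add_mod (j : ℕ) G, hij, h3]
  · intro q hq
    have hq' := hlt q (Finset.mem_range.1 hq)
    have h1 := ((τ q).symm ⟨g, hg⟩).isLt
    have e1 : (((τ q).symm ⟨g, hg⟩ : ℕ) + G * q) / G = q := by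
      rw [Nat.add_mul_div_left _ _ hG, Nat.div_eq_of_lt h1, zero_add]
    have e2 : (((τ q).symm ⟨g, hg⟩ : ℕ) + G * q) % G = (τ q).symm ⟨g, hg⟩ := by
      rw [Nat.add_mul_mod_self_left, Nat.mod_eq_of_lt h1]
    refine ⟨⟨((τ q).symm ⟨g, hg⟩ : ℕ) + G * q, by omega⟩, mem_fibre.2 (Fin.ext ?_), e1⟩
    rw [rowGrouping_of_lt hq']
    simp only [e1, e2]
    simp

theorem card_fibre_rowGrouping_of_le {g : Fin (G + r)} (hg : G ≤ g) :
    (fibre (rowGrouping d m G r hd hG τ) g).card = 1 := by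
  rw [Finset.card_eq_one]
  have hlt := g.isLt
  refine ⟨⟨G * m + (g - G), by omega⟩, ?_⟩
  ext i
  rw [mem_fibre, Finset.mem_singleton, Fin.ext_iff, Fin.ext_iff]
  by_cases hi : (i : ℕ) < G * m
  · have h1 := (rowGrouping_lt_iff (hd := hd) (hG := hG) (τ := τ)).2 hi
    constructor
    · intro h; omega
    · intro h; simp only at h; omega
  · rw [rowGrouping_of_le (not_lt.1 hi)]
    simp only
    omega

/-- The row permutations are determined by the groups, if the first row serves as labels. -/
theorem rowGrouping_eq_of_fibres (hm : 0 < m) {τ' : ℕ → Equiv.Perm (Fin G)} (h0 : τ 0 = 1)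
    (h0' : τ' 0 = 1)
    (h : Finset.univ.image (fibre (rowGrouping d m G r hd hG τ)) =
      Finset.univ.image (fibre (rowGrouping d m G r hd hG τ'))) {q : ℕ} (hq : q < m) :
    τ q = τ' q := by
  ext j
  have hj : (j : ℕ) + G * q < G * m := by
    have := j.isLt
    calc (j : ℕ) + G * q < G + G * q := by omega
      _ = G * (q + 1) := by ring
      _ ≤ G * m := Nat.mul_le_mul_left _ hq
  have hGm : G ≤ G * m := Nat.le_mul_of_pos_right _ hm
  have e1 : ((j : ℕ) + G * q) / G = q := by
    rw [Nat.add_mul_div_left _ _ hG, Nat.div_eq_of_lt j.isLt, zero_add]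
  have e2 : ((j : ℕ) + G * q) % G = j := by
    rw [Nat.add_mul_mod_self_left, Nat.mod_eq_of_lt j.isLt]
  have hval (σ : ℕ → Equiv.Perm (Fin G)) :
      (rowGrouping d m G r hd hG σ ⟨(j : ℕ) + G * q, by omega⟩ : ℕ) = σ q j := by
    rw [rowGrouping_of_lt hj]
    simp only [e1, e2]
  have hanchor (σ : ℕ → Equiv.Perm (Fin G)) (hσ : σ 0 = 1) (a : Fin G) :
      (rowGrouping d m G r hd hG σ ⟨a, by omega⟩ : ℕ) = a := by
    have := a.isLt
    rw [rowGrouping_of_lt (show ((⟨a, by omega⟩ : Fin d) : ℕ) < G * m by simp only; omega)]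
    simp [Nat.div_eq_of_lt this, Nat.mod_eq_of_lt this, hσ]
  set x : Fin d := ⟨(j : ℕ) + G * q, by omega⟩ with hx
  set a : Fin d := ⟨τ q j, by omega⟩ with ha
  have hxa : rowGrouping d m G r hd hG τ x = rowGrouping d m G r hd hG τ a := by
    refine Fin.ext ?_
    rw [hval τ, hanchor τ h0]
  have hmem : fibre (rowGrouping d m G r hd hG τ) (rowGrouping d m G r hd hG τ a) ∈
      Finset.univ.image (fibre (rowGrouping d m G r hd hG τ')) := by
    rw [← h]; exact Finset.mem_image_of_mem _ (Finset.mem_univ _)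
  obtain ⟨g, -, hg⟩ := Finset.mem_image.1 hmem
  have m1 : x ∈ fibre (rowGrouping d m G r hd hG τ') g := by rw [hg]; exact mem_fibre.2 hxa
  have m2 : a ∈ fibre (rowGrouping d m G r hd hG τ') g := by rw [hg]; exact mem_fibre.2 rfl
  have h2 := congrArg Fin.val ((mem_fibre.1 m1).trans (mem_fibre.1 m2).symm)
  rw [hval τ', hanchor τ' h0'] at h2
  exact h2.symm

theorem supportPattern_groupNetwork {Γ : ℕ} (hP : P.SparseCoding) (hθ : ∀ i, P.θ₀ d i ≠ 0)
    (hΓ : 0 < Γ) (hH : Γ ≤ P.H d) (φ : Fin d → Fin Γ) :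
    P.supportPattern (groupNetwork P φ) = Finset.univ.image (fibre φ) := by
  ext A
  simp only [Model.supportPattern, Finset.mem_image, Finset.mem_univ, true_and]
  constructor
  · rintro ⟨h, rfl⟩
    exact ⟨⟨h % Γ, Nat.mod_lt _ hΓ⟩, (nodeSupport_groupNetwork hP hθ hH φ h _ rfl).symm⟩
  · rintro ⟨g, rfl⟩
    exact ⟨⟨g, g.isLt.trans_le hH⟩,
      nodeSupport_groupNetwork hP hθ hH φ _ g (Nat.mod_eq_of_lt g.isLt)⟩

/-- With `m - 1` free rows of `G` features there are at least `2 ^ d` choices of row permutations.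
-/
theorem two_pow_le_factorial_pow (hm : 2 ≤ m) (hr : r < m) (hG : 4 ^ (G + 1) ≤ G.factorial) :
    2 ^ (G * m + r) ≤ G.factorial ^ (m - 1) := by
  calc 2 ^ (G * m + r) ≤ 2 ^ (2 * (G + 1) * (m - 1)) := by
        refine Nat.pow_le_pow_right (by norm_num) ?_
        obtain ⟨n, rfl⟩ : ∃ n, m = n + 2 := ⟨m - 2, by omega⟩
        rw [show n + 2 - 1 = n + 1 from rfl]
        nlinarith [Nat.zero_le (G * n)]
    _ = (4 ^ (G + 1)) ^ (m - 1) := by rw [pow_mul, pow_mul]; norm_num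
    _ ≤ _ := Nat.pow_le_pow_left hG _

/-- Different row permutations with a fixed first row have different groups, which are the supports
of the nodes. -/
theorem two_pow_le_ncard (hP : P.SparseCoding) (hθ : ∀ i, P.θ₀ d i ≠ 0) (hm : 2 ≤ P.mstar d)
    (hH : d ≤ P.H d) (hG : 4 ^ (d / P.mstar d + 1) ≤ (d / P.mstar d).factorial)
    (hG0 : 0 < d / P.mstar d) :
    2 ^ d ≤ (P.supportPattern '' ((groupNetwork P) '' fullGroupings P d)).ncard := by
  set m := P.mstar d with hmdef
  set G := d / m with hGdef
  set r := d % m with hrdef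
  have hd : d = G * m + r := (Nat.div_add_mod' d m).symm
  have hr : r < m := Nat.mod_lt _ (by omega)
  have hΓ : 0 < groupNumber P d := Nat.add_pos_left hG0 _
  have hΓd : groupNumber P d ≤ d := by
    change G + r ≤ d
    have : G ≤ G * m := Nat.le_mul_of_pos_right _ (by omega)
    omega
  let F (σ : Fin (m - 1) → Equiv.Perm (Fin G)) : Fin d → Fin (groupNumber P d) :=
    rowGrouping d m G r hd hG0 (extendPerm σ)
  have hF (σ : Fin (m - 1) → Equiv.Perm (Fin G)) : F σ ∈ fullGroupings P d := by
    have hlt (g : Fin (groupNumber P d)) (hg : (g : ℕ) < G) : (fibre (F σ) g).card = m :=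
      card_fibre_rowGrouping_of_lt (g := g) hg
    have hle (g : Fin (groupNumber P d)) (hg : G ≤ g) : (fibre (F σ) g).card = 1 :=
      card_fibre_rowGrouping_of_le (g := g) hg
    constructor
    · intro g
      rcases lt_or_ge (g : ℕ) G with hg | hg
      · rw [hlt g hg]; omega
      · rw [hle g hg]; omega
    · have hcard : G ≤ (Finset.univ.filter fun g => (fibre (F σ) g).card = m).card := by
        calc G = (Finset.univ : Finset (Fin G)).card := by simp
          _ = (Finset.univ.map (Fin.castAddEmb r)).card := (Finset.card_map _).symm
          _ ≤ _ := by
            refine Finset.card_le_card fun g hg => ?_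
            obtain ⟨a, -, rfl⟩ := Finset.mem_map.1 hg
            exact Finset.mem_filter.2 ⟨Finset.mem_univ _, hlt _ a.isLt⟩
      have h1 : d ≤ 2 * m * G := by
        have : m ≤ G * m := Nat.le_mul_of_pos_left _ hG0
        calc d ≤ G * m + G * m := by omega
          _ = 2 * m * G := by ring
      have h2 : d ≤ 2 * m * (Finset.univ.filter fun g => (fibre (F σ) g).card = m).card :=
        h1.trans (Nat.mul_le_mul_left _ hcard)
      exact_mod_cast h2
  have hinj : Function.Injective fun σ => P.supportPattern (groupNetwork P (F σ)) := by
    intro σ σ' h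
    simp only at h
    rw [supportPattern_groupNetwork hP hθ hΓ (hΓd.trans hH),
      supportPattern_groupNetwork hP hθ hΓ (hΓd.trans hH)] at h
    funext q
    have h1 := rowGrouping_eq_of_fibres (q := q + 1) (by omega : 0 < m)
      (τ := extendPerm σ) (τ' := extendPerm σ') rfl rfl h (by omega)
    have hq := q.isLt
    simpa [extendPerm, show (q : ℕ) + 1 < m by omega] using h1
  calc 2 ^ d = 2 ^ (G * m + r) := by rw [← hd]
    _ ≤ G.factorial ^ (m - 1) := two_pow_le_factorial_pow hm hr hG
    _ = Nat.card (Fin (m - 1) → Equiv.Perm (Fin G)) := by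
        rw [Nat.card_eq_fintype_card, Fintype.card_fun, Fintype.card_perm, Fintype.card_fin,
          Fintype.card_fin]
    _ = (Set.range fun σ => P.supportPattern (groupNetwork P (F σ))).ncard :=
        (Set.ncard_range_of_injective hinj).symm
    _ ≤ _ := by
        refine Set.ncard_le_ncard ?_ (Set.toFinite _)
        rintro _ ⟨σ, rfl⟩
        exact ⟨_, ⟨F σ, hF σ, rfl⟩, rfl⟩

end Counting

/-! ### Asymptotics of the error term -/

section Asymptotics

variable {P : Model} {c C : ℝ} {d : ℕ}

/-- This uses `H ≥ d` and `log k ≥ 1 / 2`. -/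
theorem errOrder_le_psi (hR : Regime P d c C) : errOrder P d ≤ 2 * P.psi d := by
  have hd : (0 : ℝ) < d := by exact_mod_cast hR.d_pos
  have hm : (2 : ℝ) ≤ P.mstar d := by exact_mod_cast hR.two_le_m
  have hk := hR.two_le_k
  have hH : (d : ℝ) ≤ P.H d := by exact_mod_cast hR.nodes
  have hlog : 1 / 2 ≤ Real.log (P.k d) := by
    have h1 := Real.log_two_gt_d9
    have h2 := Real.log_le_log (by norm_num) hk
    linarith
  have h0 : 0 ≤ √(P.k d / d) := Real.sqrt_nonneg _
  have h1 : errOrder P d ≤ 2 *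
      ((P.H d : ℝ) * P.mstar d ^ 3 * P.k d ^ 3 * Real.log (P.k d) ^ 2 / d ^ 2) := by
    calc errOrder P d = 2 * (d * (P.mstar d ^ 2 * 2) * P.k d ^ 3 * (1 / 2) ^ 2 / d ^ 2) := by
          unfold errOrder; field_simp
      _ ≤ 2 * (P.H d * (P.mstar d ^ 2 * P.mstar d) * P.k d ^ 3 * Real.log (P.k d) ^ 2 / d ^ 2) := by
          gcongr
      _ = _ := by ring
  unfold Model.psi
  linarith

theorem psi_nonneg (hR : Regime P d c C) : 0 ≤ P.psi d := by
  have hk := hR.two_le_k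
  unfold Model.psi
  positivity

theorem rootMK_pos (hR : Regime P d c C) : 0 < P.rootMK d := by
  have hk := hR.two_le_k
  have hm : (2 : ℝ) ≤ P.mstar d := by exact_mod_cast hR.two_le_m
  exact Real.sqrt_pos.2 (by positivity)

theorem rootMK_sq (hR : Regime P d c C) : P.rootMK d ^ 2 = P.mstar d * P.k d := by
  have hk := hR.two_le_k
  exact Real.sq_sqrt (by positivity)

/-- In the moderate regime the error term is smaller than every attack gap of order
`1 / log d`. -/
theorem tendsto_psi_mul_log (hR : ∀ᶠ d in atTop, Regime P d c C)
    (hkm : (fun d : ℕ => P.k d * (P.mstar d : ℝ) * Real.log (d : ℝ) ^ 2)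
      =o[atTop] fun d : ℕ => (d : ℝ)) (hM : P.Moderate) :
    Tendsto (fun d => P.psi d * Real.log (d : ℝ)) atTop (𝓝 0) := by
  obtain ⟨τ, hτ, hO⟩ := hM
  obtain ⟨A, hA, hO⟩ := hO.exists_pos
  have t1 : Tendsto (fun d : ℕ => A * (Real.log (d : ℝ) ^ 3 / (d : ℝ) ^ τ)) atTop (𝓝 0) := by
    have h := ((isLittleO_log_rpow_rpow_atTop 3 hτ).tendsto_div_nhds_zero).comp
      tendsto_natCast_atTop_atTop
    have h2 := h.const_mul A
    rw [mul_zero] at h2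
    refine h2.congr fun d => ?_
    simp only [Function.comp]
    norm_cast
  have t2 : Tendsto (fun d : ℕ => √(P.k d * (P.mstar d : ℝ) * Real.log (d : ℝ) ^ 2 / d)) atTop
      (𝓝 0) := by
    have h := hkm.tendsto_div_nhds_zero
    have h2 := (Real.continuous_sqrt.tendsto 0).comp h
    rwa [Real.sqrt_zero] at h2
  have t3 := t1.add t2
  rw [add_zero] at t3
  refine squeeze_zero' ?_ ?_ t3
  · filter_upwards [hR] with d hR
    exact mul_nonneg (psi_nonneg hR) (by linarith [hR.one_le_log])
  · filter_upwards [hR, hO.bound] with d hR hb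
    have hd : (0 : ℝ) < d := by exact_mod_cast hR.d_pos
    have hm : (2 : ℝ) ≤ P.mstar d := by exact_mod_cast hR.two_le_m
    have hk := hR.two_le_k
    have hl := hR.one_le_log
    rw [Real.norm_of_nonneg (by positivity), Real.norm_of_nonneg (by positivity),
      Real.rpow_sub hd] at hb
    have hkd : P.k d ≤ d := by
      calc P.k d = P.k d * 1 * 1 ^ 2 := by ring
        _ ≤ P.k d * P.mstar d * Real.log d ^ 2 := by gcongr; linarith
        _ ≤ d := hR.sparse
    have hlk : Real.log (P.k d) ≤ Real.log d := Real.log_le_log (by linarith) hkd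
    have hlk0 : 0 ≤ Real.log (P.k d) := Real.log_nonneg (by linarith)
    unfold Model.psi
    rw [add_mul]
    refine add_le_add ?_ ?_
    · have h2 : (d : ℝ) ^ (2 : ℝ) = (d : ℝ) ^ 2 := by norm_cast
      rw [h2] at hb
      calc (P.H d : ℝ) * P.mstar d ^ 3 * P.k d ^ 3 * Real.log (P.k d) ^ 2 / d ^ 2 * Real.log d
          ≤ P.H d * P.mstar d ^ 3 * P.k d ^ 3 * Real.log d ^ 2 / d ^ 2 * Real.log d := by gcongr
        _ = (P.H d * P.k d ^ 3 * P.mstar d ^ 3) * (Real.log d ^ 3 / d ^ 2) := by ring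
        _ ≤ (A * (d ^ 2 / d ^ τ)) * (Real.log d ^ 3 / d ^ 2) := by gcongr
        _ = _ := by field_simp
    · have h1 : Real.log d = √(Real.log d ^ 2) := (Real.sqrt_sq (by linarith)).symm
      nth_rewrite 1 [h1]
      rw [← Real.sqrt_mul (by positivity)]
      refine Real.sqrt_le_sqrt ?_
      rw [div_mul_eq_mul_div]
      gcongr
      have : (1 : ℝ) ≤ P.mstar d := by linarith
      exact le_mul_of_one_le_right (by linarith) this

theorem tendsto_psi (hR : ∀ᶠ d in atTop, Regime P d c C)
    (hkm : (fun d : ℕ => P.k d * (P.mstar d : ℝ) * Real.log (d : ℝ) ^ 2)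
      =o[atTop] fun d : ℕ => (d : ℝ)) (hM : P.Moderate) : Tendsto P.psi atTop (𝓝 0) := by
  refine squeeze_zero' ?_ ?_ (tendsto_psi_mul_log hR hkm hM)
  · filter_upwards [hR] with d hR using psi_nonneg hR
  · filter_upwards [hR] with d hR using le_mul_of_one_le_right (psi_nonneg hR) hR.one_le_log

/-- The number `d / m*` of full groups tends to infinity, since `m* log² d ≤ d`. -/
theorem eventually_factorial (hR : ∀ᶠ d in atTop, Regime P d c C) :
    ∀ᶠ d in atTop, 0 < d / P.mstar d ∧
      4 ^ (d / P.mstar d + 1) ≤ (d / P.mstar d).factorial := by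
  have h1 : Tendsto (fun d => d / P.mstar d) atTop atTop := by
    refine tendsto_atTop.2 fun b => ?_
    filter_upwards [hR, tendsto_log_natCast.eventually_ge_atTop (b : ℝ)] with d hR hl
    have hm := hR.two_le_m
    have hk := hR.two_le_k
    rw [Nat.le_div_iff_mul_le (by omega)]
    have h1 := hR.one_le_log
    have h2 : (b : ℝ) * P.mstar d ≤ d := by
      calc (b : ℝ) * P.mstar d = 1 * P.mstar d * b := by ring
        _ ≤ P.k d * P.mstar d * Real.log d ^ 2 := by
            gcongr
            · linarith
            · nlinarith
        _ ≤ d := hR.sparse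
    exact_mod_cast h2
  have h2 : ∀ᶠ n : ℕ in atTop, 4 ^ (n + 1) ≤ n.factorial := by
    have h := (FloorSemiring.tendsto_pow_div_factorial_atTop (4 : ℝ)).eventually_le_const
      (by norm_num : (0 : ℝ) < 1 / 4)
    filter_upwards [h] with n hn
    rw [div_le_iff₀ (by positivity)] at hn
    have : (4 : ℝ) ^ (n + 1) ≤ n.factorial := by rw [pow_succ]; linarith
    exact_mod_cast this
  exact (h1.eventually_gt_atTop 0).and (h1.eventually h2)

/-- The attack gap is of the order `1 / log d`. -/
theorem attack_bounds (hR : ∀ᶠ d in atTop, Regime P d c C) {ε : ℕ → ℝ} (h0 : ∀ d, 0 ≤ ε d)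
    (hε : ε =Θ[atTop] fun d : ℕ => 1 / (Real.log (d : ℝ) * P.rootMK d)) :
    ∃ a b : ℝ, 0 < a ∧ 0 < b ∧ ∀ᶠ d in atTop,
      a ≤ ε d * P.rootMK d * Real.log d ∧ ε d * P.rootMK d * Real.log d ≤ b := by
  obtain ⟨b, hb, h1⟩ := hε.1.exists_pos
  obtain ⟨a, ha, h2⟩ := hε.2.exists_pos
  refine ⟨1 / a, b, by positivity, hb, ?_⟩
  filter_upwards [hR, h1.bound, h2.bound] with d hR h1 h2
  have hl : 0 < Real.log d := by linarith [hR.one_le_log]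
  have hr := rootMK_pos hR
  rw [Real.norm_of_nonneg (h0 d), Real.norm_of_nonneg (by positivity)] at h1 h2
  rw [mul_one_div, le_div_iff₀ (by positivity)] at h1
  rw [div_le_iff₀ (by positivity)] at h2
  constructor
  · rw [div_le_iff₀ ha]; linarith
  · linarith

/-- The attack is eventually smaller than the margin of the gating, which is of order
`1 / √log d`. -/
theorem tendsto_mul_rootMK (hR : ∀ᶠ d in atTop, Regime P d c C) {ε : ℕ → ℝ} (h0 : ∀ d, 0 ≤ ε d)
    (hε : ε =Θ[atTop] fun d : ℕ => 1 / (Real.log (d : ℝ) * P.rootMK d)) :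
    Tendsto (fun d => ε d * P.rootMK d * √(Real.log d)) atTop (𝓝 0) := by
  obtain ⟨a, b, -, hb, h⟩ := attack_bounds hR h0 hε
  have t : Tendsto (fun d : ℕ => b / √(Real.log (d : ℝ))) atTop (𝓝 0) :=
    tendsto_const_nhds.div_atTop tendsto_sqrt_log_natCast
  refine squeeze_zero' ?_ ?_ t
  · filter_upwards [hR] with d hR
    exact mul_nonneg (mul_nonneg (h0 d) (rootMK_pos hR).le) (Real.sqrt_nonneg _)
  · filter_upwards [hR, h] with d hR h
    have hl := hR.one_le_log
    rw [le_div_iff₀ (Real.sqrt_pos.2 (by linarith)), mul_assoc,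
      Real.mul_self_sqrt (by linarith)]
    exact h.2

theorem psi_isLittleO (hR : ∀ᶠ d in atTop, Regime P d c C)
    (hkm : (fun d : ℕ => P.k d * (P.mstar d : ℝ) * Real.log (d : ℝ) ^ 2)
      =o[atTop] fun d : ℕ => (d : ℝ)) {ε : ℕ → ℝ} (h0 : ∀ d, 0 ≤ ε d)
    (hε : ε =Θ[atTop] fun d : ℕ => 1 / (Real.log (d : ℝ) * P.rootMK d)) (hM : P.Moderate) :
    P.psi =o[atTop] fun d : ℕ => ε d * P.rootMK d := by
  obtain ⟨a, b, ha, -, h⟩ := attack_bounds hR h0 hε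
  refine IsLittleO.of_bound fun η hη => ?_
  have t := (tendsto_psi_mul_log hR hkm hM).eventually_le_const (by positivity : 0 < η * a)
  filter_upwards [hR, h, t] with d hR h t
  have hl : 0 < Real.log d := by linarith [hR.one_le_log]
  rw [Real.norm_of_nonneg (psi_nonneg hR),
    Real.norm_of_nonneg (mul_nonneg (h0 d) (rootMK_pos hR).le)]
  refine le_of_mul_le_mul_right ?_ hl
  calc P.psi d * Real.log d ≤ η * a := t
    _ ≤ η * (ε d * P.rootMK d * Real.log d) := by gcongr; exact h.1
    _ = _ := by ring

end Asymptotics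

/-! ### Comparison of the risks -/

section Comparison

variable {P : Model} {c C : ℝ}

theorem groupNumber_bounds {d : ℕ} (hG : 0 < d / P.mstar d) :
    0 < groupNumber P d ∧ groupNumber P d ≤ d := by
  refine ⟨Nat.add_pos_left hG _, ?_⟩
  have hm : 0 < P.mstar d := by
    by_contra h
    simp [Nat.eq_zero_of_not_pos h] at hG
  have h1 := Nat.div_add_mod d (P.mstar d)
  have h2 : d / P.mstar d ≤ P.mstar d * (d / P.mstar d) := Nat.le_mul_of_pos_left _ hm
  unfold groupNumber
  omega

/-- No network of the class has a smaller adversarial risk than the true score. -/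
theorem eventually_oracleRisk_le (hP : P.SparseCoding) (hR : ∀ᶠ d in atTop, Regime P d c C)
    {N : ∀ d : ℕ, Network d (P.H d)} (hN : P.InClass N) (ℓ : LossKind) :
    ∀ᶠ d in atTop, ∀ e : ℝ, 0 ≤ e → P.oracleRisk ℓ d ≤ P.risk ℓ e (N d) := by
  filter_upwards [hR, hN.features, hN.same_sign] with d hR h1 h2 e he
  exact oracleRisk_le_risk hP hR.d_pos (fun h => (h1 h).1) h2 ℓ he

theorem integrable_advLoss_of_inClass (hP : P.SparseCoding) {N : ∀ d : ℕ, Network d (P.H d)}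
    (hN : P.InClass N) (ℓ : LossKind) :
    ∀ᶠ d in atTop, ∀ e : ℝ,
      Integrable (fun w => advLoss ℓ e (N d) w.2.1 w.2.2) (P.dataLaw ℓ d) := by
  filter_upwards [eventually_gt_atTop 0, hN.features] with d hd h1 e
  obtain ⟨i, h⟩ := integrable_advLoss hP hd (fun h => (h1 h).1) ℓ e
  exact i.congr h.symm

/-- The clean risk of a group network is optimal up to the error term. -/
theorem exists_clean_bound (hP : P.SparseCoding) (hc : 0 < c) (ℓ : LossKind) :
    ∃ K, 0 < K ∧ ∀ (d Γ : ℕ) (φ : Fin d → Fin Γ), Regime P d c C → 0 < Γ → Γ ≤ d →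
      Admissible P φ → |P.risk ℓ 0 (groupNetwork P φ) - P.oracleRisk ℓ d| ≤ K * P.psi d := by
  obtain ⟨K, hK, h⟩ := exists_abs_risk_sub_le (C := C) hP ℓ hc
  refine ⟨K * 2, by positivity, fun d Γ φ hR h1 h2 hA => ?_⟩
  have h3 := h d Γ φ 0 hR h1 (h2.trans hR.nodes) hA le_rfl (by simp)
  have h4 := errOrder_le_psi hR
  simp only [zero_mul, sub_zero, ne_eq, OfNat.ofNat_ne_zero, not_false_eq_true, zero_pow,
    add_zero] at h3
  calc _ ≤ K * errOrder P d := h3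
    _ ≤ K * (2 * P.psi d) := by gcongr
    _ = _ := by ring

/-- The risk of an attacked group network exceeds the optimal clean risk by the order of the attack
at most. -/
theorem exists_robust_upper (hP : P.SparseCoding) (hc : 0 < c) (ℓ : LossKind) :
    ∃ K, 0 < K ∧ ∀ (d Γ : ℕ) (φ : Fin d → Fin Γ) (ε : ℝ), Regime P d c C → 0 < Γ → Γ ≤ d →
      Admissible P φ → 0 ≤ ε → ε * P.rootMK d * √(Real.log d) ≤ 1 →
      P.risk ℓ ε (groupNetwork P φ) ≤
        P.oracleRisk ℓ d + K * (ε * P.rootMK d) + K * P.psi d := by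
  obtain ⟨K, hK, h⟩ := exists_abs_risk_sub_le (C := C) hP ℓ hc
  obtain ⟨W, hW0, hW⟩ := exists_attackWeight_le ℓ P.s
  refine ⟨W * √(C ^ 3) + 2 * K, by positivity, fun d Γ φ ε hR h1 h2 hA hε0 hε => ?_⟩
  have h3 := (abs_le.1 (h d Γ φ ε hR h1 (h2.trans hR.nodes) hA hε0 hε)).2
  have h4 := errOrder_le_psi hR
  have hψ := psi_nonneg hR
  have h5 := attackCost_le hP hR ℓ hW0.le hW hA
  have hr := rootMK_pos hR
  have hx : 0 ≤ ε * P.rootMK d := mul_nonneg hε0 hr.le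
  have hl : 1 ≤ √(Real.log d) := Real.one_le_sqrt.2 hR.one_le_log
  have hx1 : ε * P.rootMK d ≤ 1 := (le_mul_of_one_le_right hx hl).trans hε
  rw [← rootMK_sq hR, ← mul_pow] at h3
  have h6 : (ε * P.rootMK d) ^ 2 ≤ ε * P.rootMK d := by
    rw [sq]; exact mul_le_of_le_one_left hx hx1
  have h7 : ε * attackCost P ℓ φ ≤ W * √(C ^ 3) * (ε * P.rootMK d) := by
    calc ε * attackCost P ℓ φ ≤ ε * (W * (√(C ^ 3) * P.rootMK d)) := by gcongr
      _ = _ := by ring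
  have h8 : K * (errOrder P d + (ε * P.rootMK d) ^ 2) ≤
      K * (2 * P.psi d + ε * P.rootMK d) := by gcongr
  have h9 : 0 ≤ W * √(C ^ 3) * P.psi d := by positivity
  have h10 := mul_nonneg hK.le hx
  linarith

/-- The network which learns the features separately is more robust than the networks with groups
of the maximal size, by the order of the attack. -/
theorem exists_robust_lower (hP : P.SparseCoding) (hc : 0 < c) (hC : 0 < C) (ℓ : LossKind) :
    ∃ κ η K, 0 < κ ∧ 0 < η ∧ 0 < K ∧ ∀ (d : ℕ), ∀ φ ∈ fullGroupings P d, ∀ ε : ℝ,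
      Regime P d c C → 0 < groupNumber P d → groupNumber P d ≤ d → 0 ≤ ε →
      ε * P.rootMK d * √(Real.log d) ≤ 1 → ε * P.rootMK d * √(Real.log d) ≤ η →
      κ * (ε * P.rootMK d) - K * P.psi d ≤
        P.risk ℓ ε (groupNetwork P φ) - P.risk ℓ ε (groupNetwork P (id : Fin d → Fin d)) := by
  obtain ⟨K, hK, h⟩ := exists_abs_risk_sub_le (C := C) hP ℓ hc
  obtain ⟨κ, hκ, hgap⟩ := exists_attackCost_gap hP ℓ hc hC
  refine ⟨κ / 2, κ / (4 * K), 4 * K, by positivity, by positivity, by positivity, ?_⟩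
  intro d φ hφ ε hR h1 h2 hε0 hε hεη
  have hf := (abs_le.1 (h d _ φ ε hR h1 (h2.trans hR.nodes) hφ.1 hε0 hε)).1
  have hp := (abs_le.1 (h d d id ε hR hR.d_pos hR.nodes (admissible_id hR) hε0 hε)).2
  have hg := hgap d _ φ hR hφ.1 hφ.2
  have h4 := errOrder_le_psi hR
  have hr := rootMK_pos hR
  have hx : 0 ≤ ε * P.rootMK d := mul_nonneg hε0 hr.le
  have hl : 1 ≤ √(Real.log d) := Real.one_le_sqrt.2 hR.one_le_log
  have hx1 : ε * P.rootMK d ≤ κ / (4 * K) := (le_mul_of_one_le_right hx hl).trans hεη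
  rw [← rootMK_sq hR, ← mul_pow] at hf hp
  have h5 : ε * attackCost P ℓ (id : Fin d → Fin d) + κ * (ε * P.rootMK d) ≤
      ε * attackCost P ℓ φ := by
    have := mul_le_mul_of_nonneg_left hg hε0
    linarith
  -- The second-order effect of the attack takes at most half of the first-order gap.
  have h6 : 2 * K * (ε * P.rootMK d) ^ 2 ≤ κ / 2 * (ε * P.rootMK d) := by
    calc 2 * K * (ε * P.rootMK d) ^ 2 = 2 * K * (ε * P.rootMK d) * (ε * P.rootMK d) := by ring
      _ ≤ 2 * K * (κ / (4 * K)) * (ε * P.rootMK d) := by gcongr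
      _ = _ := by field_simp; norm_num
  have h7 : 2 * (K * errOrder P d) ≤ 4 * K * P.psi d := by
    have := mul_le_mul_of_nonneg_left h4 hK.le
    linarith
  linarith

end Comparison

end FeaturePurification

theorem mainTheorem2 (P : FeaturePurification.Model) (hP : P.SparseCoding)
    (hk : ∀ᶠ d in atTop, 2 ≤ P.k d)
    (hm : ∀ᶠ d in atTop, 2 ≤ P.mstar d)
    (hkm : (fun d : ℕ => P.k d * (P.mstar d : ℝ) * Real.log (d : ℝ) ^ 2)
      =o[atTop] fun d : ℕ => (d : ℝ))
    (hH : (fun d : ℕ => (d : ℝ)) =o[atTop] fun d : ℕ => (P.H d : ℝ)) :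
    -- the error term vanishes in the moderate regime
    (P.Moderate → Tendsto P.psi atTop (𝓝 0)) ∧
    -- all risks in question are expectations of integrable losses
    (∀ ℓ : FeaturePurification.LossKind,
      (∀ᶠ d in atTop, Integrable
        (fun w => ℓ.loss (P.score d w.1) w.2.2) (P.dataLaw ℓ d)) ∧
      ∀ N : ∀ d : ℕ, FeaturePurification.Network d (P.H d), P.InClass N →
        ∀ᶠ d in atTop, ∀ e : ℝ, Integrable
          (fun w => FeaturePurification.advLoss ℓ e (N d) w.2.1 w.2.2) (P.dataLaw ℓ d)) ∧
    -- many networks of the class with `U a = θ₀`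
    ∃ S : ∀ d : ℕ, Set (FeaturePurification.Network d (P.H d)),
      (∀ᶠ d in atTop, 2 ^ d ≤ (P.supportPattern '' S d).ncard) ∧
      (∀ N : ∀ d : ℕ, FeaturePurification.Network d (P.H d),
        (∀ᶠ d in atTop, N d ∈ S d) → P.InClass N) ∧
      (∀ᶠ d in atTop, ∀ N ∈ S d, P.Matches N) ∧
      ∀ ℓ : FeaturePurification.LossKind,
        -- good clean performance
        (∃ C : ℝ, 0 < C ∧
          (∀ᶠ d in atTop, ∀ N ∈ S d,
            |P.risk ℓ 0 N - P.oracleRisk ℓ d| ≤ C * P.psi d) ∧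
          ∀ N' : ∀ d : ℕ, FeaturePurification.Network d (P.H d), P.InClass N' →
            ∀ᶠ d in atTop, ∀ N ∈ S d,
              P.risk ℓ 0 N ≤ P.risk ℓ 0 (N' d) + C * P.psi d) ∧
        -- poor robustness
        ∀ ε : ℕ → ℝ, (∀ d, 0 ≤ ε d) →
          (ε =Θ[atTop] fun d : ℕ => 1 / (Real.log (d : ℝ) * P.rootMK d)) →
          (P.Moderate → P.psi =o[atTop] fun d : ℕ => ε d * P.rootMK d) ∧
          ∃ c C : ℝ, 0 < c ∧ 0 < C ∧
            (∀ N' : ∀ d : ℕ, FeaturePurification.Network d (P.H d), P.InClass N' →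
              ∀ᶠ d in atTop, ∀ N ∈ S d,
                P.risk ℓ (ε d) N - P.risk ℓ (ε d) (N' d)
                  ≤ C * (ε d * P.rootMK d) + C * P.psi d) ∧
            ∃ N' : ∀ d : ℕ, FeaturePurification.Network d (P.H d), P.InClass N' ∧
              ∀ᶠ d in atTop, ∀ N ∈ S d,
                c * (ε d * P.rootMK d) - C * P.psi d
                  ≤ P.risk ℓ (ε d) N - P.risk ℓ (ε d) (N' d) := by
  obtain ⟨c, C, hc, hC, hR⟩ := FeaturePurification.exists_regime hP hk hm hkm hH
  have hF := FeaturePurification.eventually_factorial hR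
  have hΓ : ∀ᶠ d in atTop, 0 < FeaturePurification.groupNumber P d ∧
      FeaturePurification.groupNumber P d ≤ d :=
    hF.mono fun d h => FeaturePurification.groupNumber_bounds h.1
  refine ⟨FeaturePurification.tendsto_psi hR hkm, fun ℓ =>
    ⟨Eventually.of_forall fun d => FeaturePurification.integrable_oracle hP ℓ d,
      fun N hN => FeaturePurification.integrable_advLoss_of_inClass hP hN ℓ⟩,
    fun d => FeaturePurification.groupNetwork P '' FeaturePurification.fullGroupings P d,
    ?_, ?_, ?_, fun ℓ => ⟨?_, ?_⟩⟩
  · filter_upwards [hR, hF] with d hR hF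
    exact FeaturePurification.two_pow_le_ncard hP (hR.coef_ne_zero hc) hR.two_le_m hR.nodes
      hF.2 hF.1
  · intro N hN
    refine FeaturePurification.inClass_groupNetwork hP hc hR hkm hΓ (hN.mono ?_)
    rintro d ⟨φ, hφ, h⟩
    exact ⟨φ, hφ.1, h.symm⟩
  · filter_upwards [hR, hΓ] with d hR hΓ
    rintro _ ⟨φ, -, rfl⟩
    exact FeaturePurification.matches_groupNetwork hP (hΓ.2.trans hR.nodes) φ
  · obtain ⟨K, hK, h⟩ := FeaturePurification.exists_clean_bound (C := C) hP hc ℓ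
    refine ⟨K, hK, ?_, fun N' hN' => ?_⟩
    · filter_upwards [hR, hΓ] with d hR hΓ
      rintro _ ⟨φ, hφ, rfl⟩
      exact h d _ φ hR hΓ.1 hΓ.2 hφ.1
    · filter_upwards [hR, hΓ, FeaturePurification.eventually_oracleRisk_le hP hR hN' ℓ] with
        d hR hΓ hN'
      rintro _ ⟨φ, hφ, rfl⟩
      have h1 := (abs_le.1 (h d _ φ hR hΓ.1 hΓ.2 hφ.1)).2
      have h2 := hN' 0 le_rfl
      linarith
  · intro ε hε0 hε
    refine ⟨FeaturePurification.psi_isLittleO hR hkm hε0 hε, ?_⟩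
    have ht := FeaturePurification.tendsto_mul_rootMK hR hε0 hε
    obtain ⟨K₁, hK₁, h₁⟩ := FeaturePurification.exists_robust_upper (C := C) hP hc ℓ
    obtain ⟨κ, η, K₂, hκ, hη, hK₂, h₂⟩ := FeaturePurification.exists_robust_lower hP hc hC ℓ
    refine ⟨κ, max K₁ K₂, hκ, lt_max_of_lt_left hK₁, fun N' hN' => ?_,
      fun d => FeaturePurification.groupNetwork P (id : Fin d → Fin d), ?_, ?_⟩
    · filter_upwards [hR, hΓ, FeaturePurification.eventually_oracleRisk_le hP hR hN' ℓ,
        ht.eventually_le_const one_pos] with d hR hΓ hN' hε1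
      rintro _ ⟨φ, hφ, rfl⟩
      have h1 := h₁ d _ φ (ε d) hR hΓ.1 hΓ.2 hφ.1 (hε0 d) hε1
      have h2 := hN' (ε d) (hε0 d)
      have h3 : 0 ≤ ε d * P.rootMK d :=
        mul_nonneg (hε0 d) (FeaturePurification.rootMK_pos hR).le
      have h4 := mul_le_mul_of_nonneg_right (le_max_left K₁ K₂) h3
      have h5 := mul_le_mul_of_nonneg_right (le_max_left K₁ K₂)
        (FeaturePurification.psi_nonneg hR)
      linarith
    · refine FeaturePurification.inClass_groupNetwork hP hc hR hkm (Γ := fun d => d) ?_ ?_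
      · filter_upwards [hR] with d hR using ⟨hR.d_pos, le_rfl⟩
      · filter_upwards [hR] with d hR
        exact ⟨id, FeaturePurification.admissible_id hR, rfl⟩
    · filter_upwards [hR, hΓ, ht.eventually_le_const one_pos, ht.eventually_le_const hη] with
        d hR hΓ hε1 hεη
      rintro _ ⟨φ, hφ, rfl⟩
      have h1 := h₂ d φ hφ (ε d) hR hΓ.1 hΓ.2 (hε0 d) hε1 hεη
      have h5 := mul_le_mul_of_nonneg_right (le_max_right K₁ K₂)
        (FeaturePurification.psi_nonneg hR)
      linarith
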